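/- \textbf{Theorem.} Conventions. Algorithms are deterministic programs for the word RAM: unit-cost arithmetic, comparison and bitwise operations, direct memory access, words of $O(\log s)$ bits where $s$ is the length of the input plus its largest entry. An $h$-uniform (hyper)graph with $n$ vertices and $m$ (hyper)edges is given by $n$, $m$ and an arbitrary list of its (hyper)edges. Solving a problem in time $O(T)$ means that one program solves all instances in at most $C\,(T+1)$ steps for a constant $C$. \emph{Partial $k$-Dominating Set} asks, given a graph $G=(V,E)$, for the maximum of $|N[v_1]\cup\dots\cup N[v_k]|$ over $v_1,\dots,v_k\in V$, where $N[v]$ is the closed neighborhood of $v$. The number $\omega$ is the exponent of matrix multiplication, the infimum of all $\tau$ such that two $n\times n$ matrices over $\mathbb{Q}$ can be multiplied with $O(n^\tau)$ arithmetic operations. Hypotheses. \begin{itemize} \item \emph{$k$-Clique Hypothesis}: for no $\varepsilon>0$ and $k\ge 3$ can it be decided in time $O(n^{k\omega/3-\varepsilon})$ whether a graph with $n$ vertices contains a clique of size $k$. \item \emph{$h$-Uniform $k$-Hyperclique Hypothesis}, for a given $h\ge 3$: for no $\varepsilon>0$ and $k\ge h+1$ can it be decided in time $O(n^{k-\varepsilon})$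 whether an $h$-uniform hypergraph with $n$ vertices contains $k$ vertices all of whose $h$-element subsets are hyperedges. \item \emph{$k$-OV Hypothesis}, for a given $k\geq 2$: for no $\varepsilon,\delta>0$ can it be decided in time $O(n^{k-\varepsilon})$, given families $A_1,\dots,A_k$ of $n$ vectors each from $\{0,1\}^d$ with $d\le n^{\delta}$, whether there are $a_1\in A_1,\dots,a_k\in A_k$ with $\sum_{y=1}^d a_1[y]\cdots a_k[y]=0$. (Refuting this form refutes the hypothesis also for $d=\omega(\log n)$ and for $d=n^{o(1)}$.) \end{itemize} Claims. Suppose that, for some $\varepsilon>0$, Partial $k$-Dominating Set on graphs with $n$ vertices and $m$ edges can be solved in time $O(n+m+T(n,m))$; this holds in particular if it can be solved in time $O(T(n,m))$. \begin{enumerate} \item If $k\ge 3$ and $T(n,m)=\min\{n,m^{2/3}\}^{k\omega/3-\varepsilon}$, then the $k$-Clique Hypothesis is false. \item If $k>h\ge 3$ and $T(n,m)=\min\{n,m^{h/(2h-1)}\}^{k-\varepsilon}$, then the $h$-Uniform $k$-Hyperclique Hypothesis is false. \item If $k\ge 2$ and $T(n,m)=\min\{n,m^{k/(2k-1)}\}^{k-\varepsilon}$,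 then the $k$-OV Hypothesis is false. \item If $k\ge 3$ and $T(n,m)=m\,n^{k-2-\varepsilon}$, then the $k$-OV Hypothesis is false. \item If $k\ge 3$ and $T(n,m)=m^{3k/5-\varepsilon}$, then the $3$-Uniform $k$-Hyperclique Hypothesis is false. \end{enumerate} -/

import Mathlib

namespace FineGrained

/-! ### The machine model: a structured word RAM

The machine has registers and a random access memory, both holding natural numbers.
Every executed instruction and every evaluated test costs one step.  The semantics is relative
to a bound `W`: a computation that tries to produce a number `≥ W` (a number that does not
fit into a machine word) has no run. -/

/-- The arithmetic, comparison and bitwise operations of the word RAM. -/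
inductive BinOp where
  | add | sub | mul | div | mod | lt | eq | and | or | xor | shl | shr

/-- `sub` is truncated; comparisons return `1` for true and `0` for false. -/
def BinOp.eval : BinOp → ℕ → ℕ → ℕ
  | .add, a, b => a + b
  | .sub, a, b => a - b
  | .mul, a, b => a * b
  | .div, a, b => a / b
  | .mod, a, b => a % b
  | .lt, a, b => if a < b then 1 else 0
  | .eq, a, b => if a = b then 1 else 0
  | .and, a, b => Nat.land a b
  | .or, a, b => Nat.lor a b
  | .xor, a, b => Nat.xor a b
  | .shl, a, b => a <<< b
  | .shr, a, b => a >>> b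

/-- RAM programs; the numbers `r a b` are names of registers. -/
inductive Prog where
  /-- do nothing -/
  | skip : Prog
  /-- `r := v` -/
  | const (r v : ℕ) : Prog
  /-- `r := o(a, b)` -/
  | op (o : BinOp) (r a b : ℕ) : Prog
  /-- `r := mem[a]` -/
  | load (r a : ℕ) : Prog
  /-- `mem[a] := b` -/
  | store (a b : ℕ) : Prog
  /-- first `p`, then `q` -/
  | seq (p q : Prog) : Prog
  /-- if register `r` is nonzero then `p` else `q` -/
  | ite (r : ℕ) (p q : Prog) : Prog
  /-- while register `r` is nonzero do `p` -/
  | loop (r : ℕ) (p : Prog) : Prog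

/-- A configuration: the contents of the registers and of the memory. -/
structure State where
  reg : ℕ → ℕ
  mem : ℕ → ℕ

def State.setReg (s : State) (r v : ℕ) : State :=
  { s with reg := Function.update s.reg r v }

def State.setMem (s : State) (a v : ℕ) : State :=
  { s with mem := Function.update s.mem a v }

/-- `Run W p s t s'`: started in `s`, the program `p` halts in `s'` after exactly `t` steps,
and every number it computes on the way is less than `W`. -/
inductive Run (W : ℕ) : Prog → State → ℕ → State → Prop where
  | skip (s : State) : Run W .skip s 1 s
  | const (r v : ℕ) (s : State) (hv : v < W) : Run W (.const r v) s 1 (s.setReg r v)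
  | op (o : BinOp) (r a b : ℕ) (s : State) (hv : o.eval (s.reg a) (s.reg b) < W) :
      Run W (.op o r a b) s 1 (s.setReg r (o.eval (s.reg a) (s.reg b)))
  | load (r a : ℕ) (s : State) : Run W (.load r a) s 1 (s.setReg r (s.mem (s.reg a)))
  | store (a b : ℕ) (s : State) : Run W (.store a b) s 1 (s.setMem (s.reg a) (s.reg b))
  | seq {p q : Prog} {s s' s'' : State} {t t' : ℕ} (hp : Run W p s t s')
      (hq : Run W q s' t' s'') : Run W (.seq p q) s (t + t') s''
  | ite_pos {r : ℕ} {p q : Prog} {s s' : State} {t : ℕ} (hr : s.reg r ≠ 0)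
      (hp : Run W p s t s') : Run W (.ite r p q) s (t + 1) s'
  | ite_zero {r : ℕ} {p q : Prog} {s s' : State} {t : ℕ} (hr : s.reg r = 0)
      (hq : Run W q s t s') : Run W (.ite r p q) s (t + 1) s'
  | loop_zero {r : ℕ} {p : Prog} {s : State} (hr : s.reg r = 0) : Run W (.loop r p) s 1 s
  | loop_pos {r : ℕ} {p : Prog} {s s' s'' : State} {t t' : ℕ} (hr : s.reg r ≠ 0)
      (hp : Run W p s t s') (hl : Run W (.loop r p) s' t' s'') :
      Run W (.loop r p) s (t + t' + 1) s''

/-- The initial configuration: the input occupies the first cells of the memory, everything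
else is zero. -/
def initState (l : List ℕ) : State where
  reg := fun _ => 0
  mem := fun i => l.getD i 0

/-- The size of an input: its length plus its largest entry. -/
def inputSize (l : List ℕ) : ℕ := l.length + l.foldr max 0

/-- A computational problem whose answers are natural numbers (`1` and `0` stand for yes and no
in a decision problem), with an encoding of the instances as sequences of numbers. -/
structure Problem where
  Instance : Type
  encode : Instance → List ℕ
  answer : Instance → ℕ

/-- `P` is solved by an algorithm in time `O(T)`: some program, on every instance `x`, halts
after at most `C * (T x + 1)` steps with the answer in register `0`, and uses only words of
`O(log (input size))` bits, that is, numbers polynomially bounded in the input size. -/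
def SolvableInTime (P : Problem) (T : P.Instance → ℝ) : Prop :=
  ∃ (p : Prog) (C c : ℕ), ∀ x : P.Instance, ∃ (t : ℕ) (s : State),
    Run ((inputSize (P.encode x) + 2) ^ c) p (initState (P.encode x)) t s ∧
      s.reg 0 = P.answer x ∧ (t : ℝ) ≤ C * (T x + 1)

/-! ### Graph problems -/

/-- A simple graph on the vertex set `Fin n`, given by an arbitrary enumeration of its edges
(each edge occurs once, smaller endpoint first). -/
structure GraphInput where
  n : ℕ
  graph : SimpleGraph (Fin n)
  edges : List (Fin n × Fin n)
  nodup : edges.Nodup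
  mem_edges : ∀ u v, (u, v) ∈ edges ↔ u < v ∧ graph.Adj u v

/-- The number of edges. -/
noncomputable def GraphInput.m (x : GraphInput) : ℕ := x.graph.edgeSet.ncard

theorem GraphInput.length_edges (x : GraphInput) : x.edges.length = x.m := by
  classical
  have h : x.graph.edgeSet = ((x.edges.toFinset.image (fun e => s(e.1, e.2)) :
      Finset (Sym2 (Fin x.n))) : Set (Sym2 (Fin x.n))) := by
    ext e
    induction e using Sym2.ind with
    | _ u v =>
      simp only [SimpleGraph.mem_edgeSet, Finset.coe_image, List.coe_toFinset, Set.mem_image,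
        Set.mem_ofPred_eq, Prod.exists]
      constructor
      · intro huv
        rcases lt_or_gt_of_ne huv.ne with h | h
        · exact ⟨u, v, (x.mem_edges u v).2 ⟨h, huv⟩, rfl⟩
        · exact ⟨v, u, (x.mem_edges v u).2 ⟨h, huv.symm⟩, Sym2.eq_swap⟩
      · rintro ⟨a, b, hab, he⟩
        have := ((x.mem_edges a b).1 hab).2
        rwa [← SimpleGraph.mem_edgeSet, he, SimpleGraph.mem_edgeSet] at this
  rw [GraphInput.m, h, Set.ncard_coe_finset, Finset.card_image_of_injOn,
    List.toFinset_card_of_nodup x.nodup]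
  rintro ⟨a, b⟩ hab ⟨c, d⟩ hcd he
  simp only [List.coe_toFinset, Set.mem_ofPred_eq, x.mem_edges] at hab hcd
  rcases Sym2.eq_iff.1 he with ⟨h1, h2⟩ | ⟨h1, h2⟩
  · simp only at h1 h2
    rw [h1, h2]
  · simp only at h1 h2
    subst h1 h2
    exact absurd hab.1 (not_lt.2 hcd.1.le)

/-- The encoding `n, m, u₁, v₁, …, uₘ, vₘ`. -/
def GraphInput.encode (x : GraphInput) : List ℕ :=
  x.n :: x.edges.length :: x.edges.flatMap (fun e => [(e.1 : ℕ), (e.2 : ℕ)])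

open Classical in
/-- The set of vertices dominated by `y₁, …, y_k`: the union of their closed neighborhoods. -/
noncomputable def dominated {n k : ℕ} (G : SimpleGraph (Fin n)) (y : Fin k → Fin n) :
    Finset (Fin n) :=
  Finset.univ.filter (fun v => ∃ i, v = y i ∨ G.Adj (y i) v)

/-- Partial `k`-Dominating Set: compute the largest number of vertices that can be dominated by
`k` vertices. -/
noncomputable def partialDominatingSet (k : ℕ) : Problem where
  Instance := GraphInput
  encode := GraphInput.encode
  answer := fun x => Finset.univ.sup (fun y : Fin k → Fin x.n => (dominated x.graph y).card)

open Classical in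
/-- `k`-Clique Detection. -/
noncomputable def cliqueDetection (k : ℕ) : Problem where
  Instance := GraphInput
  encode := GraphInput.encode
  answer := fun x => if ∃ S : Finset (Fin x.n), x.graph.IsNClique k S then 1 else 0

/-! ### Hyperclique detection -/

/-- An `h`-uniform hypergraph on the vertex set `Fin n`, given by an arbitrary enumeration of
its hyperedges. -/
structure HypergraphInput (h : ℕ) where
  n : ℕ
  edges : List (Finset (Fin n))
  nodup : edges.Nodup
  uniform : ∀ e ∈ edges, e.card = h

/-- The encoding: `n`, the number of hyperedges, and the `h` vertices of each hyperedge. -/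
def HypergraphInput.encode {h : ℕ} (x : HypergraphInput h) : List ℕ :=
  x.n :: x.edges.length :: x.edges.flatMap (fun e => (e.sort (· ≤ ·)).map Fin.val)

open Classical in
/-- `h`-Uniform `k`-Hyperclique Detection: are there `k` vertices all of whose `h`-element
subsets are hyperedges? -/
noncomputable def hypercliqueDetection (h k : ℕ) : Problem where
  Instance := HypergraphInput h
  encode := HypergraphInput.encode
  answer := fun x =>
    if ∃ S : Finset (Fin x.n), S.card = k ∧ ∀ e ⊆ S, e.card = h → e ∈ x.edges then 1 else 0

/-! ### Orthogonal vectors -/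

/-- `k` families of `n` vectors from `{0,1}^d`. -/
structure OVInput (k : ℕ) where
  n : ℕ
  d : ℕ
  vec : Fin k → Fin n → Fin d → Bool

/-- The encoding: `n`, `d`, and the coordinates of all vectors, family by family and vector by
vector. -/
def OVInput.encode {k : ℕ} (x : OVInput k) : List ℕ :=
  x.n :: x.d :: (List.finRange k).flatMap fun i => (List.finRange x.n).flatMap fun j =>
    (List.finRange x.d).map fun y => (x.vec i j y).toNat

open Classical in
/-- `k`-Orthogonal Vectors on instances with `d ≤ n ^ δ`: can one choose one vector from each
family such that the sum over all coordinates of the product of their entries is zero? -/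
noncomputable def orthogonalVectors (k : ℕ) (δ : ℝ) : Problem where
  Instance := {x : OVInput k // (x.d : ℝ) ≤ (x.n : ℝ) ^ δ}
  encode := fun x => x.1.encode
  answer := fun x =>
    if ∃ a : Fin k → Fin x.1.n, ∑ y, ∏ i, (x.1.vec i (a i) y).toNat = 0 then 1 else 0

/-! ### The exponent of matrix multiplication -/

/-- The entries of the two factors, as functions of the pair of matrices. -/
def matrixInputs (n : ℕ) : Set (Matrix (Fin n) (Fin n) ℚ × Matrix (Fin n) (Fin n) ℚ → ℚ) :=
  {f | ∃ i j, (f = fun M => M.1 i j) ∨ (f = fun M => M.2 i j)}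

/-- `g` is a straight-line program with the given inputs: each of its functions is a constant,
or the sum, the difference or the product of two inputs or earlier functions. -/
def IsStraightLine {X : Type} {T : ℕ} (inputs : Set (X → ℚ)) (g : Fin T → X → ℚ) : Prop :=
  ∀ t, (∃ c : ℚ, g t = fun _ => c) ∨
    ∃ a ∈ inputs ∪ g '' {s | s < t}, ∃ b ∈ inputs ∪ g '' {s | s < t},
      g t = a + b ∨ g t = a - b ∨ g t = a * b

/-- Two `n × n` matrices can be multiplied with `T` arithmetic operations. -/
def MatMulInOps (n T : ℕ) : Prop :=
  ∃ g : Fin T → Matrix (Fin n) (Fin n) ℚ × Matrix (Fin n) (Fin n) ℚ → ℚ,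
    IsStraightLine (matrixInputs n) g ∧
      ∀ i j, (fun M => (M.1 * M.2) i j) ∈ matrixInputs n ∪ Set.range g

/-- The exponent `ω` of matrix multiplication: the infimum of the reals `τ` such that `n × n`
matrices can be multiplied with `O(n ^ τ)` arithmetic operations. -/
noncomputable def matMulExponent : ℝ :=
  sInf {τ : ℝ | ∃ C : ℝ, ∀ n : ℕ, ∃ T : ℕ, MatMulInOps n T ∧ (T : ℝ) ≤ C * (n : ℝ) ^ τ}

/-! ### The hardness hypotheses -/

/-- The `k`-Clique Hypothesis: for no `ε > 0` and `k ≥ 3` can `k`-Clique Detection be solved in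
time `O(n ^ (k * ω / 3 - ε))`. -/
def CliqueHypothesis : Prop :=
  ∀ ε : ℝ, 0 < ε → ∀ k : ℕ, 3 ≤ k →
    ¬ SolvableInTime (cliqueDetection k)
      (fun x : GraphInput => (x.n : ℝ) ^ (k * matMulExponent / 3 - ε))

/-- The `h`-Uniform `k`-Hyperclique Hypothesis, for a given `h ≥ 3`: for no `ε > 0` and
`k ≥ h + 1` can `h`-Uniform `k`-Hyperclique Detection be solved in time `O(n ^ (k - ε))`. -/
def HypercliqueHypothesis (h : ℕ) : Prop :=
  ∀ ε : ℝ, 0 < ε → ∀ k : ℕ, h + 1 ≤ k →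
    ¬ SolvableInTime (hypercliqueDetection h k)
      (fun x : HypergraphInput h => (x.n : ℝ) ^ ((k : ℝ) - ε))

/-- The `k`-OV Hypothesis, in its weakest form (the one whose refutation says most): for no
`ε, δ > 0` can `k`-OV on instances with `d ≤ n ^ δ` be solved in time `O(n ^ (k - ε))`. -/
def OVHypothesis (k : ℕ) : Prop :=
  ∀ ε : ℝ, 0 < ε → ∀ δ : ℝ, 0 < δ →
    ¬ SolvableInTime (orthogonalVectors k δ)
      (fun x => (x.1.n : ℝ) ^ ((k : ℝ) - ε))

/-- Partial `k`-Dominating Set on graphs with `n` vertices and `m` edges can be solved in time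
`O(n + m + T(n, m))`. -/
def PDSInTime (k : ℕ) (T : ℝ → ℝ → ℝ) : Prop :=
  SolvableInTime (partialDominatingSet k)
    (fun x : GraphInput => (x.n : ℝ) + x.m + T x.n x.m)

end FineGrained

open FineGrained

/-! All five claims come from one reduction of a constraint problem to Partial `k`-Dominating Set.
There are `k` groups of `N` candidates. In each of `d` layers a candidate gives values from `[q]` to
its `g` slots. For every active placement, that is, every active map of `h` positions into slots,
the tuple of values must satisfy a relation; the task is to choose one candidate per group. The
gadget graph is bipartite, between candidates and elements; an element is a layer, a block and a
tuple from `[q]^h`.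

A placement together with a set `J` of positions is a block. An allowed tuple `x` is joined to
candidates only in the blocks with `J` odd, a forbidden one only in those with `J` even. A choice
with values `w` dominates `x` there iff `x` and `w` agree somewhere on `J`. Equally many odd and
even sets meet the agreement set, unless it contains every position; then the odd sets win by one
(`card_odd_inter`). So a choice of one candidate per group dominates a fixed number of vertices plus
one for each satisfied placement (`sum_card_constraint`, `domCount_choice`).

Other choices must not reach the same count. The union bound for the constraint blocks has the same
value for all choices of candidates (`load_eq`) and by Bonferroni (`hitCount_lower`) exceeds the
true count by only `O(q^(h-2))`. In each forcing block two candidates of one group overlap in at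
least `q^(h-2)` elements, and a chosen element gives up at least `q^(h-1)` forced elements per copy
while dominating only `O(q^(h-1))` candidates. Hence constantly many copies of the forcing blocks
suffice (`domCount_lt`), and comparing the optimum with a threshold decides the constraint problem
(`threshold_le_domCount_iff`).

The graph has `O(d(N + q^h))` vertices and `O(d N q^(h-1))` edges. For hypercliques with `k * h`
vertices a candidate is an `h`-tuple of vertices, so `q = n + 1` and `N = q^h`: `O(n^h)` vertices
and `O(n^(2h-1))` edges. Cliques are the case `h = 2`. For `k`-OV the layers are coordinates, `h =
k`, `g = 1`, and a value is a bit together with one of about `n^(1/k)` labels: `O(n^(1+δ))` vertices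
and `O(n^(2-1/k+δ))` edges. Substituting these sizes into `T` gives the claims. The cost of writing
the graph stays below the target time; for cliques this uses `two_le_matMulExponent`.

On the machine side, a small command language with accounting of time and word size is compiled to
RAM programs (`Cmd.Exec.run`). Its commands write the graph in time linear in the bound on the edges
(`GadgetCode.tri_buildCmd`), and `SolvableInTime.of_gadget` packages the reduction. -/

namespace FineGrained

/-! ### Registers and word size of a run -/

/-- A strict upper bound on the registers occurring in a program. -/
def Prog.regBound : Prog → ℕ
  | .skip => 0
  | .const r _ => r + 1
  | .op _ r a b => max (r + 1) (max (a + 1) (b + 1))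
  | .load r a => max (r + 1) (a + 1)
  | .store a b => max (a + 1) (b + 1)
  | .seq p q => max p.regBound q.regBound
  | .ite r p q => max (r + 1) (max p.regBound q.regBound)
  | .loop r p => max (r + 1) p.regBound

theorem Run.mono {W W' : ℕ} (hW : W ≤ W') {p : Prog} {s s' : State} {t : ℕ}
    (h : Run W p s t s') : Run W' p s t s' := by
  induction h with
  | skip s => exact .skip s
  | const r v s hv => exact .const r v s (hv.trans_le hW)
  | op o r a b s hv => exact .op o r a b s (hv.trans_le hW)
  | load r a s => exact .load r a s
  | store a b s => exact .store a b s
  | seq _ _ ih ih' => exact .seq ih ih'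
  | ite_pos hr _ ih => exact .ite_pos hr ih
  | ite_zero hr _ ih => exact .ite_zero hr ih
  | loop_zero hr => exact .loop_zero hr
  | loop_pos hr _ _ ih ih' => exact .loop_pos hr ih ih'

theorem Run.reg_eq {W : ℕ} {p : Prog} {s s' : State} {t : ℕ} (h : Run W p s t s') :
    ∀ r, p.regBound ≤ r → s'.reg r = s.reg r := by
  induction h with
  | skip s => exact fun _ _ => rfl
  | const r v s hv =>
    intro r' hr'
    simp only [Prog.regBound] at hr'
    exact Function.update_of_ne (by omega) _ _
  | op o r a b s hv =>
    intro r' hr'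
    simp only [Prog.regBound] at hr'
    exact Function.update_of_ne (by omega) _ _
  | load r a s =>
    intro r' hr'
    simp only [Prog.regBound] at hr'
    exact Function.update_of_ne (by omega) _ _
  | store a b s => exact fun _ _ => rfl
  | seq _ _ ih ih' =>
    intro r hr
    simp only [Prog.regBound, max_le_iff] at hr
    rw [ih' r hr.2, ih r hr.1]
  | ite_pos _ _ ih =>
    intro r hr
    simp only [Prog.regBound, max_le_iff] at hr
    exact ih r hr.2.1
  | ite_zero _ _ ih =>
    intro r hr
    simp only [Prog.regBound, max_le_iff] at hr
    exact ih r hr.2.2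
  | loop_zero _ => exact fun _ _ => rfl
  | loop_pos _ _ _ ih ih' =>
    intro r hr
    rw [ih' r hr]
    simp only [Prog.regBound, max_le_iff] at hr
    exact ih r hr.2

/-- A register that `p` does not mention is invisible to it. Thus the threshold can wait in a spare
register while the given program for Partial Dominating Set runs as if from its initial state. -/
theorem Run.setReg {W : ℕ} {p : Prog} {s s' : State} {t : ℕ} (h : Run W p s t s') (z v : ℕ)
    (hz : p.regBound ≤ z) : Run W p (s.setReg z v) t (s'.setReg z v) := by
  have comm : ∀ (s : State) (r w : ℕ), r ≠ z →
      (s.setReg r w).setReg z v = (s.setReg z v).setReg r w := by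
    intro s r w hr
    simp only [State.setReg]
    rw [Function.update_comm hr]
  have get : ∀ (s : State) (r : ℕ), r ≠ z → (s.setReg z v).reg r = s.reg r := by
    intro s r hr
    exact Function.update_of_ne hr _ _
  induction h with
  | skip s => exact .skip _
  | const r w s hv =>
    simp only [Prog.regBound] at hz
    rw [comm _ _ _ (by omega)]
    exact .const r w _ hv
  | op o r a b s hv =>
    simp only [Prog.regBound, max_le_iff] at hz
    have h := Run.op (W := W) o r a b (s.setReg z v)
    rw [get s a (by omega), get s b (by omega)] at h
    rw [comm _ _ _ (by omega)]
    exact h hv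
  | load r a s =>
    simp only [Prog.regBound, max_le_iff] at hz
    have h := Run.load (W := W) r a (s.setReg z v)
    rw [get s a (by omega)] at h
    rw [comm _ _ _ (by omega)]
    exact h
  | store a b s =>
    simp only [Prog.regBound, max_le_iff] at hz
    have h := Run.store (W := W) a b (s.setReg z v)
    rw [get s a (by omega), get s b (by omega)] at h
    exact h
  | seq _ _ ih ih' =>
    simp only [Prog.regBound, max_le_iff] at hz
    exact .seq (ih hz.1) (ih' hz.2)
  | ite_pos hr _ ih =>
    simp only [Prog.regBound, max_le_iff] at hz
    exact .ite_pos (by rwa [get _ _ (by omega)]) (ih hz.2.1)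
  | ite_zero hr _ ih =>
    simp only [Prog.regBound, max_le_iff] at hz
    exact .ite_zero (by rwa [get _ _ (by omega)]) (ih hz.2.2)
  | loop_zero hr =>
    simp only [Prog.regBound, max_le_iff] at hz
    exact .loop_zero (by rwa [get _ _ (by omega)])
  | loop_pos hr _ _ ih ih' =>
    have hz' := hz
    simp only [Prog.regBound, max_le_iff] at hz'
    exact .loop_pos (by rwa [get _ _ (by omega)]) (ih hz'.2) (ih' hz)

/-! ### Expressions and commands -/

/-- The operations used in expressions. -/
inductive ArithOp where
  | add | sub | mul | div | mod | lt | eq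

/-- The machine operation. -/
def ArithOp.toBinOp : ArithOp → BinOp
  | .add => .add
  | .sub => .sub
  | .mul => .mul
  | .div => .div
  | .mod => .mod
  | .lt => .lt
  | .eq => .eq

/-- No operation kept in expressions grows faster than a product; left shifts, which do, are
excluded. So the values of a fixed expression are polynomial in the entries of the state. -/
theorem ArithOp.eval_lt (o : ArithOp) (a b : ℕ) :
    o.toBinOp.eval a b < 2 * ((a + 1) * (b + 1)) := by
  have h1 : 1 ≤ (a + 1) * (b + 1) := Nat.mul_pos a.succ_pos b.succ_pos
  have h2 : a + b + a * b + 1 = (a + 1) * (b + 1) := by ring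
  have h3 := Nat.div_le_self a b
  have h4 := Nat.mod_le a b
  cases o <;> simp only [ArithOp.toBinOp, BinOp.eval]
  · omega
  · omega
  · omega
  · omega
  · omega
  · split_ifs <;> omega
  · split_ifs <;> omega

/-- Expressions over sixteen named registers and the memory. -/
inductive Expr where
  | reg (r : Fin 16)
  | lit (v : ℕ)
  | bin (o : ArithOp) (a b : Expr)
  | load (a : Expr)

/-- A state of the named registers and the memory. -/
structure AState where
  reg : Fin 16 → ℕ
  mem : ℕ → ℕ

def AState.setReg (s : AState) (r : Fin 16) (v : ℕ) : AState :=
  { s with reg := Function.update s.reg r v }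

def AState.setMem (s : AState) (a v : ℕ) : AState :=
  { s with mem := Function.update s.mem a v }

@[simp] theorem AState.setReg_reg (s : AState) (r : Fin 16) (v : ℕ) :
    (s.setReg r v).reg r = v := Function.update_self _ _ _

theorem AState.setReg_reg_of_ne (s : AState) {r r' : Fin 16} (v : ℕ) (h : r' ≠ r) :
    (s.setReg r v).reg r' = s.reg r' := Function.update_of_ne h _ _

@[simp] theorem AState.setReg_mem (s : AState) (r : Fin 16) (v : ℕ) :
    (s.setReg r v).mem = s.mem := rfl

@[simp] theorem AState.setMem_reg (s : AState) (a v : ℕ) : (s.setMem a v).reg = s.reg := rfl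

@[simp] theorem AState.setMem_mem (s : AState) (a v : ℕ) :
    (s.setMem a v).mem = Function.update s.mem a v := rfl

/-- All entries are below `V`. -/
def AState.Bdd (V : ℕ) (s : AState) : Prop := (∀ r, s.reg r < V) ∧ ∀ a, s.mem a < V

namespace Expr

def eval : Expr → AState → ℕ
  | .reg r, s => s.reg r
  | .lit v, _ => v
  | .bin o a b, s => o.toBinOp.eval (a.eval s) (b.eval s)
  | .load a, s => s.mem (a.eval s)

/-- Machine code that evaluates an expression into register `r`, using the registers above `r`. -/
def code : Expr → ℕ → Prog
  -- The machine has no move instruction; the bitwise conjunction of a register with itself copies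
  -- it.
  | .reg a, r => .op .and r a a
  | .lit v, r => .const r v
  | .bin o a b, r => .seq (a.code r) (.seq (b.code (r + 1)) (.op o.toBinOp r r (r + 1)))
  | .load a, r => .seq (a.code r) (.load r r)

def steps : Expr → ℕ
  | .reg _ => 1
  | .lit _ => 1
  | .bin _ a b => a.steps + (b.steps + 1)
  | .load a => a.steps + 1

/-- The values of an expression are bounded by this power of the entries of the state. -/
def deg : Expr → ℕ
  | .reg _ => 1
  | .lit v => v
  | .bin _ a b => 1 + (a.deg + b.deg)
  | .load a => a.deg + 1

theorem eval_lt {V : ℕ} (hV : 2 ≤ V) {s : AState} (hs : s.Bdd V) (e : Expr) :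
    e.eval s < V ^ e.deg := by
  induction e with
  | reg r => simpa [eval, deg] using hs.1 r
  | lit v => exact Nat.lt_pow_self (by omega)
  | bin o a b iha ihb =>
    simp only [eval, deg, pow_add, pow_one]
    calc o.toBinOp.eval (a.eval s) (b.eval s) < 2 * ((a.eval s + 1) * (b.eval s + 1)) :=
          o.eval_lt _ _
      _ ≤ V * (V ^ a.deg * V ^ b.deg) := by
          gcongr
          · exact iha
          · exact ihb
  | load a ih =>
    simp only [eval, deg]
    calc s.mem (a.eval s) < V := hs.2 _
      _ = V ^ 1 := (pow_one V).symm
      _ ≤ V ^ (a.deg + 1) := Nat.pow_le_pow_right (by omega) (by omega)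

end Expr

/-- The machine state `m` represents `s`. -/
def Sim (s : AState) (m : State) : Prop := (∀ r : Fin 16, m.reg r = s.reg r) ∧ m.mem = s.mem

/-- The registers from `r` on serve as an evaluation stack, so the named registers and the partial
results below `r` survive. -/
theorem Expr.run_code {V W : ℕ} (hV : 2 ≤ V) {s : AState} (hs : s.Bdd V) (e : Expr) :
    ∀ (r : ℕ) (m : State), 16 ≤ r → V ^ e.deg ≤ W → Sim s m →
      ∃ m', Run W (e.code r) m e.steps m' ∧ m'.mem = m.mem ∧ (∀ r' < r, m'.reg r' = m.reg r') ∧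
        m'.reg r = e.eval s := by
  have hlt : ∀ e : Expr, V ^ e.deg ≤ W → e.eval s < W := fun e h => (e.eval_lt hV hs).trans_le h
  induction e with
  | reg a =>
    intro r m hr hW hm
    have h := Run.op (W := W) .and r a a m
    have h' : BinOp.eval .and (m.reg a) (m.reg a) = s.reg a := by
      simp only [BinOp.eval]
      rw [hm.1 a]
      exact Nat.and_self _
    rw [h'] at h
    exact ⟨_, h (hlt _ hW), rfl, fun r' hr' => Function.update_of_ne (by omega) _ _,
      Function.update_self _ _ _⟩
  | lit v =>
    intro r m hr hW hm
    exact ⟨_, .const r v m (hlt _ hW), rfl, fun r' hr' => Function.update_of_ne (by omega) _ _,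
      Function.update_self _ _ _⟩
  | bin o a b iha ihb =>
    intro r m hr hW hm
    have hd : V ^ a.deg ≤ W ∧ V ^ b.deg ≤ W := by
      simp only [deg] at hW
      exact ⟨(Nat.pow_le_pow_right (by omega) (by omega)).trans hW,
        (Nat.pow_le_pow_right (by omega) (by omega)).trans hW⟩
    obtain ⟨m1, h1, h1m, h1r, h1v⟩ := iha r m hr hd.1 hm
    have hm1 : Sim s m1 := ⟨fun r' => by rw [h1r _ (by omega), hm.1], by rw [h1m, hm.2]⟩
    obtain ⟨m2, h2, h2m, h2r, h2v⟩ := ihb (r + 1) m1 (by omega) hd.2 hm1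
    have h := Run.op (W := W) o.toBinOp r r (r + 1) m2
    rw [h2r r (by omega), h1v, h2v] at h
    refine ⟨_, .seq h1 (.seq h2 (h (hlt (.bin o a b) hW))), ?_, ?_, Function.update_self _ _ _⟩
    · simp only [State.setReg]
      rw [h2m, h1m]
    · intro r' hr'
      have : r' ≠ r := by omega
      simp only [State.setReg]
      rw [Function.update_of_ne this, h2r r' (by omega), h1r r' hr']
  | load a ih =>
    intro r m hr hW hm
    have hd : V ^ a.deg ≤ W := (Nat.pow_le_pow_right (by omega) (by simp [deg])).trans hW
    obtain ⟨m1, h1, h1m, h1r, h1v⟩ := ih r m hr hd hm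
    refine ⟨_, .seq h1 (.load r r m1), h1m, ?_, ?_⟩
    · intro r' hr'
      have : r' ≠ r := by omega
      simp only [State.setReg]
      rw [Function.update_of_ne this, h1r r' hr']
    · simp only [State.setReg]
      rw [Function.update_self, h1v, h1m, hm.2]
      rfl

/-- Commands of a small imperative language. -/
inductive Cmd where
  | nop
  | assign (r : Fin 16) (e : Expr)
  | store (a e : Expr)
  | seq (c d : Cmd)
  | ite (e : Expr) (c d : Cmd)
  | while (e : Expr) (c : Cmd)

namespace Cmd

/-- Registers 16 and above are scratch space. A loop evaluates its test once before entry and again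
at the end of each round. -/
def code : Cmd → Prog
  | .nop => .skip
  | .assign r e => .seq (e.code 16) (.op .and r 16 16)
  | .store a e => .seq (a.code 16) (.seq (e.code 17) (.store 16 17))
  | .seq c d => .seq c.code d.code
  | .ite e c d => .seq (e.code 16) (.ite 16 c.code d.code)
  | .while e c => .seq (e.code 16) (.loop 16 (.seq c.code (e.code 16)))

/-- The number of machine steps per step of the command. -/
def cost : Cmd → ℕ
  | .nop => 1
  | .assign _ e => e.steps + 1
  | .store a e => a.steps + (e.steps + 1)
  | .seq c d => c.cost + d.cost
  | .ite e c d => e.steps + 1 + (c.cost + d.cost)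
  | .while e c => e.steps + 1 + c.cost

def deg : Cmd → ℕ
  | .nop => 1
  | .assign _ e => e.deg + 1
  | .store a e => a.deg + e.deg
  | .seq c d => c.deg + d.deg
  | .ite e c d => e.deg + (c.deg + d.deg)
  | .while e c => e.deg + c.deg

/-- Big-step semantics: every value that is stored in a named register or in the memory is
below `V`; the number is an upper bound on the number of steps. -/
inductive Exec (V : ℕ) : Cmd → AState → ℕ → AState → Prop where
  | nop (s : AState) : Exec V .nop s 1 s
  | assign (r : Fin 16) (e : Expr) (s : AState) (h : e.eval s < V) :
      Exec V (.assign r e) s 1 (s.setReg r (e.eval s))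
  | store (a e : Expr) (s : AState) (h : e.eval s < V) :
      Exec V (.store a e) s 1 (s.setMem (a.eval s) (e.eval s))
  | seq {c d : Cmd} {s s' s'' : AState} {t t' : ℕ} (hc : Exec V c s t s')
      (hd : Exec V d s' t' s'') : Exec V (.seq c d) s (t + t') s''
  | ite_pos {e : Expr} {c d : Cmd} {s s' : AState} {t : ℕ} (he : e.eval s ≠ 0)
      (hc : Exec V c s t s') : Exec V (.ite e c d) s (t + 1) s'
  | ite_zero {e : Expr} {c d : Cmd} {s s' : AState} {t : ℕ} (he : e.eval s = 0)
      (hd : Exec V d s t s') : Exec V (.ite e c d) s (t + 1) s'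
  | while_zero {e : Expr} {c : Cmd} {s : AState} (he : e.eval s = 0) : Exec V (.while e c) s 1 s
  | while_pos {e : Expr} {c : Cmd} {s s' s'' : AState} {t t' : ℕ} (he : e.eval s ≠ 0)
      (hc : Exec V c s t s') (hl : Exec V (.while e c) s' t' s'') :
      Exec V (.while e c) s (t + t' + 1) s''
  | mono {c : Cmd} {s s' : AState} {t t' : ℕ} (h : Exec V c s t s') (ht : t ≤ t') :
      Exec V c s t' s'

theorem Exec.bdd {V : ℕ} {c : Cmd} {s s' : AState} {t : ℕ} (h : Exec V c s t s')
    (hs : s.Bdd V) : s'.Bdd V := by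
  induction h with
  | nop s => exact hs
  | assign r e s h =>
    refine ⟨fun r' => ?_, hs.2⟩
    by_cases hr : r' = r
    · subst hr
      simpa using h
    · rw [AState.setReg_reg_of_ne _ _ hr]
      exact hs.1 r'
  | store a e s h =>
    refine ⟨hs.1, fun a' => ?_⟩
    rw [AState.setMem_mem, Function.update_apply]
    split_ifs
    · exact h
    · exact hs.2 a'
  | seq _ _ ih ih' => exact ih' (ih hs)
  | ite_pos _ _ ih => exact ih hs
  | ite_zero _ _ ih => exact ih hs
  | while_zero _ => exact hs
  | while_pos _ _ _ ih ih' => exact ih' (ih hs)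
  | mono _ _ ih => exact ih hs

/-- Everything stored is below `V`, so each expression is evaluated in a bounded state and its
intermediate values stay below a fixed power of `V`, however many rounds the loops make. -/
theorem Exec.run {V W : ℕ} (hV : 2 ≤ V) {c : Cmd} {s s' : AState} {t : ℕ}
    (h : Exec V c s t s') (hs : s.Bdd V) (hW : V ^ c.deg ≤ W) (m : State) (hm : Sim s m) :
    ∃ t' m', Run W c.code m t' m' ∧ t' ≤ c.cost * t ∧ Sim s' m' := by
  have le_of_deg : ∀ {a b : ℕ}, V ^ b ≤ W → a ≤ b → V ^ a ≤ W := fun hb hab =>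
    (Nat.pow_le_pow_right (by omega) hab).trans hb
  have sim_of : ∀ {s : AState} {m m' : State}, Sim s m → m'.mem = m.mem →
      (∀ r < 16, m'.reg r = m.reg r) → Sim s m' := fun hm h1 h2 =>
    ⟨fun r => by rw [h2 r r.2, hm.1], by rw [h1, hm.2]⟩
  induction h generalizing m with
  | nop s => exact ⟨1, m, .skip m, by simp [cost], hm⟩
  | assign r e s h =>
    simp only [deg] at hW
    obtain ⟨m1, h1, h1m, h1r, h1v⟩ := e.run_code hV hs 16 m le_rfl (le_of_deg hW (by omega)) hm
    have h2 := Run.op (W := W) .and r 16 16 m1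
    have h' : BinOp.eval .and (m1.reg 16) (m1.reg 16) = e.eval s := by
      simp only [BinOp.eval]
      rw [h1v]
      exact Nat.and_self _
    rw [h'] at h2
    refine ⟨_, _, .seq h1 (h2 (h.trans_le ?_)), by simp [cost], ?_, ?_⟩
    · calc V = V ^ 1 := (pow_one V).symm
        _ ≤ W := le_of_deg hW (by omega)
    · intro r'
      have hsim := sim_of hm h1m h1r
      by_cases hr : r' = r
      · subst hr
        simp [State.setReg]
      · rw [AState.setReg_reg_of_ne _ _ hr, ← hsim.1]
        exact Function.update_of_ne (fun h => hr (Fin.ext h)) _ _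
    · rw [AState.setReg_mem, ← hm.2, ← h1m]
      rfl
  | store a e s h =>
    simp only [deg] at hW
    obtain ⟨m1, h1, h1m, h1r, h1v⟩ := a.run_code hV hs 16 m le_rfl (le_of_deg hW (by omega)) hm
    have hsim := sim_of hm h1m h1r
    obtain ⟨m2, h2, h2m, h2r, h2v⟩ :=
      e.run_code hV hs 17 m1 (by omega) (le_of_deg hW (by omega)) hsim
    refine ⟨_, _, .seq h1 (.seq h2 (.store 16 17 m2)), by simp [cost], ?_, ?_⟩
    · intro r'
      have hr' := r'.2
      simp only [State.setMem, AState.setMem_reg]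
      rw [h2r _ (by omega), hsim.1]
    · simp only [State.setMem, AState.setMem_mem]
      rw [h2m, h2v, h2r _ (by omega), h1v, hsim.2]
  | seq hc hd ih ih' =>
    simp only [deg] at hW
    obtain ⟨t1, m1, h1, ht1, hm1⟩ := ih hs (le_of_deg hW (by omega)) m hm
    obtain ⟨t2, m2, h2, ht2, hm2⟩ := ih' (hc.bdd hs) (le_of_deg hW (by omega)) m1 hm1
    refine ⟨_, m2, .seq h1 h2, ?_, hm2⟩
    simp only [cost]
    nlinarith
  | @ite_pos e c d s s' t he hc ih =>
    simp only [deg] at hW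
    obtain ⟨m1, h1, h1m, h1r, h1v⟩ := e.run_code hV hs 16 m le_rfl (le_of_deg hW (by omega)) hm
    obtain ⟨t2, m2, h2, ht2, hm2⟩ := ih hs (le_of_deg hW (by omega)) m1 (sim_of hm h1m h1r)
    refine ⟨_, m2, .seq h1 (.ite_pos (by rwa [h1v]) h2), ?_, hm2⟩
    simp only [cost]
    nlinarith
  | @ite_zero e c d s s' t he hc ih =>
    simp only [deg] at hW
    obtain ⟨m1, h1, h1m, h1r, h1v⟩ := e.run_code hV hs 16 m le_rfl (le_of_deg hW (by omega)) hm
    obtain ⟨t2, m2, h2, ht2, hm2⟩ := ih hs (le_of_deg hW (by omega)) m1 (sim_of hm h1m h1r)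
    refine ⟨_, m2, .seq h1 (.ite_zero (by rwa [h1v]) h2), ?_, hm2⟩
    simp only [cost]
    nlinarith
  | @while_zero e c s he =>
    simp only [deg] at hW
    obtain ⟨m1, h1, h1m, h1r, h1v⟩ := e.run_code hV hs 16 m le_rfl (le_of_deg hW (by omega)) hm
    refine ⟨_, m1, .seq h1 (.loop_zero (by rwa [h1v])), ?_, sim_of hm h1m h1r⟩
    simp only [cost]
    omega
  | @while_pos e c s s' s'' t t' he hc hl ih ih' =>
    have hW' := hW
    simp only [deg] at hW
    obtain ⟨m1, h1, h1m, h1r, h1v⟩ := e.run_code hV hs 16 m le_rfl (le_of_deg hW (by omega)) hm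
    obtain ⟨t2, m2, h2, ht2, hm2⟩ := ih hs (le_of_deg hW (by omega)) m1 (sim_of hm h1m h1r)
    obtain ⟨t3, m3, h3, ht3, hm3⟩ := ih' (hc.bdd hs) hW' m2 hm2
    -- The run for the remaining rounds begins with its own evaluation of the test; that evaluation,
    -- `ha`, becomes the end of the current round.
    cases h3 with
    | @seq _ _ _ m' _ u u' ha hb =>
      refine ⟨_, m3, .seq h1 (.loop_pos (by rwa [h1v]) (.seq h2 ha) hb), ?_, hm3⟩
      simp only [cost] at ht3 ⊢
      nlinarith
  | mono _ ht ih =>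
    obtain ⟨t1, m1, h1, ht1, hm1⟩ := ih hs hW m hm
    exact ⟨t1, m1, h1, ht1.trans (Nat.mul_le_mul_left _ ht), hm1⟩

/-- Total correctness: `c` started in `s` halts within `t` steps in a state satisfying `Q`. -/
def Tri (V : ℕ) (c : Cmd) (s : AState) (t : ℕ) (Q : AState → Prop) : Prop :=
  ∃ s', Exec V c s t s' ∧ Q s'

namespace Tri

variable {V : ℕ} {c d : Cmd} {s : AState} {t t' : ℕ} {Q R : AState → Prop}

theorem conseq (h : Tri V c s t Q) (ht : t ≤ t') (hQ : ∀ s, Q s → R s) : Tri V c s t' R :=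
  let ⟨s', h1, h2⟩ := h
  ⟨s', h1.mono ht, hQ s' h2⟩

theorem nop (h : Q s) : Tri V .nop s 1 Q := ⟨s, .nop s, h⟩

theorem assign {r : Fin 16} {e : Expr} (h : e.eval s < V) (hQ : Q (s.setReg r (e.eval s))) :
    Tri V (.assign r e) s 1 Q := ⟨_, .assign r e s h, hQ⟩

theorem store {a e : Expr} (h : e.eval s < V) (hQ : Q (s.setMem (a.eval s) (e.eval s))) :
    Tri V (.store a e) s 1 Q := ⟨_, .store a e s h, hQ⟩

theorem seq (h : Tri V c s t fun s' => Tri V d s' t' Q) : Tri V (.seq c d) s (t + t') Q :=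
  let ⟨_, h1, s'', h2, h3⟩ := h
  ⟨s'', .seq h1 h2, h3⟩

theorem ite {e : Expr} (h1 : e.eval s ≠ 0 → Tri V c s t Q) (h0 : e.eval s = 0 → Tri V d s t Q) :
    Tri V (.ite e c d) s (t + 1) Q := by
  by_cases he : e.eval s = 0
  · obtain ⟨s', h, hQ⟩ := h0 he
    exact ⟨s', .ite_zero he h, hQ⟩
  · obtain ⟨s', h, hQ⟩ := h1 he
    exact ⟨s', .ite_pos he h, hQ⟩

/-- The invariant is indexed by the number of finished rounds, which fixes the number of rounds at
`n`; the induction is on the rounds that remain. -/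
theorem loop {e : Expr} (I : ℕ → AState → Prop) (n : ℕ)
    (hpos : ∀ j < n, ∀ s, I j s → e.eval s ≠ 0 ∧ Tri V c s t (I (j + 1)))
    (hzero : ∀ s, I n s → e.eval s = 0) (h0 : I 0 s) :
    Tri V (.while e c) s (n * (t + 1) + 1) (I n) := by
  suffices ∀ m j s, j + m = n → I j s → Tri V (.while e c) s (m * (t + 1) + 1) (I n) from
    this n 0 s (by omega) h0
  intro m
  induction m with
  | zero =>
    intro j s hj hs
    obtain rfl : j = n := by omega
    exact ⟨s, (Exec.while_zero (hzero s hs)).mono (by omega), hs⟩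
  | succ m ih =>
    intro j s hj hs
    obtain ⟨he, s1, h1, hI⟩ := hpos j (by omega) s hs
    obtain ⟨s2, h2, hn⟩ := ih (j + 1) s1 (by omega) hI
    exact ⟨s2, (Exec.while_pos he h1 h2).mono (by rw [Nat.succ_mul]; omega), hn⟩

end Tri

end Cmd

/-! ### Reductions to Partial Dominating Set -/

/-- The initial state on input `l`. -/
def AState.init (l : List ℕ) : AState where
  reg := fun _ => 0
  mem := fun i => l.getD i 0

theorem le_foldr_max {l : List ℕ} {a : ℕ} (h : a ∈ l) : a ≤ l.foldr max 0 := by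
  induction l with
  | nil => simp at h
  | cons b l ih =>
    rcases List.mem_cons.1 h with rfl | h
    · exact le_max_left _ _
    · exact (ih h).trans (le_max_right _ _)

theorem foldr_max_le {l : List ℕ} {b : ℕ} (h : ∀ a ∈ l, a ≤ b) : l.foldr max 0 ≤ b := by
  induction l with
  | nil => exact Nat.zero_le _
  | cons c l ih =>
    exact max_le (h c (by simp)) (ih fun a ha => h a (by simp [ha]))

theorem getD_le_inputSize (l : List ℕ) (i : ℕ) : l.getD i 0 ≤ inputSize l := by
  by_cases h : i < l.length
  · rw [List.getD_eq_getElem _ _ h]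
    exact (le_foldr_max (List.getElem_mem h)).trans (Nat.le_add_left _ _)
  · rw [List.getD_eq_default _ _ (by omega)]
    exact Nat.zero_le _

/-- Set the registers below `n` to zero. -/
def clearRegs : ℕ → Prog
  | 0 => .skip
  | n + 1 => .seq (clearRegs n) (.const n 0)

theorem run_clearRegs {W : ℕ} (hW : 0 < W) (n : ℕ) (m : State) :
    ∃ m', Run W (clearRegs n) m (n + 1) m' ∧ m'.mem = m.mem ∧ (∀ r < n, m'.reg r = 0) ∧
      ∀ r, n ≤ r → m'.reg r = m.reg r := by
  induction n with
  | zero => exact ⟨m, .skip m, rfl, by simp, fun _ _ => rfl⟩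
  | succ n ih =>
    obtain ⟨m', h, hm, h0, h1⟩ := ih
    refine ⟨_, .seq h (.const n 0 m' hW), hm, ?_, ?_⟩
    · intro r hr
      simp only [State.setReg, Function.update_apply]
      split_ifs with h
      · rfl
      · exact h0 r (by omega)
    · intro r hr
      have : r ≠ n := by omega
      simp only [State.setReg]
      rw [Function.update_of_ne this, h1 r (by omega)]

/-- The command leaves the encoding of `G` in memory and a threshold in register `0`. The threshold
moves to register `z`, above all registers of both programs, and the registers below `z` are
cleared; `p` then runs exactly as on input `G`, and the final answer is `1 - [optimum < threshold]`.
-/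
theorem SolvableInTime.of_reduction {P : Problem} {k : ℕ} {T : GraphInput → ℝ}
    (hp : SolvableInTime (partialDominatingSet k) T) (c : Cmd) (a : ℕ) (K : ℝ)
    (T' : P.Instance → ℝ) (hT' : ∀ x, 0 ≤ T' x) (ha : 1 ≤ a)
    (H : ∀ x, ∃ (t : ℕ) (s : AState) (G : GraphInput),
      Cmd.Exec ((inputSize (P.encode x) + 2) ^ a) c (AState.init (P.encode x)) t s ∧
      s.mem = (fun i => G.encode.getD i 0) ∧
      P.answer x = (if s.reg 0 ≤ (partialDominatingSet k).answer G then 1 else 0) ∧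
      (t : ℝ) ≤ K * (T' x + 1) ∧ T G ≤ K * (T' x + 1)) :
    SolvableInTime P T' := by
  obtain ⟨p, C, e, hp⟩ := hp
  set z := max 16 (max c.code.regBound p.regBound) with hz
  obtain ⟨C', hC'⟩ := exists_nat_ge (c.cost * K + (z + 8) + C * (K + 1))
  refine ⟨.seq c.code (.seq (.op .and z 0 0) (.seq (clearRegs z) (.seq p
    (.seq (.op .lt (z + 1) 0 z) (.seq (.const (z + 2) 1) (.op .sub 0 (z + 2) (z + 1))))))),
    C', a * (c.deg + 1 + 4 * e), fun x => ?_⟩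
  obtain ⟨t, s, G, hex, hmem, hans, ht, hTG⟩ := H x
  set S := inputSize (P.encode x) with hS
  set V := (S + 2) ^ a with hVdef
  have hSV : S + 2 ≤ V := by
    calc S + 2 = (S + 2) ^ 1 := (pow_one _).symm
      _ ≤ V := Nat.pow_le_pow_right (by omega) ha
  have hV : 2 ≤ V := by omega
  rw [pow_mul, ← hVdef]
  set W := V ^ (c.deg + 1 + 4 * e) with hW
  have hWV : V ≤ W := by
    calc V = V ^ 1 := (pow_one _).symm
      _ ≤ W := Nat.pow_le_pow_right (by omega) (by omega)
  have hb0 : (AState.init (P.encode x)).Bdd V :=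
    ⟨fun _ => by simp only [AState.init]; omega, fun i => by
      have := getD_le_inputSize (P.encode x) i
      simp only [AState.init]
      omega⟩
  have hb := hex.bdd hb0
  obtain ⟨t1, m1, h1, ht1, hm1⟩ := hex.run (W := W) hV hb0
    (Nat.pow_le_pow_right (by omega) (by omega)) (initState (P.encode x))
    ⟨fun _ => rfl, rfl⟩
  have h1z : ∀ r, z ≤ r → m1.reg r = 0 := by
    intro r hr
    rw [h1.reg_eq r (le_trans (by simp [hz]) hr)]
    rfl
  have h2 := Run.op (W := W) .and z 0 0 m1
  have hthr : BinOp.eval .and (m1.reg 0) (m1.reg 0) = s.reg 0 := by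
    have h0 : m1.reg 0 = s.reg 0 := hm1.1 0
    simp only [BinOp.eval]
    rw [h0]
    exact Nat.and_self _
  rw [hthr] at h2
  have h2 := h2 ((hb.1 0).trans_le hWV)
  obtain ⟨m3, h3, h3m, h30, h3r⟩ := run_clearRegs (W := W) (by omega) z (m1.setReg z (s.reg 0))
  -- Apart from the saved threshold this is the initial configuration for `G`: the registers above
  -- `z` were never touched.
  have hm3 : m3 = (initState G.encode).setReg z (s.reg 0) := by
    have hr : m3.reg = ((initState G.encode).setReg z (s.reg 0)).reg := by
      funext r
      rcases lt_trichotomy r z with h | h | h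
      · rw [h30 r h]
        simp only [State.setReg]
        rw [Function.update_of_ne (by omega)]
        rfl
      · subst h
        rw [h3r _ le_rfl]
        simp [State.setReg]
      · rw [h3r r h.le]
        simp only [State.setReg]
        rw [Function.update_of_ne (by omega), Function.update_of_ne (by omega), h1z r h.le]
        rfl
    have hm : m3.mem = ((initState G.encode).setReg z (s.reg 0)).mem := by
      rw [h3m]
      simp only [State.setReg]
      rw [hm1.2, hmem]
      rfl
    cases m3
    simp only at hr hm
    subst hr hm
    rfl
  obtain ⟨t4, m4, h4, h4a, ht4⟩ := hp G
  have hn : G.n < V := by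
    have := hb.2 0
    rw [hmem] at this
    exact this
  have hm : G.edges.length < V := by
    have := hb.2 1
    rw [hmem] at this
    exact this
  -- The encoding has `2 + 2m` entries with `m < V`, none larger than `V`, so its size is linear in
  -- `V`; the power `4` absorbs the constants already for `V = 2`.
  have hsize : inputSize G.encode + 2 ≤ V ^ 4 := by
    have h1 : G.encode.length = 2 + 2 * G.edges.length := by
      simp [GraphInput.encode, List.length_flatMap]
      ring
    have h2 : G.encode.foldr max 0 ≤ V := by
      refine foldr_max_le fun b hb => ?_
      simp only [GraphInput.encode, List.mem_cons, List.mem_flatMap] at hb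
      rcases hb with rfl | rfl | ⟨⟨u, v⟩, -, hb⟩
      · exact hn.le
      · exact hm.le
      · have hu := u.2
        have hv := v.2
        simp at hb
        rcases hb with rfl | rfl <;> omega
    have h3 : V ^ 4 = V * V * V * V := by ring
    have h4 : 8 * V ≤ V * V * V * V := by
      gcongr
      calc 8 = 2 * 2 * 2 := by norm_num
        _ ≤ V * V * V := by gcongr
    unfold inputSize
    omega
  have h4 : Run W p (initState G.encode) t4 m4 := by
    refine h4.mono ?_
    calc (inputSize ((partialDominatingSet k).encode G) + 2) ^ e ≤ (V ^ 4) ^ e :=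
          Nat.pow_le_pow_left hsize e
      _ = V ^ (4 * e) := (pow_mul V 4 e).symm
      _ ≤ W := Nat.pow_le_pow_right (by omega) (by omega)
  have h4 := h4.setReg z (s.reg 0) (by simp [hz])
  rw [← hm3] at h4
  set m5 := m4.setReg z (s.reg 0) with hm5
  have hz0 : (0 : ℕ) ≠ z := by omega
  have h50 : m5.reg 0 = (partialDominatingSet k).answer G := by
    rw [← h4a, hm5]
    exact Function.update_of_ne hz0 _ _
  have h5z : m5.reg z = s.reg 0 := Function.update_self _ _ _
  have h6 := Run.op (W := W) .lt (z + 1) 0 z m5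
  have h6 := h6 (by simp only [BinOp.eval]; split_ifs <;> omega)
  set m6 := m5.setReg (z + 1) (BinOp.eval .lt (m5.reg 0) (m5.reg z)) with hm6
  have h7 := Run.const (W := W) (z + 2) 1 m6 (by omega)
  set m7 := m6.setReg (z + 2) 1 with hm7
  have h7a : m7.reg (z + 2) = 1 := Function.update_self _ _ _
  have h7b : m7.reg (z + 1) = BinOp.eval .lt (m5.reg 0) (m5.reg z) := by
    rw [hm7]
    simp only [State.setReg]
    rw [Function.update_of_ne (by omega)]
    exact Function.update_self _ _ _
  have h8 := Run.op (W := W) .sub 0 (z + 2) (z + 1) m7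
  have h8 := h8 (by simp only [BinOp.eval]; omega)
  refine ⟨_, _, .seq h1 (.seq h2 (.seq h3 (.seq h4 (.seq h6 (.seq h7 h8))))), ?_, ?_⟩
  · rw [hans]
    simp only [State.setReg]
    rw [Function.update_self, h7a, h7b, h50, h5z]
    simp only [BinOp.eval]
    by_cases h : s.reg 0 ≤ (partialDominatingSet k).answer G
    · rw [if_neg (by omega), if_pos h]
    · rw [if_pos (by omega), if_neg h]
  · have hT := hT' x
    have ht1' : (t1 : ℝ) ≤ c.cost * t := by exact_mod_cast ht1
    have e1 : (t1 : ℝ) ≤ c.cost * K * (T' x + 1) := by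
      refine ht1'.trans ?_
      rw [mul_assoc]
      gcongr
    have e2 : (t4 : ℝ) ≤ C * (K + 1) * (T' x + 1) := by
      refine ht4.trans ?_
      rw [mul_assoc]
      gcongr
      linarith
    have e3 : (z + 8 : ℝ) ≤ (z + 8) * (T' x + 1) := by
      have : (0 : ℝ) ≤ z := Nat.cast_nonneg z
      nlinarith
    have e4 : (c.cost * K + (z + 8) + C * (K + 1)) * (T' x + 1) ≤ C' * (T' x + 1) := by
      gcongr
    push_cast
    linarith

end FineGrained


/-! ### Combinatorics of the gadget graph and its domination threshold -/

namespace FineGrained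

open Finset

/-! ### Parities of sets meeting a given set -/

/-- Inserting or erasing `t` is an involution that flips the parity and preserves `p`. -/
theorem card_odd_eq_card_even {α : Type*} [Fintype α] [DecidableEq α] (p : Finset α → Prop)
    [DecidablePred p] (t : α) (hp : ∀ J, t ∉ J → (p (insert t J) ↔ p J)) :
    #{J : Finset α | Odd #J ∧ p J} = #{J : Finset α | ¬ Odd #J ∧ p J} := by
  have flip : ∀ J : Finset α, (Odd #(if t ∈ J then J.erase t else insert t J) ↔ ¬ Odd #J) ∧
      (p (if t ∈ J then J.erase t else insert t J) ↔ p J) := by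
    intro J
    split_ifs with h
    · have h1 := card_erase_add_one h
      have h2 := hp (J.erase t) (notMem_erase t J)
      rw [insert_erase h] at h2
      exact ⟨by rw [← h1, Nat.odd_add_one]; tauto, h2.symm⟩
    · rw [card_insert_of_notMem h, Nat.odd_add_one]
      exact ⟨Iff.rfl, hp J h⟩
  have inv : ∀ J : Finset α, (if t ∈ (if t ∈ J then J.erase t else insert t J) then
      (if t ∈ J then J.erase t else insert t J).erase t else
      insert t (if t ∈ J then J.erase t else insert t J)) = J := by
    intro J
    by_cases h : t ∈ J
    · simp [h]
    · simp [h]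
  refine card_nbij' (fun J => if t ∈ J then J.erase t else insert t J)
    (fun J => if t ∈ J then J.erase t else insert t J) ?_ ?_ ?_ ?_
  · intro J hJ
    simp only [coe_filter, mem_univ, true_and, Set.mem_ofPred_eq] at hJ ⊢
    rw [(flip J).1, (flip J).2]
    exact ⟨not_not.2 hJ.1, hJ.2⟩
  · intro J hJ
    simp only [coe_filter, mem_univ, true_and, Set.mem_ofPred_eq] at hJ ⊢
    rw [(flip J).1, (flip J).2]
    exact hJ
  · exact fun J _ => inv J
  · exact fun J _ => inv J

/-- If some `t` is missing from `S`, toggling `t` does not affect whether a set meets `S`. If `S` is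
everything, meeting it means being nonempty, and only the even sets lose a member, the empty set. -/
theorem card_odd_inter {α : Type*} [Fintype α] [DecidableEq α] [Nonempty α] (S : Finset α) :
    #{J : Finset α | Odd #J ∧ ∃ t ∈ J, t ∈ S} =
      #{J : Finset α | ¬ Odd #J ∧ ∃ t ∈ J, t ∈ S} + if S = univ then 1 else 0 := by
  split_ifs with hS
  · subst hS
    obtain ⟨t⟩ := ‹Nonempty α›
    have h := card_odd_eq_card_even (fun _ : Finset α => True) t (by simp)
    simp only [and_true] at h
    have h1 : #{J : Finset α | Odd #J ∧ ∃ t ∈ J, t ∈ univ} = #{J : Finset α | Odd #J} := by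
      congr 1
      ext J
      simp only [mem_univ, and_true, mem_filter, true_and, and_iff_left_iff_imp]
      intro hJ
      exact card_pos.1 hJ.pos
    have h2 : ({J : Finset α | ¬ Odd #J ∧ ∃ t ∈ J, t ∈ univ} : Finset (Finset α)) =
        ({J : Finset α | ¬ Odd #J} : Finset (Finset α)).erase ∅ := by
      ext J
      simp only [mem_univ, and_true, mem_filter, true_and, mem_erase, ne_eq,
        ← nonempty_iff_ne_empty]
      exact and_comm
    rw [h1, h2, h, card_erase_add_one]
    simp
  · obtain ⟨t, ht⟩ : ∃ t, t ∉ S := by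
      by_contra! hc
      exact hS (eq_univ_iff_forall.2 hc)
    rw [add_zero]
    refine card_odd_eq_card_even (fun J => ∃ t ∈ J, t ∈ S) t fun J _ => ?_
    simp only [mem_insert, exists_eq_or_imp, ht, false_or]

/-! ### Counting tuples -/

/-- The number of tuples from `[q]^h` that agree with a given one in one of `j` positions. -/
def hitCount (h q j : ℕ) : ℕ := q ^ h - (q - 1) ^ j * q ^ (h - j)

section Tuples

variable {h q : ℕ}

theorem card_tuples_agree (J : Finset (Fin h)) (w : Fin h → Fin q) :
    #{x : Fin h → Fin q | ∀ t ∈ J, x t = w t} = q ^ (h - #J) := by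
  have h1 : ({x : Fin h → Fin q | ∀ t ∈ J, x t = w t} : Finset _) =
      Fintype.piFinset fun t => if t ∈ J then {w t} else univ := by
    ext x
    simp only [mem_filter, mem_univ, true_and, Fintype.mem_piFinset]
    refine forall_congr' fun t => ?_
    split_ifs with ht <;> simp [ht]
  rw [h1, Fintype.card_piFinset]
  have h2 : ∀ t, #(if t ∈ J then {w t} else (univ : Finset (Fin q))) = if t ∈ J then 1 else q := by
    intro t
    split_ifs <;> simp
  simp only [h2, prod_ite, prod_const, one_pow, one_mul]
  congr 1
  rw [filter_not, filter_mem_eq_inter, univ_inter, card_sdiff_of_subset (subset_univ J)]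
  simp

theorem card_tuples_hit (J : Finset (Fin h)) (w : Fin h → Fin q) :
    #{x : Fin h → Fin q | ∃ t ∈ J, x t = w t} = hitCount h q #J := by
  have h1 : ({x : Fin h → Fin q | ∀ t ∈ J, x t ≠ w t} : Finset _) =
      Fintype.piFinset fun t => if t ∈ J then {w t}ᶜ else univ := by
    ext x
    simp only [mem_filter, mem_univ, true_and, Fintype.mem_piFinset]
    refine forall_congr' fun t => ?_
    split_ifs with ht <;> simp [ht]
  have h2 : ∀ t, #(if t ∈ J then {w t}ᶜ else (univ : Finset (Fin q))) =
      if t ∈ J then q - 1 else q := by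
    intro t
    split_ifs <;> simp [card_compl]
  have h3 : #{x : Fin h → Fin q | ∀ t ∈ J, x t ≠ w t} = (q - 1) ^ #J * q ^ (h - #J) := by
    rw [h1, Fintype.card_piFinset]
    simp only [h2, prod_ite, prod_const]
    congr 2
    · congr 1
      ext
      simp
    · rw [filter_not, filter_mem_eq_inter, univ_inter, card_sdiff_of_subset (subset_univ J)]
      simp
  have h4 := card_filter_add_card_filter_not (s := (univ : Finset (Fin h → Fin q)))
    (fun x => ∃ t ∈ J, x t = w t)
  have h5 : ({x : Fin h → Fin q | ¬ ∃ t ∈ J, x t = w t} : Finset _) =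
      ({x : Fin h → Fin q | ∀ t ∈ J, x t ≠ w t} : Finset _) := by
    ext x
    simp
  rw [h5, h3] at h4
  simp only [card_univ, Fintype.card_fun, Fintype.card_fin] at h4
  unfold hitCount
  omega

theorem card_tuples_eq (t : Fin h) (v : Fin q) :
    #{x : Fin h → Fin q | x t = v} = q ^ (h - 1) := by
  have := card_tuples_agree {t} (fun _ => v)
  simpa using this

/-- This is Bonferroni's inequality: summing over the `j` positions overcounts by at most the pairs
of positions, each worth `q ^ (h - 2)`; the number of pairs is generously bounded by `h ^ 2`. -/
theorem hitCount_lower (hq : 1 ≤ q) (hh : 2 ≤ h) {j : ℕ} (hj : j ≤ h) :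
    j * q ^ (h - 1) ≤ hitCount h q j + h ^ 2 * q ^ (h - 2) := by
  obtain ⟨p, rfl⟩ : ∃ p, q = p + 1 := ⟨q - 1, by omega⟩
  obtain ⟨m, rfl⟩ : ∃ m, h = m + 2 := ⟨h - 2, by omega⟩
  -- The inequality for `h = j`, multiplied by `q ^ 2` so that no exponent contains a subtraction. A
  -- power of `q` is multiplied in afterwards and `q ^ 2` cancelled.
  have key : ∀ j : ℕ, (p + 1) ^ 2 * p ^ j + j * (p + 1) ^ (j + 1) ≤
      (p + 1) ^ (j + 2) + j ^ 2 * (p + 1) ^ j := by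
    intro j
    induction j with
    | zero => simp
    | succ j ih =>
      have h1 := Nat.mul_le_mul_left p ih
      have h2 : 0 ≤ (p + 1) ^ j := Nat.zero_le _
      zify at h1 h2 ⊢
      have e1 : ((p : ℤ) + 1) ^ (j + 1) = (p + 1) ^ j * (p + 1) := pow_succ _ _
      have e2 : ((p : ℤ) + 1) ^ (j + 2) = (p + 1) ^ j * (p + 1) ^ 2 := pow_add _ _ _
      have e3 : ((p : ℤ) + 1) ^ (j + 3) = (p + 1) ^ j * (p + 1) ^ 3 := pow_add _ _ _
      have e4 : (p : ℤ) ^ (j + 1) = p ^ j * p := pow_succ _ _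
      rw [show j + 1 + 1 = j + 2 from rfl, show j + 1 + 2 = j + 3 from rfl]
      rw [e1, e2] at h1
      rw [e1, e2, e3, e4]
      have h3 : (0 : ℤ) ≤ (p + 1) ^ j * (j ^ 2 + (j + 1) * (p + 1)) := by positivity
      nlinarith
  have hle : p ^ j * (p + 1) ^ (m + 2 - j) ≤ (p + 1) ^ (m + 2) := by
    calc p ^ j * (p + 1) ^ (m + 2 - j) ≤ (p + 1) ^ j * (p + 1) ^ (m + 2 - j) := by gcongr; omega
      _ = (p + 1) ^ (m + 2) := by rw [← pow_add]; congr 1; omega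
  have h1 := Nat.mul_le_mul_right ((p + 1) ^ (m + 2 - j)) (key j)
  have e : ∀ i, (p + 1) ^ (j + i) * (p + 1) ^ (m + 2 - j) = (p + 1) ^ (m + 2 + i) := by
    intro i
    rw [← pow_add]
    congr 1
    omega
  have h2 : (p + 1) ^ 2 * (p ^ j * (p + 1) ^ (m + 2 - j)) + j * (p + 1) ^ (m + 2 + 1) ≤
      (p + 1) ^ (m + 2 + 2) + j ^ 2 * (p + 1) ^ (m + 2) := by
    have := e 0
    simp only [add_zero] at this
    rw [← this, ← e 1, ← e 2]
    nlinarith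
  have h3 : (p + 1) ^ 2 * (j * (p + 1) ^ (m + 1) + p ^ j * (p + 1) ^ (m + 2 - j)) ≤
      (p + 1) ^ 2 * ((p + 1) ^ (m + 2) + j ^ 2 * (p + 1) ^ m) := by
    calc _ = (p + 1) ^ 2 * (p ^ j * (p + 1) ^ (m + 2 - j)) + j * (p + 1) ^ (m + 2 + 1) := by ring
      _ ≤ _ := h2
      _ = _ := by ring
  have h4 := Nat.le_of_mul_le_mul_left h3 (by positivity)
  have h5 : j ^ 2 * (p + 1) ^ m ≤ (m + 2) ^ 2 * (p + 1) ^ m := by gcongr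
  unfold hitCount
  rw [show m + 2 - 1 = m + 1 from rfl, show m + 2 - 2 = m from rfl, show p + 1 - 1 = p from rfl]
  omega

theorem hitCount_two_lower (hq : 1 ≤ q) (hh : 2 ≤ h) : q ^ (h - 1) ≤ hitCount h q 2 := by
  obtain ⟨m, rfl⟩ : ∃ m, h = m + 2 := ⟨h - 2, by omega⟩
  have w : Fin (m + 2) → Fin q := fun _ => ⟨0, hq⟩
  have h1 := card_tuples_hit (h := m + 2) {0, 1} w
  rw [card_pair (by simp)] at h1
  rw [← h1, ← card_tuples_eq 0 (w 0)]
  exact card_le_card fun x hx => by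
    simp only [mem_filter, mem_univ, true_and] at hx ⊢
    exact ⟨0, by simp, hx⟩

end Tuples

/-- The union bound, improved by the overlap of one pair of members. -/
theorem card_biUnion_add_card_inter_le {ι α : Type*} [DecidableEq ι] [DecidableEq α] [Fintype ι]
    (A : ι → Finset α) {i j : ι} (hij : i ≠ j) :
    #(univ.biUnion A) + #(A i ∩ A j) ≤ ∑ l, #(A l) := by
  have h1 : univ.biUnion A ⊆ (A i ∪ A j) ∪ ((univ.erase i).erase j).biUnion A := by
    intro x hx
    simp only [mem_biUnion, mem_univ, true_and, mem_union, mem_erase, and_true] at hx ⊢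
    obtain ⟨l, hl⟩ := hx
    by_cases hli : l = i
    · subst hli
      exact .inl (.inl hl)
    · by_cases hlj : l = j
      · subst hlj
        exact .inl (.inr hl)
      · exact .inr ⟨l, ⟨hlj, hli⟩, hl⟩
  have h2 := (card_le_card h1).trans (card_union_le _ _)
  have h3 : #(((univ.erase i).erase j).biUnion A) ≤ ∑ l ∈ (univ.erase i).erase j, #(A l) :=
    card_biUnion_le
  have h4 := card_union_add_card_inter (A i) (A j)
  have h5 := add_sum_erase univ (fun l => #(A l)) (mem_univ i)
  have h6 := add_sum_erase (univ.erase i) (fun l => #(A l))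
    (mem_erase.2 ⟨hij.symm, mem_univ j⟩)
  omega

/-! ### The gadget graph -/

/-- Maps that place the positions of a constraint into slots (a group and a place in it). -/
abbrev SlotMap (h k g : ℕ) := Fin h → Fin k × Fin g

/-- The number of copies of the blocks that force one candidate per group. -/
def copies (h k g : ℕ) : ℕ := (k * g) ^ h * (2 ^ h * h ^ 2) + h + 1

/-- The blocks of elements: blocks forcing one candidate per group, and blocks for a placement
of a constraint together with a set of positions. -/
abbrev Block (h k g : ℕ) := (Fin k × Fin (copies h k g)) ⊕ (SlotMap h k g × Finset (Fin h))

namespace Block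

variable {h k g : ℕ}

def slot [NeZero g] : Block h k g → SlotMap h k g
  | .inl c => fun _ => (c.1, 0)
  | .inr c => c.1

def support : Block h k g → Finset (Fin h)
  | .inl _ => {t | t.val < 2}
  | .inr c => c.2

end Block

/-- Data of a constraint satisfaction instance: in layer `y`, choosing candidate `a` in the group
of the slot `s` gives the slot the value `val y s a`; for all active placements the values of the
slots must satisfy the relation. -/
structure GadgetData (h k g N q d : ℕ) where
  val : Fin d → Fin k × Fin g → Fin N → Fin q
  active : SlotMap h k g → Prop
  rel : (Fin h → Fin q) → Prop

/-- The vertices of the gadget graph: candidates and elements. -/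
abbrev GVertex (h k g N q d : ℕ) :=
  (Fin k × Fin N) ⊕ (Fin d × Block h k g × (Fin h → Fin q))

namespace GadgetData

variable {h k g N q d : ℕ} [NeZero g] (D : GadgetData h k g N q d)

/-- The elements that are joined to candidates. -/
def On : Block h k g → (Fin h → Fin q) → Prop
  | .inl _, _ => True
  | .inr c, x => Odd #c.2 ↔ (D.active c.1 → D.rel x)

/-- Adjacency of candidates and elements. -/
def Joined (i : Fin k) (a : Fin N) (y : Fin d) (b : Block h k g) (x : Fin h → Fin q) : Prop :=
  D.On b x ∧ ∃ t ∈ b.support, (b.slot t).1 = i ∧ x t = D.val y (b.slot t) a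

/-- Adjacency of vertices. -/
def Nbr : GVertex h k g N q d → GVertex h k g N q d → Prop
  | .inl c, .inr e => D.Joined c.1 c.2 e.1 e.2.1 e.2.2
  | .inr e, .inl c => D.Joined c.1 c.2 e.1 e.2.1 e.2.2
  | _, _ => False

open Classical in
/-- The number of dominated vertices. -/
noncomputable def domCount (z : Fin k → GVertex h k g N q d) : ℕ :=
  #{v | ∃ j, v = z j ∨ D.Nbr (z j) v}

section iff

variable {h k g N q d : ℕ} [NeZero g] (D : GadgetData h k g N q d)

theorem on_inl (c : Fin k × Fin (copies h k g)) (x : Fin h → Fin q) :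
    D.On (.inl c) x ↔ True := ⟨fun _ => trivial, id⟩

theorem on_inr (c : SlotMap h k g × Finset (Fin h)) (x : Fin h → Fin q) :
    D.On (.inr c) x ↔ (Odd #c.2 ↔ (D.active c.1 → D.rel x)) := ⟨id, id⟩

theorem joined_iff (i : Fin k) (a : Fin N) (y : Fin d) (b : Block h k g) (x : Fin h → Fin q) :
    D.Joined i a y b x ↔
      D.On b x ∧ ∃ t ∈ b.support, (b.slot t).1 = i ∧ x t = D.val y (b.slot t) a := ⟨id, id⟩

theorem nbr_inl_inr (c : Fin k × Fin N) (e : Fin d × Block h k g × (Fin h → Fin q)) :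
    D.Nbr (.inl c) (.inr e) ↔ D.Joined c.1 c.2 e.1 e.2.1 e.2.2 := ⟨id, id⟩

theorem nbr_inr_inl (c : Fin k × Fin N) (e : Fin d × Block h k g × (Fin h → Fin q)) :
    D.Nbr (.inr e) (.inl c) ↔ D.Joined c.1 c.2 e.1 e.2.1 e.2.2 := ⟨id, id⟩

theorem nbr_inl_inl (c c' : Fin k × Fin N) : D.Nbr (.inl c) (.inl c') ↔ False := ⟨id, False.elim⟩

theorem nbr_inr_inr (e e' : Fin d × Block h k g × (Fin h → Fin q)) :
    D.Nbr (.inr e) (.inr e') ↔ False := ⟨id, False.elim⟩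

end iff

end GadgetData

/-- The number of elements of one layer dominated by one candidate per group, without the
contributions of satisfied constraints. -/
noncomputable def baseCount (h k g q : ℕ) : ℕ :=
  k * copies h k g * hitCount h q 2 +
    (k * g) ^ h * ∑ J : Finset (Fin h), if Odd #J then 0 else hitCount h q #J

/-- The number of vertices dominated by a choice satisfying all constraints. -/
noncomputable def threshold (h k g q d : ℕ) : ℕ := k + d * (baseCount h k g q + (k * g) ^ h)

theorem Block.card_support_inl {h k g : ℕ} (hh : 2 ≤ h) (c : Fin k × Fin (copies h k g)) :
    #(Block.support (.inl c : Block h k g)) = 2 := by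
  simp only [Block.support]
  rw [show ({t : Fin h | t.val < 2} : Finset (Fin h)) = {⟨0, by omega⟩, ⟨1, by omega⟩} by
    ext t
    simp [Fin.ext_iff]
    omega]
  exact card_pair (by simp)

theorem card_filter_sum {α β : Type*} [Fintype α] [Fintype β] (p : α ⊕ β → Prop)
    [DecidablePred p] : #{v | p v} = #{a | p (.inl a)} + #{b | p (.inr b)} := by
  simp only [card_filter, Fintype.sum_sum_type]

theorem card_filter_prod {α β : Type*} [Fintype α] [Fintype β] (p : α × β → Prop)
    [DecidablePred p] : #{v | p v} = ∑ a, #{b | p (a, b)} := by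
  simp only [card_filter, Fintype.sum_prod_type]

theorem sum_ite_fst {α β : Type*} [Fintype α] [Fintype β] [DecidableEq α] (i : α) (v : ℕ) :
    (∑ e : α × β, if i = e.1 then v else 0) = Fintype.card β * v := by
  rw [Fintype.sum_prod_type, sum_comm]
  simp

/-! ### Counting the dominated vertices -/

namespace GadgetData

variable {h k g N q d : ℕ} [NeZero g] (D : GadgetData h k g N q d)

open Classical in
theorem domCount_eq (z : Fin k → GVertex h k g N q d) :
    D.domCount z = #{c | ∃ j, .inl c = z j ∨ D.Nbr (z j) (.inl c)} +
      ∑ y, ∑ b, #{x | ∃ j, .inr (y, b, x) = z j ∨ D.Nbr (z j) (.inr (y, b, x))} := by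
  unfold domCount
  rw [card_filter_sum, card_filter_prod]
  simp only [card_filter_prod]

open Classical in
-- Exchange the sums and fix `x`. Whether `x` lives in the odd or in the even blocks,
-- `card_odd_inter` for its agreement set with `w` gives the same number of blocks in which it is
-- dominated, except for `x = w`, where the odd blocks give one more.
theorem sum_card_constraint (y : Fin d) (P : SlotMap h k g) [NeZero h] (w : Fin h → Fin q) :
    ∑ J : Finset (Fin h), #{x | D.On (.inr (P, J)) x ∧ ∃ t ∈ J, x t = w t} =
      (∑ J : Finset (Fin h), if Odd #J then 0 else hitCount h q #J) +
        if D.active P → D.rel w then 1 else 0 := by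
  have h1 : ∀ x : Fin h → Fin q, ∑ J : Finset (Fin h),
      (if D.On (.inr (P, J)) x ∧ ∃ t ∈ J, x t = w t then 1 else 0) =
      (∑ J : Finset (Fin h), if ¬ Odd #J ∧ ∃ t ∈ J, x t = w t then 1 else 0) +
      if x = w then (if D.active P → D.rel w then 1 else 0) else 0 := by
    intro x
    have h2 := card_odd_inter ({t | x t = w t} : Finset (Fin h))
    have h3 : (({t | x t = w t} : Finset (Fin h)) = univ) ↔ x = w := by
      simp [funext_iff, Finset.eq_univ_iff_forall]
    simp only [h3, mem_filter, mem_univ, true_and] at h2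
    simp only [← card_filter]
    by_cases hR : D.active P → D.rel x
    · simp only [on_inr, eq_true hR, iff_true]
      rw [h2]
      by_cases hx : x = w
      · subst hx
        simpa using hR
      · simp [hx]
    · simp only [on_inr, eq_false hR, iff_false]
      by_cases hx : x = w
      · subst hx
        simp [hR]
      · simp [hx]
  simp only [card_filter]
  rw [sum_comm]
  simp only [h1, sum_add_distrib]
  congr 1
  · rw [sum_comm]
    refine sum_congr rfl fun J _ => ?_
    split_ifs with hJ
    · simp [hJ]
    · simp only [hJ, not_false_eq_true, true_and, ← card_filter]
      exact card_tuples_hit J w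
  · simp

open Classical in
-- The chosen candidates dominate no candidates but themselves, and the forcing blocks contribute
-- the same for every such choice. Only the extra unit per satisfied placement varies.
theorem domCount_choice (hh : 2 ≤ h) (c : Fin k → Fin N) :
    D.domCount (fun i => .inl (i, c i)) = k + ∑ y, (baseCount h k g q +
      #{P : SlotMap h k g | D.active P → D.rel fun t => D.val y (P t) (c (P t).1)}) := by
  have : NeZero h := ⟨by omega⟩
  rw [domCount_eq]
  congr 1
  · have h1 : ({e | ∃ j, (.inl e : GVertex h k g N q d) = .inl (j, c j) ∨
        D.Nbr (.inl (j, c j)) (.inl e)} : Finset (Fin k × Fin N)) =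
        univ.image fun j => (j, c j) := by
      ext e
      simp only [mem_filter]
      simp only [nbr_inl_inr, nbr_inr_inl, nbr_inl_inl, nbr_inr_inr, or_false, mem_univ, true_and, mem_image, Sum.inl.injEq]
      exact exists_congr fun j => eq_comm
    rw [h1, card_image_of_injective _ fun i j hij => (Prod.ext_iff.1 hij).1]
    simp
  · refine sum_congr rfl fun y _ => ?_
    have h1 : ∀ b : Block h k g, ({x | ∃ j, (.inr (y, b, x) : GVertex h k g N q d) = .inl (j, c j) ∨
        D.Nbr (.inl (j, c j)) (.inr (y, b, x))} : Finset (Fin h → Fin q)) =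
        ({x | D.On b x ∧ ∃ t ∈ b.support, x t = D.val y (b.slot t) (c (b.slot t).1)} :
          Finset (Fin h → Fin q)) := by
      intro b
      ext x
      simp only [mem_filter]
      simp only [nbr_inl_inr, nbr_inr_inl, nbr_inl_inl, nbr_inr_inr, joined_iff, reduceCtorEq, false_or, mem_univ, true_and]
      constructor
      · rintro ⟨j, h1, t, ht, rfl, hx⟩
        exact ⟨h1, t, ht, hx⟩
      · rintro ⟨h1, t, ht, hx⟩
        exact ⟨_, h1, t, ht, rfl, hx⟩
    simp only [h1]
    rw [Fintype.sum_sum_type, Fintype.sum_prod_type (f := fun e : SlotMap h k g × Finset (Fin h) => _)]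
    unfold baseCount
    rw [add_assoc]
    congr 1
    · have h2 : ∀ e : Fin k × Fin (copies h k g), #{x | D.On (.inl e) x ∧
          ∃ t ∈ Block.support (.inl e : Block h k g), x t =
            D.val y (Block.slot (.inl e : Block h k g) t)
              (c (Block.slot (.inl e : Block h k g) t).1)} = hitCount h q 2 := by
        intro e
        rw [← Block.card_support_inl hh e, ← card_tuples_hit _
          fun t => D.val y (Block.slot (.inl e : Block h k g) t)
              (c (Block.slot (.inl e : Block h k g) t).1)]
        simp [on_inl, on_inr]
      simp only [h2]
      simp [mul_assoc]
    · refine (sum_congr rfl fun P _ => D.sum_card_constraint y P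
        fun t => D.val y (P t) (c (P t).1)).trans ?_
      rw [sum_add_distrib, card_filter]
      simp [mul_comm]

/-- The number of sets of even cardinality containing `t`. -/
def evenCount {h : ℕ} (t : Fin h) : ℕ := #{J : Finset (Fin h) | ¬ Odd #J ∧ t ∈ J}

/-- Since `h ≥ 2`, the singleton of `t` is not everything, so `card_odd_inter` has no correction
term. Consequently the degree of a candidate into the constraint blocks can be bounded independently
of the relation. -/
theorem card_odd_mem (hh : 2 ≤ h) (t : Fin h) :
    #{J : Finset (Fin h) | Odd #J ∧ t ∈ J} = evenCount t := by
  have : Nonempty (Fin h) := ⟨t⟩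
  have h1 := card_odd_inter ({t} : Finset (Fin h))
  have h2 : ({t} : Finset (Fin h)) ≠ univ := by
    intro h3
    have := congrArg card h3
    simp at this
    omega
  rw [if_neg h2] at h1
  simpa [evenCount] using h1

/-- An upper bound on the number of elements of one layer of constraint blocks that are joined to
a candidate. -/
def load (h k g q : ℕ) (i : Fin k) : ℕ :=
  ∑ P : SlotMap h k g, ∑ t, if (P t).1 = i then evenCount t * q ^ (h - 1) else 0

omit [NeZero g] in
-- Swapping the two groups permutes the placements. As all groups have equal load, the union bound
-- cannot be improved by leaving a group out and using another twice.
theorem load_eq (i i' : Fin k) : load h k g q i = load h k g q i' := by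
  unfold load
  refine Fintype.sum_equiv (Equiv.arrowCongr (Equiv.refl (Fin h))
    (Equiv.prodCongr (Equiv.swap i i') (Equiv.refl (Fin g)))) _ _ fun P => ?_
  refine sum_congr rfl fun t _ => ?_
  have : ((Equiv.arrowCongr (Equiv.refl (Fin h))
    (Equiv.prodCongr (Equiv.swap i i') (Equiv.refl (Fin g)))) P t).1 = i' ↔ (P t).1 = i := by
    simp only [Equiv.arrowCongr_apply, Equiv.coe_refl, Equiv.refl_symm, Function.comp_apply, Equiv.prodCongr_apply, id, Prod.map_fst]
    rw [Equiv.swap_apply_eq_iff, Equiv.swap_apply_right]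
  simp only [this]

omit [NeZero g] in
theorem sum_load : ∑ i : Fin k, load h k g q i =
    (k * g) ^ h * ∑ t : Fin h, evenCount t * q ^ (h - 1) := by
  unfold load
  rw [sum_comm]
  have : ∀ P : SlotMap h k g, ∑ i, ∑ t, (if (P t).1 = i then evenCount t * q ^ (h - 1) else 0) =
      ∑ t : Fin h, evenCount t * q ^ (h - 1) := by
    intro P
    rw [sum_comm]
    simp
  simp [this]

/-- Counting the pairs `t ∈ J` with `J` even in the other order turns the left side into the sum of
`#J * q ^ (h - 1)`, to which `hitCount_lower` applies for each of the `2 ^ h` sets. -/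
theorem sum_evenCount_le (hq : 1 ≤ q) (hh : 2 ≤ h) :
    ∑ t : Fin h, evenCount t * q ^ (h - 1) ≤
      (∑ J : Finset (Fin h), if Odd #J then 0 else hitCount h q #J) +
        2 ^ h * h ^ 2 * q ^ (h - 2) := by
  have h1 : ∑ t : Fin h, evenCount t * q ^ (h - 1) =
      ∑ J : Finset (Fin h), if Odd #J then 0 else #J * q ^ (h - 1) := by
    have h2 : ∀ t : Fin h, evenCount t * q ^ (h - 1) =
        ∑ J : Finset (Fin h), if Odd #J then 0 else if t ∈ J then q ^ (h - 1) else 0 := by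
      intro t
      unfold evenCount
      rw [card_filter, sum_mul]
      refine sum_congr rfl fun J _ => ?_
      by_cases h1 : Odd #J <;> by_cases h2 : t ∈ J <;> simp [h1, h2]
    simp only [h2]
    rw [sum_comm]
    refine sum_congr rfl fun J _ => ?_
    by_cases h1 : Odd #J <;> simp [h1]
  rw [h1]
  calc _ ≤ ∑ J : Finset (Fin h), ((if Odd #J then 0 else hitCount h q #J) +
        h ^ 2 * q ^ (h - 2)) := by
        refine sum_le_sum fun J _ => ?_
        split_ifs
        · exact Nat.zero_le _
        · exact hitCount_lower hq hh (by simpa using card_le_univ J)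
    _ = _ := by
        rw [sum_add_distrib]
        simp [mul_assoc]

open Classical in
-- A union bound over candidates, positions and tuples: once the position `t` and the tuple `x` are
-- fixed, exactly `evenCount t` sets `J` containing `t` have `x` joined to candidates, by
-- `card_odd_mem`. Chosen elements have no neighbors among elements.
theorem card_constraint_le (hh : 2 ≤ h) (z : Fin k → GVertex h k g N q d) (y : Fin d)
    (P : SlotMap h k g) :
    ∑ J : Finset (Fin h), #{x | ∃ j, D.Nbr (z j) (.inr (y, .inr (P, J), x))} ≤
      ∑ j, Sum.elim (fun c => ∑ t, if (P t).1 = c.1 then evenCount t * q ^ (h - 1) else 0)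
        (fun _ => 0) (z j) := by
  have h1 : ∀ J : Finset (Fin h), #{x | ∃ j, D.Nbr (z j) (.inr (y, .inr (P, J), x))} ≤
      ∑ j, #{x | D.Nbr (z j) (.inr (y, .inr (P, J), x))} := by
    intro J
    refine le_trans (card_le_card ?_) (card_biUnion_le (s := univ)
      (t := fun j => ({x | D.Nbr (z j) (.inr (y, .inr (P, J), x))} : Finset (Fin h → Fin q))))
    intro x hx
    simpa using hx
  refine (sum_le_sum fun J _ => h1 J).trans ?_
  rw [sum_comm]
  refine sum_le_sum fun j _ => ?_
  rcases z j with ⟨i, a⟩ | e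
  · simp only [nbr_inl_inr, nbr_inr_inl, nbr_inl_inl, nbr_inr_inr, Sum.elim_inl]
    have h2 : ∀ x : Fin h → Fin q, ∀ t, #{J : Finset (Fin h) | D.On (.inr (P, J)) x ∧ t ∈ J} =
        evenCount t := by
      intro x t
      by_cases hR : D.active P → D.rel x
      · simp only [on_inr, eq_true hR, iff_true]
        exact card_odd_mem hh t
      · simp only [on_inr, eq_false hR, iff_false]
        rfl
    calc ∑ J : Finset (Fin h), #{x | D.Joined i a y (.inr (P, J)) x}
        ≤ ∑ J : Finset (Fin h), ∑ x : Fin h → Fin q, ∑ t,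
          if (P t).1 = i ∧ x t = D.val y (P t) a then
            (if D.On (.inr (P, J)) x ∧ t ∈ J then 1 else 0) else 0 := by
          refine sum_le_sum fun J _ => ?_
          rw [card_filter]
          refine sum_le_sum fun x _ => ?_
          split_ifs with hj
          · obtain ⟨hon, t, ht, hi, hx⟩ := hj
            refine le_trans ?_ (single_le_sum (fun _ _ => Nat.zero_le _) (mem_univ t))
            simp only [Block.slot, Block.support] at hi hx ht
            rw [if_pos ⟨hi, hx⟩, if_pos ⟨hon, ht⟩]
          · exact Nat.zero_le _
      _ = ∑ x : Fin h → Fin q, ∑ t,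
          if (P t).1 = i ∧ x t = D.val y (P t) a then evenCount t else 0 := by
          rw [sum_comm]
          refine sum_congr rfl fun x _ => ?_
          rw [sum_comm]
          refine sum_congr rfl fun t _ => ?_
          split_ifs
          · rw [← h2 x t, card_filter]
          · simp
      _ = ∑ t, if (P t).1 = i then evenCount t * q ^ (h - 1) else 0 := by
          rw [sum_comm]
          refine sum_congr rfl fun t _ => ?_
          by_cases hi : (P t).1 = i
          · simp only [hi, true_and, if_true]
            rw [← sum_filter, sum_const, card_tuples_eq, smul_eq_mul, mul_comm]
          · simp [hi]
      _ ≤ _ := le_rfl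
  · simp [nbr_inl_inr, nbr_inr_inl, nbr_inl_inl, nbr_inr_inr]

open Classical in
theorem card_force_single (hh : 2 ≤ h) (v : GVertex h k g N q d) (y : Fin d)
    (e : Fin k × Fin (copies h k g)) :
    #{x | D.Nbr v (.inr (y, .inl e, x))} =
      Sum.elim (fun c => if c.1 = e.1 then hitCount h q 2 else 0) (fun _ => 0) v := by
  rcases v with ⟨i, a⟩ | u
  · simp only [nbr_inl_inr, nbr_inr_inl, nbr_inl_inl, nbr_inr_inr, joined_iff, on_inl, on_inr, Sum.elim_inl, true_and]
    split_ifs with hi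
    · rw [← Block.card_support_inl hh e, ← card_tuples_hit _ fun _ => D.val y (e.1, 0) a]
      simp [Block.slot, hi]
    · rw [card_eq_zero, filter_eq_empty_iff]
      rintro x - ⟨t, -, h1, -⟩
      exact hi h1.symm
  · simp [nbr_inl_inr, nbr_inr_inl, nbr_inl_inl, nbr_inr_inr]

open Classical in
theorem card_force_le (hh : 2 ≤ h) (z : Fin k → GVertex h k g N q d) (y : Fin d)
    (e : Fin k × Fin (copies h k g)) :
    #{x | ∃ j, D.Nbr (z j) (.inr (y, .inl e, x))} ≤
      ∑ j, Sum.elim (fun c => if c.1 = e.1 then hitCount h q 2 else 0) (fun _ => 0) (z j) := by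
  simp only [← D.card_force_single hh _ y e]
  refine le_trans (card_le_card ?_) (card_biUnion_le (s := univ)
    (t := fun j => ({x | D.Nbr (z j) (.inr (y, .inl e, x))} : Finset (Fin h → Fin q))))
  intro x hx
  simpa using hx

open Classical in
-- A tuple whose first entry is the value of one candidate and whose second entry is the value of
-- the other is dominated by both. There are `q ^ (h - 2)` such tuples, even if the two values
-- coincide.
theorem card_force_pair (hh : 2 ≤ h) (z : Fin k → GVertex h k g N q d) (y : Fin d)
    (e : Fin k × Fin (copies h k g)) {j j' : Fin k} (hj : j ≠ j') {a a' : Fin N}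
    (hz : z j = .inl (e.1, a)) (hz' : z j' = .inl (e.1, a')) :
    #{x | ∃ j, D.Nbr (z j) (.inr (y, .inl e, x))} + q ^ (h - 2) ≤
      ∑ j, Sum.elim (fun c => if c.1 = e.1 then hitCount h q 2 else 0) (fun _ => 0) (z j) := by
  simp only [← D.card_force_single hh _ y e]
  have h1 := card_biUnion_add_card_inter_le
    (fun j => ({x | D.Nbr (z j) (.inr (y, .inl e, x))} : Finset (Fin h → Fin q))) hj
  refine le_trans (Nat.add_le_add (card_le_card ?_) ?_) h1
  · intro x hx
    simpa using hx
  · let w : Fin h → Fin q := fun t =>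
      if t.val = 0 then D.val y (e.1, 0) a else D.val y (e.1, 0) a'
    have h2 := card_tuples_agree ({⟨0, by omega⟩, ⟨1, by omega⟩} : Finset (Fin h)) w
    rw [card_pair (by simp)] at h2
    rw [← h2]
    refine card_le_card fun x hx => ?_
    simp only [mem_insert, mem_singleton, forall_eq_or_imp, forall_eq, mem_filter, mem_univ, true_and, w] at hx
    have hx1 : x ⟨0, by omega⟩ = D.val y (e.1, 0) a := by simpa using hx.1
    have hx2 : x ⟨1, by omega⟩ = D.val y (e.1, 0) a' := by simpa using hx.2
    rw [mem_inter, mem_filter, mem_filter, hz, hz']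
    exact ⟨⟨mem_univ _, trivial, ⟨0, by omega⟩, by simp [Block.support], rfl,
      hx1⟩, ⟨mem_univ _, trivial, ⟨1, by omega⟩, by simp [Block.support], rfl,
      hx2⟩⟩

open Classical in
-- A neighbor of an element must take a prescribed value at one of at most `h` slots, and each value
-- is taken by at most `q ^ (h - 1)` candidates of a group.
theorem card_nbr_element (hval : ∀ y s v, #{a | D.val y s a = v} ≤ q ^ (h - 1))
    (z : Fin k → GVertex h k g N q d) :
    #{c | ∃ j, D.Nbr (z j) (.inl c)} ≤
      ∑ j, Sum.elim (fun _ => 0) (fun _ => h * q ^ (h - 1)) (z j) := by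
  have h1 : #{c | ∃ j, D.Nbr (z j) (.inl c)} ≤ ∑ j, #{c | D.Nbr (z j) (.inl c)} := by
    refine le_trans (card_le_card ?_) (card_biUnion_le (s := univ)
      (t := fun j => ({c | D.Nbr (z j) (.inl c)} : Finset (Fin k × Fin N))))
    intro x hx
    simpa using hx
  refine h1.trans (sum_le_sum fun j _ => ?_)
  rcases z j with c | ⟨y, b, x⟩
  · simp [nbr_inl_inr, nbr_inr_inl, nbr_inl_inl, nbr_inr_inr]
  · simp only [nbr_inl_inr, nbr_inr_inl, nbr_inl_inl, nbr_inr_inr, Sum.elim_inr]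
    have h2 : ({c | D.Joined c.1 c.2 y b x} : Finset (Fin k × Fin N)) ⊆
        univ.biUnion fun t : Fin h => ({a | D.val y (b.slot t) a = x t} : Finset (Fin N)).image
          fun a => ((b.slot t).1, a) := by
      rintro ⟨i, a⟩ hc
      simp only [mem_filter] at hc
      simp only [mem_univ, true_and, joined_iff] at hc
      obtain ⟨-, t, -, hi, hx⟩ := hc
      simp only [mem_biUnion, mem_univ, true_and, mem_image, mem_filter, Prod.mk.injEq]
      exact ⟨t, a, hx.symm, hi, rfl⟩
    refine (card_le_card h2).trans (card_biUnion_le.trans ?_)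
    calc _ ≤ ∑ _t : Fin h, q ^ (h - 1) :=
          sum_le_sum fun t _ => card_image_le.trans (hval y (b.slot t) (x t))
      _ = h * q ^ (h - 1) := by simp

open Classical in
-- The constraint blocks are already estimated by the union bound, while the forcing blocks are kept
-- exact, since the losses of a bad choice are found there.
theorem domCount_le (hh : 2 ≤ h) (hval : ∀ y s v, #{a | D.val y s a = v} ≤ q ^ (h - 1))
    (z : Fin k → GVertex h k g N q d) :
    D.domCount z ≤ k + (∑ j, Sum.elim (fun _ => 0) (fun _ => h * q ^ (h - 1)) (z j)) +
      ∑ y, ((∑ e, #{x | ∃ j, D.Nbr (z j) (.inr (y, .inl e, x))}) +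
        ∑ j, Sum.elim (fun c => load h k g q c.1) (fun _ => 0) (z j)) := by
  have h1 : D.domCount z ≤ #(univ.image z) + #{v | ∃ j, D.Nbr (z j) v} := by
    refine (card_le_card ?_).trans (card_union_le _ _)
    intro v hv
    simp only [mem_filter, mem_univ, true_and, mem_union, mem_image] at hv ⊢
    obtain ⟨j, h | h⟩ := hv
    · exact .inl ⟨j, h.symm⟩
    · exact .inr ⟨j, h⟩
  have h2 : #(univ.image z) ≤ k := card_image_le.trans (by simp)
  have h3 : #{v | ∃ j, D.Nbr (z j) v} = #{c | ∃ j, D.Nbr (z j) (.inl c)} +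
      ∑ y, ∑ b, #{x | ∃ j, D.Nbr (z j) (.inr (y, b, x))} := by
    rw [card_filter_sum, card_filter_prod]
    simp only [card_filter_prod]
  have h4 := D.card_nbr_element hval z
  have h5 : ∑ y, ∑ b : Block h k g, #{x | ∃ j, D.Nbr (z j) (.inr (y, b, x))} ≤
      ∑ y, ((∑ e, #{x | ∃ j, D.Nbr (z j) (.inr (y, .inl e, x))}) +
        ∑ j, Sum.elim (fun c => load h k g q c.1) (fun _ => 0) (z j)) := by
    refine sum_le_sum fun y _ => ?_
    rw [Fintype.sum_sum_type, Fintype.sum_prod_type (f := fun e : SlotMap h k g × Finset (Fin h) => _)]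
    refine Nat.add_le_add_left ((sum_le_sum fun P _ => D.card_constraint_le hh z y P).trans ?_) _
    rw [sum_comm]
    refine sum_le_sum fun j _ => ?_
    rcases z j with c | e
    · simp [load]
    · simp
  omega

/-- Fewer than one candidate per group leads to a count below the threshold. -/
theorem domCount_lt (hh : 2 ≤ h) (hq : 1 ≤ q) (hd : 1 ≤ d)
    (hval : ∀ y s v, #{a | D.val y s a = v} ≤ q ^ (h - 1)) (hg : 1 ≤ k * g)
    (z : Fin k → GVertex h k g N q d)
    (hz : ¬ ∃ (i : Fin k → Fin k) (a : Fin k → Fin N), i.Injective ∧ ∀ j, z j = .inl (i j, a j)) :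
    D.domCount z < threshold h k g q d := by
  classical
  set r := hitCount h q 2 with hr
  set M := copies h k g with hM
  set p := (k * g) ^ h with hp
  have hp1 : 1 ≤ p := Nat.one_le_pow _ _ hg
  set Q1 := q ^ (h - 1) with hQ1
  set Q2 := q ^ (h - 2) with hQ2
  set B := ∑ J : Finset (Fin h), if Odd #J then 0 else hitCount h q #J with hB
  set L := ∑ t : Fin h, evenCount t * Q1 with hL
  have hLB : L ≤ B + 2 ^ h * h ^ 2 * Q2 := sum_evenCount_le hq hh
  have hr1 : Q1 ≤ r := hitCount_two_lower hq hh
  have hQ21 : Q2 ≤ Q1 := Nat.pow_le_pow_right hq (by omega)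
  have hQ2pos : 1 ≤ Q2 := Nat.one_le_pow _ _ hq
  -- The first summand pays for the slack of the union bound on the constraint blocks, the summand
  -- `h` for the candidates that a chosen element dominates.
  have hMeq : M = p * (2 ^ h * h ^ 2) + h + 1 := rfl
  have hthr : threshold h k g q d = k + d * (k * M * r + p * B + p) := rfl
  -- the load of the candidates
  have hload : ∑ j, Sum.elim (fun c : Fin k × Fin N => load h k g q c.1) (fun _ => 0) (z j) ≤
      p * L := by
    rw [hp, hL, ← sum_load]
    refine sum_le_sum fun j _ => ?_
    rcases z j with c | e
    · exact (load_eq c.1 j).le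
    · exact Nat.zero_le _
  have hle := D.domCount_le hh hval z
  by_cases hcand : ∃ j e, z j = .inr e
  · -- some element is chosen
    obtain ⟨j₀, e₀, hj₀⟩ := hcand
    set E := ∑ j, Sum.elim (fun _ : Fin k × Fin N => 0)
      (fun _ : Fin d × Block h k g × (Fin h → Fin q) => 1) (z j) with hE
    have hE1 : 1 ≤ E := by
      rw [hE]
      refine le_trans ?_ (single_le_sum (fun _ _ => Nat.zero_le _) (mem_univ j₀))
      rw [hj₀]
      rfl
    -- Each chosen element gives up the `M * r` forced elements that a candidate in its place would
    -- contribute to the union bound.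
    have hforce : ∀ y, (∑ e, #{x | ∃ j, D.Nbr (z j) (.inr (y, .inl e, x))}) + E * (M * r) ≤
        k * M * r := by
      intro y
      refine (Nat.add_le_add_right (sum_le_sum fun e _ => D.card_force_le hh z y e) _).trans ?_
      rw [sum_comm, hE, sum_mul, ← sum_add_distrib]
      calc _ ≤ ∑ _j : Fin k, M * r := by
            refine sum_le_sum fun j _ => ?_
            rcases z j with c | e
            · simp only [Sum.elim_inl, zero_mul, add_zero]
              rw [sum_ite_fst, Fintype.card_fin]
            · simp
        _ = k * M * r := by simp [mul_assoc]
    have helem : ∑ j, Sum.elim (fun _ : Fin k × Fin N => 0)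
        (fun _ : Fin d × Block h k g × (Fin h → Fin q) => h * Q1) (z j) = E * (h * Q1) := by
      rw [hE, sum_mul]
      refine sum_congr rfl fun j _ => ?_
      rcases z j with c | e <;> simp
    rw [helem] at hle
    have h1 : D.domCount z + d * (E * (M * r)) ≤ k + E * (h * Q1) + d * (k * M * r + p * L) := by
      have h2 : (∑ y : Fin d, ((∑ e, #{x | ∃ j, D.Nbr (z j) (.inr (y, .inl e, x))}) +
          ∑ j, Sum.elim (fun c => load h k g q c.1) (fun _ => 0) (z j))) + d * (E * (M * r)) ≤
          d * (k * M * r + p * L) := by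
        have h3 : d * (E * (M * r)) = ∑ _y : Fin d, E * (M * r) := by simp
        have h4 : d * (k * M * r + p * L) = ∑ _y : Fin d, (k * M * r + p * L) := by simp
        rw [h3, h4, ← sum_add_distrib]
        refine sum_le_sum fun y _ => ?_
        have := hforce y
        omega
      omega
    have h2 : p * L ≤ p * B + p * (2 ^ h * h ^ 2) * Q1 := by
      calc p * L ≤ p * (B + 2 ^ h * h ^ 2 * Q2) := Nat.mul_le_mul_left _ hLB
        _ = p * B + p * (2 ^ h * h ^ 2) * Q2 := by ring
        _ ≤ _ := by gcongr
    have h3 : p * (2 ^ h * h ^ 2) * Q1 + E * (h * Q1) ≤ E * (M * r) := by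
      calc p * (2 ^ h * h ^ 2) * Q1 + E * (h * Q1)
          ≤ E * (p * (2 ^ h * h ^ 2) * Q1) + E * (h * Q1) := by
            exact Nat.add_le_add_right (Nat.le_mul_of_pos_left _ hE1) _
        _ = E * ((p * (2 ^ h * h ^ 2) + h) * Q1) := by ring
        _ ≤ E * (M * r) := by
            gcongr
            omega
    have h4 : E * (h * Q1) ≤ d * (E * (h * Q1)) := Nat.le_mul_of_pos_left _ hd
    have h5 := Nat.mul_le_mul_left d h2
    have h6 := Nat.mul_le_mul_left d h3
    have h7 : d ≤ d * p := Nat.le_mul_of_pos_right _ hp1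
    rw [hthr]
    simp only [mul_add] at h1 h5 h6 ⊢
    omega
  · -- two candidates of one group are chosen
    push Not at hcand
    have hinl : ∀ j, ∃ c, z j = .inl c := by
      intro j
      rcases hzj : z j with c | e
      · exact ⟨c, rfl⟩
      · exact absurd hzj (hcand j e)
    choose c hc using hinl
    obtain ⟨j₁, j₂, hj, hne⟩ : ∃ j₁ j₂, (c j₁).1 = (c j₂).1 ∧ j₁ ≠ j₂ := by
      by_contra! hcon
      exact hz ⟨fun j => (c j).1, fun j => (c j).2, fun j₁ j₂ h12 => by
        by_contra hne
        exact hne (hcon j₁ j₂ h12), hc⟩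
    have helem : ∑ j, Sum.elim (fun _ : Fin k × Fin N => 0)
        (fun _ : Fin d × Block h k g × (Fin h → Fin q) => h * Q1) (z j) = 0 := by
      simp [hc]
    rw [helem] at hle
    -- In all `M` copies belonging to the common group the union bound overcounts by at least `q ^
    -- (h - 2)`.
    have hforce : ∀ y, (∑ e, #{x | ∃ j, D.Nbr (z j) (.inr (y, .inl e, x))}) + M * Q2 ≤
        k * M * r := by
      intro y
      have h1 : M * Q2 = ∑ e : Fin k × Fin M, if e.1 = (c j₁).1 then Q2 else 0 := by
        simp only [eq_comm (b := (c j₁).1)]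
        rw [sum_ite_fst, Fintype.card_fin]
      rw [h1, ← sum_add_distrib]
      calc _ ≤ ∑ e : Fin k × Fin M, ∑ j, Sum.elim (fun c => if c.1 = e.1 then r else 0)
            (fun _ => 0) (z j) := by
            refine sum_le_sum fun e _ => ?_
            split_ifs with he
            · exact D.card_force_pair hh z y e hne (a := (c j₁).2) (a' := (c j₂).2)
                (by rw [hc, he]) (by rw [hc, he, hj])
            · exact D.card_force_le hh z y e
        _ = ∑ _j : Fin k, M * r := by
            rw [sum_comm]
            refine sum_congr rfl fun j _ => ?_
            simp only [hc, Sum.elim_inl]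
            rw [sum_ite_fst, Fintype.card_fin]
        _ = k * M * r := by simp [mul_assoc]
    have h1 : D.domCount z + d * (M * Q2) ≤ k + d * (k * M * r + p * L) := by
      have h2 : (∑ y : Fin d, ((∑ e, #{x | ∃ j, D.Nbr (z j) (.inr (y, .inl e, x))}) +
          ∑ j, Sum.elim (fun c => load h k g q c.1) (fun _ => 0) (z j))) + d * (M * Q2) ≤
          d * (k * M * r + p * L) := by
        have h3 : d * (M * Q2) = ∑ _y : Fin d, M * Q2 := by simp
        have h4 : d * (k * M * r + p * L) = ∑ _y : Fin d, (k * M * r + p * L) := by simp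
        rw [h3, h4, ← sum_add_distrib]
        refine sum_le_sum fun y _ => ?_
        have := hforce y
        omega
      omega
    have h2 : p * L ≤ p * B + M * Q2 := by
      calc p * L ≤ p * (B + 2 ^ h * h ^ 2 * Q2) := Nat.mul_le_mul_left _ hLB
        _ = p * B + p * (2 ^ h * h ^ 2) * Q2 := by ring
        _ ≤ _ := by
            gcongr
            omega
    have h5 := Nat.mul_le_mul_left d h2
    have h7 : 1 ≤ d * p := Nat.mul_pos hd hp1
    rw [hthr]
    simp only [mul_add] at h1 h5 ⊢
    omega

/-- The threshold is reached if and only if the constraints can be satisfied. -/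
theorem threshold_le_domCount_iff (hh : 2 ≤ h) (hq : 1 ≤ q) (hd : 1 ≤ d)
    (hval : ∀ y s v, #{a | D.val y s a = v} ≤ q ^ (h - 1)) (hg : 1 ≤ k * g) :
    (∃ z, threshold h k g q d ≤ D.domCount z) ↔
      ∃ c : Fin k → Fin N, ∀ y P, D.active P → D.rel fun t => D.val y (P t) (c (P t).1) := by
  classical
  have hcard : Fintype.card (SlotMap h k g) = (k * g) ^ h := by simp
  constructor
  · rintro ⟨z, hz⟩
    by_cases hcand : ∃ (i : Fin k → Fin k) (a : Fin k → Fin N), i.Injective ∧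
        ∀ j, z j = .inl (i j, a j)
    · obtain ⟨i, a, hi, hza⟩ := hcand
      let e := Equiv.ofBijective i (Finite.injective_iff_bijective.1 hi)
      refine ⟨fun j => a (e.symm j), ?_⟩
      -- With one candidate in each group, only the order of the choice differs from the order of
      -- the groups.
      have h1 : D.domCount z = D.domCount fun j => .inl (j, a (e.symm j)) := by
        unfold domCount
        congr 1
        ext v
        simp only [mem_filter, mem_univ, true_and]
        constructor
        · rintro ⟨j, hj⟩
          refine ⟨e j, ?_⟩
          rw [Equiv.symm_apply_apply]
          rw [hza] at hj
          exact hj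
        · rintro ⟨j, hj⟩
          refine ⟨e.symm j, ?_⟩
          rw [hza]
          have h2 : i (e.symm j) = j := e.apply_symm_apply j
          rw [h2]
          exact hj
      rw [h1, domCount_choice D hh] at hz
      unfold threshold at hz
      have h2 : ∀ y : Fin d, #{P : SlotMap h k g | D.active P →
          D.rel fun t => D.val y (P t) (a (e.symm (P t).1))} ≤ (k * g) ^ h := fun y => by
        rw [← hcard]
        exact card_le_univ _
      have h3 : d * (baseCount h k g q + (k * g) ^ h) =
          ∑ _y : Fin d, (baseCount h k g q + (k * g) ^ h) := by simp
      rw [h3] at hz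
      -- Each layer is bounded by the case that all placements are satisfied, so reaching the total
      -- forces equality in every layer.
      have h4 := (sum_eq_sum_iff_of_le fun y _ => Nat.add_le_add_left (h2 y) _).1
        (le_antisymm (sum_le_sum fun y _ => Nat.add_le_add_left (h2 y) _)
          (Nat.le_of_add_le_add_left hz))
      intro y P
      have h5 := Nat.add_left_cancel (h4 y (mem_univ y))
      rw [← hcard] at h5
      have h6 := (card_eq_iff_eq_univ _).1 h5
      have h7 := mem_univ P
      rw [← h6] at h7
      exact (mem_filter.1 h7).2
    · exact absurd hz (not_le.2 (D.domCount_lt hh hq hd hval hg z hcand))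
  · rintro ⟨c, hc⟩
    refine ⟨fun i => .inl (i, c i), ?_⟩
    rw [domCount_choice D hh]
    have h1 : ∀ y : Fin d, #{P : SlotMap h k g | D.active P →
        D.rel fun t => D.val y (P t) (c (P t).1)} = (k * g) ^ h := by
      intro y
      rw [← hcard, filter_true_of_mem fun P _ => hc y P, card_univ]
    simp [h1, threshold]

end GadgetData

end FineGrained


/-! ### The gadget graph as a duplicate-free list of numbered edges -/

namespace FineGrained

open Finset

/-! ### Digits -/

theorem mul_add_mod_of_lt_right {m a b : ℕ} (hb : b < m) : (a * m + b) % m = b := by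
  rw [Nat.mul_add_mod_self_right, Nat.mod_eq_of_lt hb]

/-- Insert the digit `v` at position `t` into the number `w`. -/
def insertDigit (q t w v : ℕ) : ℕ := w / q ^ t * q ^ (t + 1) + v * q ^ t + w % q ^ t

/-- Remove the digit at position `t`. -/
def removeDigit (q t x : ℕ) : ℕ := x / q ^ (t + 1) * q ^ t + x % q ^ t

section Digits

variable {h q t w v x : ℕ}

theorem insertDigit_div (hq : 0 < q) : insertDigit q t w v / q ^ t = w / q ^ t * q + v := by
  have hA : 0 < q ^ t := pow_pos hq t
  unfold insertDigit
  rw [show w / q ^ t * q ^ (t + 1) + v * q ^ t + w % q ^ t =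
    w % q ^ t + q ^ t * (w / q ^ t * q + v) by ring, Nat.add_mul_div_left _ _ hA,
    Nat.div_eq_of_lt (Nat.mod_lt _ hA), zero_add]

theorem digit_insertDigit (hv : v < q) : insertDigit q t w v / q ^ t % q = v := by
  rw [insertDigit_div (by omega), mul_add_mod_of_lt_right hv]

theorem insertDigit_mod (hq : 0 < q) : insertDigit q t w v % q ^ t = w % q ^ t := by
  have hA : 0 < q ^ t := pow_pos hq t
  unfold insertDigit
  rw [show w / q ^ t * q ^ (t + 1) + v * q ^ t + w % q ^ t =
    w % q ^ t + q ^ t * (w / q ^ t * q + v) by ring, Nat.add_mul_mod_self_left, Nat.mod_mod]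

theorem removeDigit_insertDigit (hv : v < q) : removeDigit q t (insertDigit q t w v) = w := by
  have hq : 0 < q := by omega
  unfold removeDigit
  rw [insertDigit_mod hq, pow_succ, ← Nat.div_div_eq_div_mul, insertDigit_div hq,
    mul_comm (w / q ^ t) q, Nat.mul_add_div hq, Nat.div_eq_of_lt hv, add_zero]
  exact Nat.div_add_mod' w (q ^ t)

theorem insertDigit_removeDigit (hq : 0 < q) :
    insertDigit q t (removeDigit q t x) (x / q ^ t % q) = x := by
  have hA : 0 < q ^ t := pow_pos hq t
  have h1 : removeDigit q t x / q ^ t = x / q ^ (t + 1) := by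
    unfold removeDigit
    rw [add_comm, Nat.add_mul_div_right _ _ hA, Nat.div_eq_of_lt (Nat.mod_lt _ hA), zero_add]
  have h2 : removeDigit q t x % q ^ t = x % q ^ t := by
    unfold removeDigit
    rw [add_comm, Nat.add_mul_mod_self_right, Nat.mod_mod]
  unfold insertDigit
  rw [h1, h2, pow_succ, ← Nat.div_div_eq_div_mul]
  have h3 := Nat.div_add_mod' (x / q ^ t) q
  have h4 := Nat.div_add_mod' x (q ^ t)
  calc _ = (x / q ^ t / q * q + x / q ^ t % q) * q ^ t + x % q ^ t := by ring
    _ = x := by rw [h3, h4]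

theorem insertDigit_lt (ht : t < h) (hw : w < q ^ (h - 1)) (hv : v < q) :
    insertDigit q t w v < q ^ h := by
  have hq : 0 < q := by omega
  have hA : 0 < q ^ t := pow_pos hq t
  have h1 : w / q ^ t < q ^ (h - 1 - t) := by
    rw [Nat.div_lt_iff_lt_mul hA, ← pow_add]
    rwa [show h - 1 - t + t = h - 1 by omega]
  have h2 := insertDigit_div (t := t) (w := w) (v := v) hq
  have h3 : insertDigit q t w v / q ^ t < q ^ (h - t) := by
    rw [h2]
    calc w / q ^ t * q + v < (w / q ^ t + 1) * q := by
          rw [Nat.add_mul]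
          omega
      _ ≤ q ^ (h - 1 - t) * q := Nat.mul_le_mul_right _ h1
      _ = q ^ (h - t) := by rw [← pow_succ]; congr 1; omega
  rw [Nat.div_lt_iff_lt_mul hA, ← pow_add] at h3
  rwa [show h - t + t = h by omega] at h3

theorem removeDigit_lt (hq : 0 < q) (ht : t < h) (hx : x < q ^ h) :
    removeDigit q t x < q ^ (h - 1) := by
  have hA : 0 < q ^ t := pow_pos hq t
  have h1 : x / q ^ (t + 1) < q ^ (h - 1 - t) := by
    rw [Nat.div_lt_iff_lt_mul (pow_pos hq _), ← pow_add]
    rwa [show h - 1 - t + (t + 1) = h by omega]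
  unfold removeDigit
  calc x / q ^ (t + 1) * q ^ t + x % q ^ t < (x / q ^ (t + 1) + 1) * q ^ t := by
        rw [Nat.add_mul, one_mul]
        have := Nat.mod_lt x hA
        omega
    _ ≤ q ^ (h - 1 - t) * q ^ t := Nat.mul_le_mul_right _ h1
    _ = q ^ (h - 1) := by rw [← pow_add]; congr 1; omega

theorem finFunctionFinEquiv_symm_val (X : Fin (q ^ h)) (t : Fin h) :
    (finFunctionFinEquiv.symm X t : ℕ) = X / q ^ t.val % q := by
  simp

end Digits

/-! ### Numbering the vertices, and the list of edges -/

/-- Gadget data with values and tuples coded by numbers. -/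
structure RawData (h k g N q d : ℕ) where
  val : ℕ → Fin k × Fin g → ℕ → ℕ
  val_lt : ∀ y < d, ∀ s, ∀ a < N, val y s a < q
  active : SlotMap h k g → Prop
  rel : ℕ → Prop

/-- The places of candidate-element adjacencies: a block and a position. -/
abbrev Spec (h k g : ℕ) := Block h k g × Fin h

/-- The order is arbitrary. Like the numbering `blockEquiv`, it depends on `h`, `k`, `g` only, so it
can be fixed in the text of the program and need not be computed. -/
noncomputable def specs (h k g : ℕ) : List (Spec h k g) :=
  (univ : Finset (Spec h k g)).toList

noncomputable def blockEquiv (h k g : ℕ) : Block h k g ≃ Fin (Fintype.card (Block h k g)) :=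
  Fintype.equivFin _

def gadgetSize (h k g N q d : ℕ) : ℕ := k * N + d * (Fintype.card (Block h k g) * q ^ h)

/-- Candidates are numbered before elements, so that in every edge the candidate is the smaller
endpoint, as the encoding of graphs demands. -/
noncomputable def vertexEquiv (h k g N q d : ℕ) :
    GVertex h k g N q d ≃ Fin (gadgetSize h k g N q d) :=
  (Equiv.sumCongr finProdFinEquiv
    ((Equiv.prodCongr (Equiv.refl _) ((Equiv.prodCongr (blockEquiv h k g)
      finFunctionFinEquiv).trans finProdFinEquiv)).trans finProdFinEquiv)).trans finSumFinEquiv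

theorem vertexEquiv_inl {h k g N q d : ℕ} (i : Fin k) (a : Fin N) :
    (vertexEquiv h k g N q d (.inl (i, a)) : ℕ) = i * N + a := by
  change (a : ℕ) + N * i = i * N + a
  ring

theorem vertexEquiv_inr {h k g N q d : ℕ} (y : Fin d) (b : Block h k g) (x : Fin h → Fin q) :
    (vertexEquiv h k g N q d (.inr (y, b, x)) : ℕ) =
      k * N + ((y * Fintype.card (Block h k g) + blockEquiv h k g b) * q ^ h +
        (finFunctionFinEquiv x : Fin (q ^ h))) := by
  change k * N + ((((finFunctionFinEquiv x : Fin (q ^ h)) : ℕ) + q ^ h * blockEquiv h k g b) +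
    Fintype.card (Block h k g) * q ^ h * y) = _
  ring

namespace RawData

variable {h k g N q d : ℕ} (R : RawData h k g N q d)

def toGadget : GadgetData h k g N q d where
  val y s a := ⟨R.val y s a, R.val_lt y y.2 s a a.2⟩
  active := R.active
  rel x := R.rel (finFunctionFinEquiv x : Fin (q ^ h))

/-- The condition that the elements of a block with number `X` are joined to candidates. -/
def On : Block h k g → ℕ → Prop
  | .inl _, _ => True
  | .inr c, X => Odd #c.2 ↔ (R.active c.1 → R.rel X)

theorem on_iff [NeZero g] (b : Block h k g) (x : Fin h → Fin q) :
    R.toGadget.On b x ↔ R.On b (finFunctionFinEquiv x : Fin (q ^ h)) := by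
  rcases b with c | c <;> exact Iff.rfl

/-- The element number of the adjacency with index `e` at a place. -/
def element [NeZero g] (e : ℕ) (p : Spec h k g) : ℕ :=
  insertDigit q p.2 (e % q ^ (h - 1))
    (R.val (e / q ^ (h - 1) / N) (p.1.slot p.2) (e / q ^ (h - 1) % N))

/-- The adjacency with index `e` at a place exists, and is not listed at an earlier place. -/
def Emits [NeZero g] (e : ℕ) (p : Spec h k g) : Prop :=
  p.2 ∈ p.1.support ∧ R.On p.1 (R.element e p) ∧
    ∀ t ∈ p.1.support, t < p.2 → (p.1.slot t).1 = (p.1.slot p.2).1 →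
      R.element e p / q ^ t.val % q ≠
        R.val (e / q ^ (h - 1) / N) (p.1.slot t) (e / q ^ (h - 1) % N)

/-- The pair of numbers of the adjacent vertices. -/
noncomputable def pair [NeZero g] (e : ℕ) (p : Spec h k g) : ℕ × ℕ :=
  ((p.1.slot p.2).1 * N + e / q ^ (h - 1) % N,
    k * N + ((e / q ^ (h - 1) / N * Fintype.card (Block h k g) + blockEquiv h k g p.1) * q ^ h +
      R.element e p))

open Classical in
noncomputable def emit [NeZero g] (e : ℕ) (p : Spec h k g) : Option (ℕ × ℕ) :=
  if R.Emits e p then some (R.pair e p) else none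

/-- An index codes a layer, a candidate and `h - 1` free digits; at a place the remaining digit is
dictated by the value of the candidate. Enumerating indices instead of candidate-element pairs keeps
the time within the bound on the number of edges. -/
noncomputable def edgeList [NeZero g] (n : ℕ) : List (ℕ × ℕ) :=
  (List.range n).flatMap fun e => (specs h k g).filterMap (R.emit e)

theorem edgeList_succ [NeZero g] (n : ℕ) :
    R.edgeList (n + 1) = R.edgeList n ++ (specs h k g).filterMap (R.emit n) := by
  simp [edgeList, List.range_succ]

theorem length_edgeList_le [NeZero g] (n : ℕ) :
    (R.edgeList n).length ≤ (specs h k g).length * n := by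
  induction n with
  | zero => simp [edgeList]
  | succ n ih =>
    rw [edgeList_succ, List.length_append, Nat.mul_succ]
    exact Nat.add_le_add ih (List.length_filterMap_le _ _)

variable [NeZero g]

theorem bounds_of_lt (hq : 1 ≤ q) {e : ℕ} (he : e < d * N * q ^ (h - 1)) :
    e / q ^ (h - 1) / N < d ∧ e / q ^ (h - 1) % N < N ∧ e % q ^ (h - 1) < q ^ (h - 1) := by
  have hQ : 0 < q ^ (h - 1) := pow_pos hq _
  have hN : 0 < N := by
    rcases Nat.eq_zero_or_pos N with rfl | hN
    · simp at he
    · exact hN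
  refine ⟨?_, Nat.mod_lt _ hN, Nat.mod_lt _ hQ⟩
  rw [Nat.div_lt_iff_lt_mul hN, Nat.div_lt_iff_lt_mul hQ]
  exact he

theorem element_lt (hq : 1 ≤ q) {e : ℕ} (he : e < d * N * q ^ (h - 1)) (p : Spec h k g) :
    R.element e p < q ^ h := by
  obtain ⟨h1, h2, h3⟩ := bounds_of_lt hq he
  exact insertDigit_lt p.2.2 h3 (R.val_lt _ h1 _ _ h2)

theorem digit_element (hq : 1 ≤ q) {e : ℕ} (he : e < d * N * q ^ (h - 1)) (p : Spec h k g) :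
    R.element e p / q ^ p.2.val % q =
      R.val (e / q ^ (h - 1) / N) (p.1.slot p.2) (e / q ^ (h - 1) % N) := by
  obtain ⟨h1, h2, h3⟩ := bounds_of_lt hq he
  exact digit_insertDigit (R.val_lt _ h1 _ _ h2)

/-- The two numbers determine the layer, the candidate, the block and the tuple. The position is
determined because an adjacency is emitted only at its least witness, and removing the digit there
recovers the free digits. -/
theorem pair_injective (hq : 1 ≤ q) {e e' : ℕ} (he : e < d * N * q ^ (h - 1))
    (he' : e' < d * N * q ^ (h - 1)) {p p' : Spec h k g} (hp : R.Emits e p) (hp' : R.Emits e' p')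
    (hpair : R.pair e p = R.pair e' p') : e = e' ∧ p = p' := by
  have split : ∀ {m a b a' b' : ℕ}, b < m → b' < m → a * m + b = a' * m + b' → a = a' ∧ b = b' := by
    intro m a b a' b' hb hb' hab
    have hm : 0 < m := by omega
    have h1 := congrArg (· / m) hab
    have h2 := congrArg (· % m) hab
    simp only [mul_add_mod_of_lt_right hb, mul_add_mod_of_lt_right hb'] at h2
    simp only [mul_comm _ m, Nat.mul_add_div hm, Nat.div_eq_of_lt hb, Nat.div_eq_of_lt hb',
      add_zero] at h1
    exact ⟨h1, h2⟩
  obtain ⟨hy, ha, hw⟩ := bounds_of_lt hq he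
  obtain ⟨hy', ha', hw'⟩ := bounds_of_lt hq he'
  have hE := R.digit_element hq he p
  have hE' := R.digit_element hq he' p'
  have hv := R.val_lt _ hy (p.1.slot p.2) _ ha
  have hv' := R.val_lt _ hy' (p'.1.slot p'.2) _ ha'
  simp only [pair, Prod.mk.injEq] at hpair
  obtain ⟨h1, h2⟩ := hpair
  obtain ⟨hi, haa⟩ := split ha ha' h1
  obtain ⟨h3, hx⟩ := split (R.element_lt hq he p) (R.element_lt hq he' p')
    (Nat.add_left_cancel h2)
  obtain ⟨hyy, hb⟩ := split (blockEquiv h k g p.1).2 (blockEquiv h k g p'.1).2 h3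
  obtain ⟨b, t⟩ := p
  obtain ⟨b', t'⟩ := p'
  obtain rfl : b = b' := (blockEquiv h k g).injective (Fin.ext hb)
  simp only at *
  -- If the positions differed, the smaller one would already witness the adjacency, contradicting
  -- its emission at the larger one.
  have ht : t = t' := by
    have hi' := Fin.ext hi
    rcases lt_trichotomy t t' with hlt | heq | hlt
    · exact absurd (by rw [← hx, hE, hyy, haa]) (hp'.2.2 t hp.1 hlt hi')
    · exact heq
    · exact absurd (by rw [hx, hE', hyy, haa]) (hp.2.2 t' hp'.1 hlt hi'.symm)
  subst ht
  refine ⟨?_, rfl⟩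
  have hw2 : e % q ^ (h - 1) = e' % q ^ (h - 1) := by
    have h5 := congrArg (removeDigit q t.val) hx
    unfold element at h5
    rwa [removeDigit_insertDigit hv, removeDigit_insertDigit hv'] at h5
  rw [← Nat.div_add_mod' e (q ^ (h - 1)), ← Nat.div_add_mod' e' (q ^ (h - 1)), hw2,
    ← Nat.div_add_mod' (e / q ^ (h - 1)) N, ← Nat.div_add_mod' (e' / q ^ (h - 1)) N, hyy, haa]

theorem emit_eq_some {e : ℕ} {p : Spec h k g} {r : ℕ × ℕ} :
    R.emit e p = some r ↔ R.Emits e p ∧ R.pair e p = r := by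
  unfold emit
  split_ifs with h1 <;> simp [h1]

theorem nodup_edgeList (hq : 1 ≤ q) : (R.edgeList (d * N * q ^ (h - 1))).Nodup := by
  unfold edgeList
  rw [List.nodup_flatMap]
  constructor
  · intro e he
    have he' := List.mem_range.1 he
    refine List.Nodup.filterMap ?_ (nodup_toList _)
    intro p p' r hr hr'
    obtain ⟨h1, h2⟩ := R.emit_eq_some.1 hr
    obtain ⟨h3, h4⟩ := R.emit_eq_some.1 hr'
    exact (R.pair_injective hq he' he' h1 h3 (h2.trans h4.symm)).2
  · refine List.Nodup.pairwise_of_forall_ne List.nodup_range ?_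
    intro e he e' he' hne r hr hr'
    obtain ⟨p, -, hp⟩ := List.mem_filterMap.1 hr
    obtain ⟨p', -, hp'⟩ := List.mem_filterMap.1 hr'
    obtain ⟨h1, h2⟩ := R.emit_eq_some.1 hp
    obtain ⟨h3, h4⟩ := R.emit_eq_some.1 hp'
    exact hne (R.pair_injective hq (List.mem_range.1 he) (List.mem_range.1 he') h1 h3
      (h2.trans h4.symm)).1

/-- For the converse direction take the least position that witnesses the adjacency; the index
consists of the layer, the candidate and the tuple without the digit at that position. -/
theorem mem_edgeList (hq : 1 ≤ q) (r : ℕ × ℕ) : r ∈ R.edgeList (d * N * q ^ (h - 1)) ↔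
    ∃ i a y b x, r.1 = vertexEquiv h k g N q d (.inl (i, a)) ∧
      r.2 = vertexEquiv h k g N q d (.inr (y, b, x)) ∧ R.toGadget.Joined i a y b x := by
  simp only [edgeList, List.mem_flatMap, List.mem_range, List.mem_filterMap, emit_eq_some]
  constructor
  · rintro ⟨e, he, p, -, hp, rfl⟩
    obtain ⟨hy, ha, hw⟩ := bounds_of_lt hq he
    have hX := R.element_lt hq he p
    refine ⟨(p.1.slot p.2).1, ⟨_, ha⟩, ⟨_, hy⟩, p.1,
      finFunctionFinEquiv.symm ⟨R.element e p, hX⟩, ?_, ?_, ?_, ?_⟩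
    · rw [vertexEquiv_inl]
      rfl
    · rw [vertexEquiv_inr, Equiv.apply_symm_apply]
      rfl
    · rw [on_iff, Equiv.apply_symm_apply]
      exact hp.2.1
    · refine ⟨p.2, hp.1, rfl, Fin.ext ?_⟩
      rw [finFunctionFinEquiv_symm_val]
      exact R.digit_element hq he p
  · rintro ⟨i, a, y, b, x, h1, h2, hon, hex⟩
    classical
    let T : Finset (Fin h) := b.support.filter fun t =>
      (b.slot t).1 = i ∧ x t = R.toGadget.val y (b.slot t) a
    have hT : T.Nonempty := by
      obtain ⟨t, ht, h3⟩ := hex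
      exact ⟨t, mem_filter.2 ⟨ht, h3⟩⟩
    obtain ⟨ht, hti, htx⟩ := mem_filter.1 (T.min'_mem hT)
    set t := T.min' hT with htdef
    set X : Fin (q ^ h) := finFunctionFinEquiv x with hX
    have hdig : ∀ t' : Fin h, (X : ℕ) / q ^ t'.val % q = x t' := by
      intro t'
      rw [← finFunctionFinEquiv_symm_val, hX, Equiv.symm_apply_apply]
    have hN : 0 < N := a.pos
    have hw := removeDigit_lt hq t.2 X.2
    have hQ : 0 < q ^ (h - 1) := pow_pos hq _
    set e := (y * N + a) * q ^ (h - 1) + removeDigit q t X with he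
    have e1 : e % q ^ (h - 1) = removeDigit q t X := mul_add_mod_of_lt_right hw
    have e2 : e / q ^ (h - 1) = y * N + a := by
      rw [he, mul_comm, Nat.mul_add_div hQ, Nat.div_eq_of_lt hw, add_zero]
    have e3 : e / q ^ (h - 1) % N = a := by rw [e2, mul_add_mod_of_lt_right a.2]
    have e4 : e / q ^ (h - 1) / N = y := by
      rw [e2, mul_comm, Nat.mul_add_div hN, Nat.div_eq_of_lt a.2, add_zero]
    have e5 : R.element e (b, t) = X := by
      unfold element
      simp only [e1, e3, e4]
      have h5 : R.val y (b.slot t) a = X / q ^ t.val % q := by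
        rw [hdig, htx]
        rfl
      rw [h5, insertDigit_removeDigit hq]
    refine ⟨e, ?_, (b, t), mem_toList.2 (mem_univ _), ⟨ht, ?_, ?_⟩, ?_⟩
    · have h5 : (y : ℕ) * N + a + 1 ≤ d * N := by
        calc (y : ℕ) * N + a + 1 ≤ (y + 1) * N := by rw [Nat.add_mul, one_mul]; omega
          _ ≤ d * N := Nat.mul_le_mul_right _ y.2
      calc e < (y * N + a + 1) * q ^ (h - 1) := by
            rw [he, Nat.add_mul _ 1, one_mul]
            omega
        _ ≤ d * N * q ^ (h - 1) := Nat.mul_le_mul_right _ h5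
    · rw [e5]
      exact (R.on_iff b x).1 hon
    · intro t' ht' hlt hgrp heq
      simp only at ht' hlt hgrp heq
      rw [e5, e3, e4, hdig] at heq
      have h6 : t' ∈ T := mem_filter.2 ⟨ht', hgrp.trans hti, Fin.ext heq⟩
      exact absurd (T.min'_le t' h6) (not_le.2 hlt)
    · unfold pair
      simp only [e3, e4, e5]
      refine Prod.ext ?_ ?_
      · rw [h1, vertexEquiv_inl, hti]
      · rw [h2, vertexEquiv_inr]

/-- The gadget graph as an input of a graph problem. -/
noncomputable def graphInput (hq : 1 ≤ q) : GraphInput where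
  n := gadgetSize h k g N q d
  graph :=
    { Adj := fun u v => R.toGadget.Nbr ((vertexEquiv h k g N q d).symm u)
        ((vertexEquiv h k g N q d).symm v)
      symm := ⟨fun u v => by
        rcases (vertexEquiv h k g N q d).symm u with c | e <;>
        rcases (vertexEquiv h k g N q d).symm v with c' | e' <;> exact id⟩
      loopless := ⟨fun u => by
        rcases (vertexEquiv h k g N q d).symm u with c | e <;> exact id⟩ }
  edges := (R.edgeList (d * N * q ^ (h - 1))).attach.map fun r =>
    (⟨r.1.1, by
      obtain ⟨i, a, y, b, x, h1, -⟩ := (R.mem_edgeList hq r.1).1 r.2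
      rw [h1]
      exact Fin.is_lt _⟩,
     ⟨r.1.2, by
      obtain ⟨i, a, y, b, x, -, h2, -⟩ := (R.mem_edgeList hq r.1).1 r.2
      rw [h2]
      exact Fin.is_lt _⟩)
  nodup := by
    refine List.Nodup.map ?_ (List.nodup_attach.2 (R.nodup_edgeList hq))
    intro r r' hr
    simp only [Prod.mk.injEq, Fin.mk.injEq] at hr
    exact Subtype.ext (Prod.ext hr.1 hr.2)
  mem_edges := by
    intro u v
    have h1 : (u, v) ∈ ((R.edgeList (d * N * q ^ (h - 1))).attach.map fun r =>
      ((⟨r.1.1, by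
        obtain ⟨i, a, y, b, x, h1, -⟩ := (R.mem_edgeList hq r.1).1 r.2
        rw [h1]
        exact Fin.is_lt _⟩ : Fin (gadgetSize h k g N q d)),
       (⟨r.1.2, by
        obtain ⟨i, a, y, b, x, -, h2, -⟩ := (R.mem_edgeList hq r.1).1 r.2
        rw [h2]
        exact Fin.is_lt _⟩ : Fin (gadgetSize h k g N q d)))) ↔
        ((u : ℕ), (v : ℕ)) ∈ R.edgeList (d * N * q ^ (h - 1)) := by
      simp only [List.mem_map, List.mem_attach, true_and, Subtype.exists, Prod.mk.injEq]
      constructor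
      · rintro ⟨r, hr, rfl, rfl⟩
        exact hr
      · intro hr
        exact ⟨_, hr, rfl, rfl⟩
    rw [h1, mem_edgeList R hq]
    obtain ⟨u, rfl⟩ := (vertexEquiv h k g N q d).surjective u
    obtain ⟨v, rfl⟩ := (vertexEquiv h k g N q d).surjective v
    simp only [Equiv.symm_apply_apply, Fin.val_inj, EmbeddingLike.apply_eq_iff_eq]
    have hlt : ∀ i a y b x, vertexEquiv h k g N q d (.inl (i, a)) <
        vertexEquiv h k g N q d (.inr (y, b, x)) := by
      intro i a y b x
      rw [Fin.lt_def, vertexEquiv_inl, vertexEquiv_inr]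
      have h2 : (i : ℕ) * N + a < k * N := by
        calc (i : ℕ) * N + a < (i + 1) * N := by
              rw [Nat.add_mul, one_mul]
              omega
          _ ≤ k * N := Nat.mul_le_mul_right _ i.2
      omega
    constructor
    · rintro ⟨i, a, y, b, x, rfl, rfl, hj⟩
      exact ⟨hlt i a y b x, hj⟩
    · rintro ⟨hlt', hn⟩
      rcases u with ⟨i, a⟩ | ⟨y, b, x⟩ <;> rcases v with ⟨i', a'⟩ | ⟨y', b', x'⟩
      · exact hn.elim
      · exact ⟨i, a, y', b', x', rfl, rfl, hn⟩
      · exact absurd hlt' (hlt i' a' y b x).not_gt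
      · exact hn.elim

theorem encode_graphInput (hq : 1 ≤ q) : (R.graphInput hq).encode =
    gadgetSize h k g N q d :: (R.edgeList (d * N * q ^ (h - 1))).length ::
      (R.edgeList (d * N * q ^ (h - 1))).flatMap fun r => [r.1, r.2] := by
  unfold GraphInput.encode graphInput
  simp only [List.length_map, List.length_attach, List.flatMap_map]
  congr 2
  rw [List.flatMap_subtype (g := fun r => [r.1, r.2]) (fun _ _ => rfl), List.unattach_attach]

theorem threshold_le_answer_iff (hh : 2 ≤ h) (hq : 1 ≤ q) (hd : 1 ≤ d)
    (hval : ∀ y < d, ∀ s v, #{a : Fin N | R.val y s a = v} ≤ q ^ (h - 1)) (hk : 1 ≤ k) :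
    threshold h k g q d ≤ (partialDominatingSet k).answer (R.graphInput hq) ↔
      ∃ c : Fin k → Fin N, ∀ y : Fin d, ∀ P, R.active P →
        R.toGadget.rel fun t => R.toGadget.val y (P t) (c (P t).1) := by
  have hg : 1 ≤ k * g := Nat.mul_pos hk (Nat.pos_of_ne_zero (NeZero.ne g))
  have hval' : ∀ y s v, #{a | R.toGadget.val y s a = v} ≤ q ^ (h - 1) := by
    intro y s v
    have h1 := hval y y.2 s v
    have h2 : ({a | R.toGadget.val y s a = v} : Finset (Fin N)) =
        ({a : Fin N | R.val y s a = v} : Finset (Fin N)) := by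
      ext a
      simp only [mem_filter, mem_univ, true_and]
      exact Fin.ext_iff
    rw [h2]
    exact h1
  refine Iff.trans ?_ (R.toGadget.threshold_le_domCount_iff hh hq hd hval' hg)
  -- Needed for a supremum of natural numbers to reach the threshold only through one of its
  -- members; the supremum of the empty family is `0`.
  have h0 : 0 < threshold h k g q d := by
    unfold threshold
    omega
  have hdom : ∀ y : Fin k → Fin (gadgetSize h k g N q d),
      (dominated (R.graphInput hq).graph y).card =
        R.toGadget.domCount fun j => (vertexEquiv h k g N q d).symm (y j) := by
    intro y
    classical
    unfold dominated GadgetData.domCount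
    refine card_bijective (vertexEquiv h k g N q d).symm (Equiv.bijective _) fun v => ?_
    simp only [mem_filter, mem_univ, true_and]
    refine exists_congr fun j => or_congr ?_ Iff.rfl
    exact ((vertexEquiv h k g N q d).symm.injective.eq_iff).symm
  change threshold h k g q d ≤ univ.sup (fun y : Fin k → Fin (gadgetSize h k g N q d) =>
    (dominated (R.graphInput hq).graph y).card) ↔ _
  rw [Finset.le_sup_iff (by simpa using h0)]
  simp only [mem_univ, true_and, hdom]
  constructor
  · rintro ⟨y, hy⟩
    exact ⟨_, hy⟩
  · rintro ⟨z, hz⟩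
    refine ⟨fun j => vertexEquiv h k g N q d (z j), ?_⟩
    simpa using hz

end RawData

end FineGrained


/-! ### The command that writes the gadget graph -/

namespace FineGrained

open Finset

/-! ### Building expressions -/

namespace Expr

instance : Add Expr := ⟨.bin .add⟩
instance : Sub Expr := ⟨.bin .sub⟩
instance : Mul Expr := ⟨.bin .mul⟩
instance : Div Expr := ⟨.bin .div⟩
instance : Mod Expr := ⟨.bin .mod⟩

variable (s : AState) (a b : Expr)

@[simp] theorem eval_reg (r : Fin 16) : (Expr.reg r).eval s = s.reg r := rfl
@[simp] theorem eval_lit (v : ℕ) : (Expr.lit v).eval s = v := rfl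
@[simp] theorem eval_load : (Expr.load a).eval s = s.mem (a.eval s) := rfl
@[simp] theorem eval_add : (a + b).eval s = a.eval s + b.eval s := rfl
@[simp] theorem eval_sub : (a - b).eval s = a.eval s - b.eval s := rfl
@[simp] theorem eval_mul : (a * b).eval s = a.eval s * b.eval s := rfl
@[simp] theorem eval_div : (a / b).eval s = a.eval s / b.eval s := rfl
@[simp] theorem eval_mod : (a % b).eval s = a.eval s % b.eval s := rfl
@[simp] theorem eval_lt' : (Expr.bin .lt a b).eval s = if a.eval s < b.eval s then 1 else 0 := rfl
@[simp] theorem eval_eq : (Expr.bin .eq a b).eval s = if a.eval s = b.eval s then 1 else 0 := rfl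

/-- Powers. -/
def pow (a : Expr) : ℕ → Expr
  | 0 => .lit 1
  | n + 1 => a.pow n * a

@[simp] theorem eval_pow (n : ℕ) : (a.pow n).eval s = a.eval s ^ n := by
  induction n with
  | zero => rfl
  | succ n ih => rw [pow, eval_mul, ih, pow_succ]

/-- Sums of lists. -/
def listSum (l : List Expr) : Expr := l.foldr (· + ·) (.lit 0)

theorem eval_listSum (l : List Expr) : (listSum l).eval s = (l.map fun e => e.eval s).sum := by
  induction l with
  | nil => rfl
  | cons a l ih =>
    simp only [listSum, List.foldr_cons, eval_add, List.map_cons, List.sum_cons] at ih ⊢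
    rw [ih]

/-- Conjunctions: the value is nonzero if all values are nonzero. -/
def conj (l : List Expr) : Expr := l.foldr (· * ·) (.lit 1)

theorem eval_conj_ne_zero (l : List Expr) : (conj l).eval s ≠ 0 ↔ ∀ e ∈ l, e.eval s ≠ 0 := by
  induction l with
  | nil => simp [conj]
  | cons a l ih =>
    simp only [conj, List.foldr_cons, eval_mul, List.mem_cons, forall_eq_or_imp, ne_eq,
      mul_eq_zero, not_or] at ih ⊢
    rw [ih]

/-- The negation of a truth value. -/
def neg (a : Expr) : Expr := .bin .eq a (.lit 0)

theorem eval_neg_ne_zero : (neg a).eval s ≠ 0 ↔ a.eval s = 0 := by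
  simp only [neg, eval_eq, eval_lit]
  split_ifs with h <;> simp [h]

/-- The digit at position `t`. -/
def digit (q : Expr) (t : ℕ) (x : Expr) : Expr := x / q.pow t % q

@[simp] theorem eval_digit (t : ℕ) :
    (digit a t b).eval s = b.eval s / a.eval s ^ t % a.eval s := by
  simp [digit]

end Expr

open FineGrained.Expr

/-! ### The program that writes the gadget graph

Registers: `0` number of candidates per group, `1` radix of the values, `2` number of layers,
`3` address of the output, `4` current end of the output, `5` counter, `6` element number,
`7` limit of the counter, `8` candidate, `9` layer, `10` digits of the element number. -/

/-- The registers that are not changed while the edges are written. -/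
def IsParam (r : Fin 16) : Prop :=
  r ≠ 4 ∧ r ≠ 5 ∧ r ≠ 6 ∧ r ≠ 7 ∧ r ≠ 8 ∧ r ≠ 9 ∧ r ≠ 10

instance : DecidablePred IsParam := fun _ => by unfold IsParam; infer_instance

/-- Expressions for the data of a gadget graph. -/
structure GadgetCode (h k g : ℕ) where
  val : Fin k × Fin g → Expr
  rel : Expr
  active : SlotMap h k g → Prop

namespace GadgetCode

variable {h k g : ℕ} [NeZero g] (c : GadgetCode h k g)

open Classical in
/-- The condition that the elements of a block are joined to candidates. -/
noncomputable def onExpr : Block h k g → Expr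
  | .inl _ => .lit 1
  -- Activity and parity are settled when the program is composed; only the relation is tested at
  -- run time.
  | .inr b => if c.active b.1 then (if Odd #b.2 then c.rel else neg c.rel)
      else if Odd #b.2 then .lit 1 else .lit 0

/-- The condition that an adjacency is written. -/
noncomputable def condExpr (p : Spec h k g) : Expr :=
  if p.2 ∈ p.1.support then
    c.onExpr p.1 * conj ((p.1.support.filter fun t =>
      t < p.2 ∧ (p.1.slot t).1 = (p.1.slot p.2).1).toList.map fun t : Fin h =>
        neg (.bin .eq (digit (.reg 1) t.val (.reg 6)) (c.val (p.1.slot t))))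
  else .lit 0

noncomputable def elementExpr (p : Spec h k g) : Expr :=
  .reg 10 / (Expr.reg 1).pow p.2 * (Expr.reg 1).pow (p.2 + 1) +
    c.val (p.1.slot p.2) * (Expr.reg 1).pow p.2 + .reg 10 % (Expr.reg 1).pow p.2

noncomputable def emitCmd (p : Spec h k g) : Cmd :=
  .seq (.assign 6 (c.elementExpr p)) (.ite (c.condExpr p)
    (.seq (.store (.reg 4) (.lit (p.1.slot p.2).1 * .reg 0 + .reg 8))
      (.seq (.store (.reg 4 + .lit 1) (.lit k * .reg 0 +
        ((.reg 9 * .lit (Fintype.card (Block h k g)) + .lit (blockEquiv h k g p.1)) *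
          (Expr.reg 1).pow h + .reg 6)))
        (.assign 4 (.reg 4 + .lit 2)))) .nop)

noncomputable def emitAll (l : List (Spec h k g)) : Cmd :=
  l.foldr (fun p d => .seq (c.emitCmd p) d) .nop

noncomputable def bodyCmd : Cmd :=
  .seq (.assign 10 (.reg 5 % (Expr.reg 1).pow (h - 1)))
    (.seq (.assign 8 (.reg 5 / (Expr.reg 1).pow (h - 1) % .reg 0))
      (.seq (.assign 9 (.reg 5 / (Expr.reg 1).pow (h - 1) / .reg 0))
        (.seq (c.emitAll (specs h k g)) (.assign 5 (.reg 5 + .lit 1)))))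

def hitExpr (h j : ℕ) : Expr :=
  (Expr.reg 1).pow h - (Expr.reg 1 - .lit 1).pow j * (Expr.reg 1).pow (h - j)

noncomputable def thresholdExpr (h k g : ℕ) : Expr :=
  .lit k + .reg 2 * (.lit (k * copies h k g) * hitExpr h 2 +
    .lit ((k * g) ^ h) * listSum ((univ : Finset (Finset (Fin h))).toList.map fun J =>
      if Odd #J then .lit 0 else hitExpr h #J) + .lit ((k * g) ^ h))

def copyCmd : Cmd :=
  .while (.bin .lt (.reg 5) (.reg 4))
    (.seq (.store (.reg 5) (.load (.reg 3 + .reg 5))) (.assign 5 (.reg 5 + .lit 1)))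

/-- The edges are written above the address in register `3`, behind two cells reserved for the
header, because the input must stay readable and the number of edges is known only at the end. It is
then computed from the length of the output, and everything moves down to address `0`. -/
noncomputable def buildCmd : Cmd :=
  .seq (.assign 4 (.reg 3 + .lit 2)) (.seq (.assign 5 (.lit 0))
    (.seq (.assign 7 (.reg 2 * .reg 0 * (Expr.reg 1).pow (h - 1)))
      (.seq (.while (.bin .lt (.reg 5) (.reg 7)) c.bodyCmd)
        (.seq (.store (.reg 3) (.lit k * .reg 0 +
            .reg 2 * (.lit (Fintype.card (Block h k g)) * (Expr.reg 1).pow h)))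
          (.seq (.store (.reg 3 + .lit 1) ((.reg 4 - .reg 3 - .lit 2) / .lit 2))
            (.seq (.assign 5 (.lit 0))
              (.seq copyCmd (.assign 0 (thresholdExpr h k g)))))))))

end GadgetCode

theorem eval_hitExpr (s : AState) (h j : ℕ) :
    (GadgetCode.hitExpr h j).eval s = hitCount h (s.reg 1) j := by
  simp [GadgetCode.hitExpr, hitCount]

theorem eval_thresholdExpr (s : AState) (h k g : ℕ) :
    (GadgetCode.thresholdExpr h k g).eval s = threshold h k g (s.reg 1) (s.reg 2) := by
  simp only [GadgetCode.thresholdExpr, eval_add, eval_lit, eval_mul, eval_reg, eval_hitExpr,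
    eval_listSum, List.map_map, threshold, baseCount]
  rw [← Finset.sum_map_toList]
  congr 6
  refine List.map_congr_left fun J _ => ?_
  simp only [Function.comp_apply]
  split_ifs
  · rfl
  · rw [eval_hitExpr]

/-- The memory with a list of pairs written behind two free cells. -/
def outMem (mem : ℕ → ℕ) (base : ℕ) (l : List (ℕ × ℕ)) : ℕ → ℕ := fun i =>
  if i < base + 2 then mem i else (l.flatMap fun r => [r.1, r.2]).getD (i - (base + 2)) 0

theorem length_flatMap_pair (l : List (ℕ × ℕ)) :
    (l.flatMap fun r => [r.1, r.2]).length = 2 * l.length := by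
  induction l with
  | nil => rfl
  | cons a l ih =>
    simp only [List.flatMap_cons, List.length_append, ih, List.length_cons, List.length_nil]
    omega

theorem outMem_append (mem : ℕ → ℕ) (base : ℕ) (l : List (ℕ × ℕ)) (u v : ℕ) :
    Function.update (Function.update (outMem mem base l) (base + 2 + 2 * l.length) u)
      (base + 2 + 2 * l.length + 1) v = outMem mem base (l ++ [(u, v)]) := by
  have hl := length_flatMap_pair l
  funext i
  simp only [Function.update_apply, outMem, List.flatMap_append, List.flatMap_cons,
    List.flatMap_nil, List.append_nil]
  by_cases h0 : i < base + 2
  · rw [if_neg (by omega), if_neg (by omega), if_pos h0, if_pos h0]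
  · rw [if_neg h0, if_neg h0]
    by_cases h1 : i - (base + 2) < 2 * l.length
    · rw [if_neg (by omega), if_neg (by omega), List.getD_append _ _ _ _ (by omega)]
    · rw [List.getD_append_right _ _ _ _ (by omega), hl]
      by_cases h2 : i = base + 2 + 2 * l.length + 1
      · rw [if_pos h2, h2, show base + 2 + 2 * l.length + 1 - (base + 2) - 2 * l.length = 1 by omega]
        rfl
      · rw [if_neg h2]
        by_cases h3 : i = base + 2 + 2 * l.length
        · rw [if_pos h3, h3, show base + 2 + 2 * l.length - (base + 2) - 2 * l.length = 0 by omega]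
          rfl
        · rw [if_neg h3, List.getD_eq_default _ _ (by omega), List.getD_eq_default _ _ (by
            simp only [List.length_cons, List.length_nil]
            omega)]

/-! ### Correctness and running time of the command -/

namespace GadgetCode

variable {h k g N q d V : ℕ} [NeZero g]

/-- In states that agree with `σ` on the parameters and below the output, the expressions compute
the gadget data. -/
structure Computes (c : GadgetCode h k g) (R : RawData h k g N q d) (σ : AState) : Prop where
  reg0 : σ.reg 0 = N
  reg1 : σ.reg 1 = q
  reg2 : σ.reg 2 = d
  mem : ∀ i, σ.reg 3 ≤ i → σ.mem i = 0
  active : ∀ P, c.active P ↔ R.active P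
  val : ∀ s : AState, (∀ r, IsParam r → s.reg r = σ.reg r) →
    (∀ i < σ.reg 3, s.mem i = σ.mem i) → s.reg 8 < N → s.reg 9 < d →
    ∀ p, (c.val p).eval s = R.val (s.reg 9) p (s.reg 8)
  rel : ∀ s : AState, (∀ r, IsParam r → s.reg r = σ.reg r) →
    (∀ i < σ.reg 3, s.mem i = σ.mem i) → s.reg 6 < q ^ h → (c.rel.eval s ≠ 0 ↔ R.rel (s.reg 6))

/-- The state after writing a list of pairs, within one round of the main loop. -/
structure Emitting (σ : AState) (e w a y : ℕ) (l : List (ℕ × ℕ)) (lim : ℕ) (s : AState) : Prop where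
  param : ∀ r, IsParam r → s.reg r = σ.reg r
  reg4 : s.reg 4 = σ.reg 3 + 2 + 2 * l.length
  reg5 : s.reg 5 = e
  reg7 : s.reg 7 = lim
  reg8 : s.reg 8 = a
  reg9 : s.reg 9 = y
  reg10 : s.reg 10 = w
  mem : s.mem = outMem σ.mem (σ.reg 3) l

theorem Emitting.mem_eq {σ s : AState} {e w a y lim : ℕ} {l : List (ℕ × ℕ)}
    (hs : Emitting σ e w a y l lim s) : ∀ i < σ.reg 3, s.mem i = σ.mem i := by
  intro i hi
  rw [hs.mem]
  exact if_pos (by omega)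

variable {c : GadgetCode h k g} {R : RawData h k g N q d} {σ : AState}

theorem Computes.onExpr (hc : c.Computes R σ) {s : AState}
    (hp : ∀ r, IsParam r → s.reg r = σ.reg r) (hm : ∀ i < σ.reg 3, s.mem i = σ.mem i)
    (h6 : s.reg 6 < q ^ h) (b : Block h k g) : (c.onExpr b).eval s ≠ 0 ↔ R.On b (s.reg 6) := by
  have hrel := hc.rel s hp hm h6
  rcases b with b | b
  · simp [GadgetCode.onExpr, RawData.On]
  · simp only [GadgetCode.onExpr, RawData.On, ← hc.active, ← hrel]
    by_cases h1 : c.active b.1 <;> by_cases h2 : Odd #b.2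
    · simp [h1, h2]
    · simp only [h1, h2, if_true, if_false, eval_neg_ne_zero]
      simp
    · simp [h1, h2]
    · simp [h1, h2]

theorem condExpr_ne_zero (hc : c.Computes R σ) {e lim : ℕ} {l : List (ℕ × ℕ)} {s : AState}
    (hq : 1 ≤ q) (he : e < d * N * q ^ (h - 1)) {p : Spec h k g}
    (hs : Emitting σ e (e % q ^ (h - 1)) (e / q ^ (h - 1) % N) (e / q ^ (h - 1) / N) l lim s)
    (h6 : s.reg 6 = R.element e p) : (c.condExpr p).eval s ≠ 0 ↔ R.Emits e p := by
  obtain ⟨hy, ha, hw⟩ := RawData.bounds_of_lt (h := h) hq he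
  have hlt := R.element_lt hq he p
  rw [← h6] at hlt
  have hon := hc.onExpr hs.param hs.mem_eq hlt p.1
  have hv := hc.val s hs.param hs.mem_eq (by rwa [hs.reg8]) (by rwa [hs.reg9])
  have h1 : s.reg 1 = q := by rw [hs.param 1 (by decide), hc.reg1]
  unfold condExpr RawData.Emits
  split_ifs with hsup
  · rw [eval_mul, mul_ne_zero_iff, hon, eval_conj_ne_zero, h6]
    simp only [hsup, true_and]
    refine and_congr Iff.rfl ?_
    have key : ∀ t : Fin h, (neg (.bin .eq (digit (.reg 1) t.val (.reg 6))
        (c.val (p.1.slot t)))).eval s ≠ 0 ↔ R.element e p / q ^ t.val % q ≠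
          R.val (e / q ^ (h - 1) / N) (p.1.slot t) (e / q ^ (h - 1) % N) := by
      intro t
      rw [eval_neg_ne_zero, eval_eq, eval_digit, hv, eval_reg, eval_reg, h1, h6, hs.reg8, hs.reg9]
      simp
    constructor
    · intro H t ht hlt hgrp
      exact (key t).1 (H _ (List.mem_map.2 ⟨t, mem_toList.2 (mem_filter.2 ⟨ht, hlt, hgrp⟩), rfl⟩))
    · intro H f hf
      obtain ⟨t, ht, rfl⟩ := List.mem_map.1 hf
      obtain ⟨ht, hlt, hgrp⟩ := mem_filter.1 (mem_toList.1 ht)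
      exact (key t).2 (H t ht hlt hgrp)
  · simp [hsup]

theorem tri_emitCmd (hc : c.Computes R σ) {e lim : ℕ} {l : List (ℕ × ℕ)} {s : AState}
    (hq : 1 ≤ q) (he : e < d * N * q ^ (h - 1)) (p : Spec h k g)
    (hs : Emitting σ e (e % q ^ (h - 1)) (e / q ^ (h - 1) % N) (e / q ^ (h - 1) / N) l lim s)
    (hV : σ.reg 3 + 2 + 2 * (l.length + 1) < V) (hqV : q ^ h ≤ V)
    (hnV : gadgetSize h k g N q d ≤ V) :
    Cmd.Tri V (c.emitCmd p) s 6 (Emitting σ e (e % q ^ (h - 1)) (e / q ^ (h - 1) % N)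
      (e / q ^ (h - 1) / N) (l ++ (R.emit e p).toList) lim) := by
  obtain ⟨hy, ha, hw⟩ := RawData.bounds_of_lt (h := h) hq he
  have hv := hc.val s hs.param hs.mem_eq (by rwa [hs.reg8]) (by rwa [hs.reg9])
  have h0 : s.reg 0 = N := by rw [hs.param 0 (by decide), hc.reg0]
  have h1 : s.reg 1 = q := by rw [hs.param 1 (by decide), hc.reg1]
  have hX : (c.elementExpr p).eval s = R.element e p := by
    simp only [elementExpr, eval_add, eval_mul, eval_div, eval_mod, eval_reg, eval_pow, hv, h1,
      hs.reg8, hs.reg9, hs.reg10]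
    rfl
  have hlt := R.element_lt hq he p
  have hs' : Emitting σ e (e % q ^ (h - 1)) (e / q ^ (h - 1) % N) (e / q ^ (h - 1) / N) l lim
      (s.setReg 6 (R.element e p)) := by
    refine ⟨fun r hr => ?_, ?_, ?_, ?_, ?_, ?_, ?_, hs.mem⟩
    · rw [AState.setReg_reg_of_ne _ _ hr.2.2.1, hs.param r hr]
    all_goals rw [AState.setReg_reg_of_ne _ _ (by decide)]
    · exact hs.reg4
    · exact hs.reg5
    · exact hs.reg7
    · exact hs.reg8
    · exact hs.reg9
    · exact hs.reg10
  unfold emitCmd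
  refine (Cmd.Tri.seq (t' := 5) (Cmd.Tri.assign (by rw [hX]; omega) ?_)).conseq le_rfl fun _ => id
  rw [hX]
  set s1 := s.setReg 6 (R.element e p) with hs1
  have h6 : s1.reg 6 = R.element e p := AState.setReg_reg _ _ _
  have hcond := condExpr_ne_zero hc hq he hs' h6
  refine (Cmd.Tri.ite (t := 4) (fun hne => ?_) fun hz => ?_).conseq le_rfl fun _ => id
  · have hem := hcond.1 hne
    have h10 : s1.reg 0 = N := by rw [hs'.param 0 (by decide), hc.reg0]
    have h11 : s1.reg 1 = q := by rw [hs'.param 1 (by decide), hc.reg1]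
    have hemit : R.emit e p = some (R.pair e p) := R.emit_eq_some.2 ⟨hem, rfl⟩
    -- The numbers to be stored are numbers of vertices of the graph, hence below `gadgetSize` and
    -- so below the bound for words.
    have hmem : R.pair e p ∈ R.edgeList (d * N * q ^ (h - 1)) := by
      unfold RawData.edgeList
      rw [List.mem_flatMap]
      exact ⟨e, List.mem_range.2 he, List.mem_filterMap.2 ⟨p, mem_toList.2 (mem_univ _), hemit⟩⟩
    obtain ⟨i, a, y, b, x, hu, hv', -⟩ := (R.mem_edgeList hq _).1 hmem
    have hult : (R.pair e p).1 < V := by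
      rw [hu]
      exact (Fin.is_lt _).trans_le hnV
    have hvlt : (R.pair e p).2 < V := by
      rw [hv']
      exact (Fin.is_lt _).trans_le hnV
    have hA : (Expr.lit (p.1.slot p.2).1 * .reg 0 + .reg 8).eval s1 = (R.pair e p).1 := by
      simp only [eval_add, eval_mul, eval_lit, eval_reg, h10, hs'.reg8]
      rfl
    have hB : ∀ s2 : AState, s2.reg = s1.reg → (Expr.lit k * .reg 0 +
        ((.reg 9 * .lit (Fintype.card (Block h k g)) + .lit (blockEquiv h k g p.1)) *
          (Expr.reg 1).pow h + .reg 6)).eval s2 = (R.pair e p).2 := by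
      intro s2 h2
      simp only [eval_add, eval_mul, eval_lit, eval_reg, eval_pow, h2, h10, h11, hs'.reg9, h6]
      rfl
    refine (Cmd.Tri.seq (t' := 2) (Cmd.Tri.store (by rw [hA]; exact hult)
      (Cmd.Tri.seq (Cmd.Tri.store ?_ (Cmd.Tri.assign ?_ ?_))))).conseq (by omega) fun _ => id
    · rw [hB (s1.setMem _ _) rfl]
      exact hvlt
    · simp only [eval_add, eval_reg, eval_lit, AState.setMem_reg, hs'.reg4]
      omega
    · rw [hA, hB (s1.setMem _ _) rfl, hemit, Option.toList_some]
      simp only [eval_add, eval_reg, eval_lit, AState.setMem_reg, hs'.reg4]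
      refine ⟨fun r hr => ?_, ?_, ?_, ?_, ?_, ?_, ?_, ?_⟩
      · rw [AState.setReg_reg_of_ne _ _ hr.1]
        exact hs'.param r hr
      · rw [AState.setReg_reg, List.length_append, List.length_singleton]
        ring
      · exact hs'.reg5
      · exact hs'.reg7
      · exact hs'.reg8
      · exact hs'.reg9
      · exact hs'.reg10
      · simp only [AState.setReg_mem, AState.setMem_mem]
        rw [hs'.mem]
        exact outMem_append _ _ _ _ _
  · have hem : R.emit e p = none := by
      unfold RawData.emit
      rw [if_neg fun h => hcond.2 h hz]
    rw [hem, Option.toList_none, List.append_nil]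
    exact (Cmd.Tri.nop hs').conseq (by omega) fun _ => id

theorem tri_emitAll (hc : c.Computes R σ) {e lim : ℕ} (hq : 1 ≤ q)
    (he : e < d * N * q ^ (h - 1)) (hqV : q ^ h ≤ V) (hnV : gadgetSize h k g N q d ≤ V)
    (ps : List (Spec h k g)) : ∀ (l : List (ℕ × ℕ)) (s : AState),
    Emitting σ e (e % q ^ (h - 1)) (e / q ^ (h - 1) % N) (e / q ^ (h - 1) / N) l lim s →
    σ.reg 3 + 2 + 2 * (l.length + ps.length) < V →
    Cmd.Tri V (c.emitAll ps) s (6 * ps.length + 1) (Emitting σ e (e % q ^ (h - 1))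
      (e / q ^ (h - 1) % N) (e / q ^ (h - 1) / N) (l ++ ps.filterMap (R.emit e)) lim) := by
  induction ps with
  | nil =>
    intro l s hs _
    rw [List.filterMap_nil, List.append_nil]
    exact Cmd.Tri.nop hs
  | cons p ps ih =>
    intro l s hs hV
    rw [List.length_cons] at hV
    refine (Cmd.Tri.seq ((tri_emitCmd hc hq he p hs (by omega) hqV hnV).conseq le_rfl
      fun s1 hs1 => ih _ s1 hs1 ?_)).conseq (by rw [List.length_cons]; omega) fun s2 hs2 => ?_
    · have : (R.emit e p).toList.length ≤ 1 := by
        cases R.emit e p <;> simp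
      rw [List.length_append]
      omega
    · rw [List.append_assoc] at hs2
      convert hs2 using 2
      rw [List.filterMap_cons]
      cases R.emit e p <;> rfl

/-- The state before a round of the main loop. -/
structure Looping (R : RawData h k g N q d) (σ : AState) (lim e : ℕ) (s : AState) : Prop where
  param : ∀ r, IsParam r → s.reg r = σ.reg r
  reg4 : s.reg 4 = σ.reg 3 + 2 + 2 * (R.edgeList e).length
  reg5 : s.reg 5 = e
  reg7 : s.reg 7 = lim
  mem : s.mem = outMem σ.mem (σ.reg 3) (R.edgeList e)

theorem tri_bodyCmd (hc : c.Computes R σ) {e lim : ℕ} (hq : 1 ≤ q) (hlim : d * N * q ^ (h - 1) = lim)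
    (he : e < lim) (hqV : q ^ h ≤ V) (hnV : gadgetSize h k g N q d ≤ V) (hlV : lim < V)
    (hV : σ.reg 3 + 2 + 2 * ((specs h k g).length * lim) < V) {s : AState}
    (hs : Looping R σ lim e s) :
    Cmd.Tri V c.bodyCmd s (6 * (specs h k g).length + 5) (Looping R σ lim (e + 1)) := by
  have he' : e < d * N * q ^ (h - 1) := by rwa [hlim]
  have h0 : s.reg 0 = N := by rw [hs.param 0 (by decide), hc.reg0]
  have h1 : s.reg 1 = q := by rw [hs.param 1 (by decide), hc.reg1]
  set w := e % q ^ (h - 1) with hw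
  set a := e / q ^ (h - 1) % N with ha
  set y := e / q ^ (h - 1) / N with hy
  have hwV : w < V := (Nat.mod_le _ _).trans_lt (by omega)
  have haV : a < V := ((Nat.mod_le _ _).trans (Nat.div_le_self _ _)).trans_lt (by omega)
  have hyV : y < V := ((Nat.div_le_self _ _).trans (Nat.div_le_self _ _)).trans_lt (by omega)
  unfold bodyCmd
  refine (Cmd.Tri.seq (Cmd.Tri.assign ?_ (Cmd.Tri.seq (Cmd.Tri.assign ?_
    (Cmd.Tri.seq (Cmd.Tri.assign ?_ (Cmd.Tri.seq ((tri_emitAll (lim := lim) hc hq he' hqV hnV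
      (specs h k g) (R.edgeList e) _ ?_ ?_).conseq le_rfl
      fun s' hs' => Cmd.Tri.assign ?_ ?_)))))))).conseq (by omega) fun _ => id
  · simp only [eval_mod, eval_reg, eval_pow, hs.reg5, h1]
    exact hwV
  · simp only [eval_mod, eval_div, eval_reg, eval_pow, AState.setReg_reg_of_ne _ _
      (show (5 : Fin 16) ≠ 10 by decide), AState.setReg_reg_of_ne _ _
      (show (1 : Fin 16) ≠ 10 by decide), AState.setReg_reg_of_ne _ _
      (show (0 : Fin 16) ≠ 10 by decide), hs.reg5, h1, h0]
    exact haV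
  · simp only [eval_div, eval_reg, eval_pow, AState.setReg_reg_of_ne _ _
      (show (5 : Fin 16) ≠ 10 by decide), AState.setReg_reg_of_ne _ _
      (show (1 : Fin 16) ≠ 10 by decide), AState.setReg_reg_of_ne _ _
      (show (0 : Fin 16) ≠ 10 by decide), AState.setReg_reg_of_ne _ _
      (show (5 : Fin 16) ≠ 8 by decide), AState.setReg_reg_of_ne _ _
      (show (1 : Fin 16) ≠ 8 by decide), AState.setReg_reg_of_ne _ _
      (show (0 : Fin 16) ≠ 8 by decide), hs.reg5, h1, h0]
    exact hyV
  · refine ⟨fun r hr => ?_, ?_, ?_, ?_, ?_, ?_, ?_, hs.mem⟩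
    · rw [AState.setReg_reg_of_ne _ _ hr.2.2.2.2.2.1, AState.setReg_reg_of_ne _ _ hr.2.2.2.2.1,
        AState.setReg_reg_of_ne _ _ hr.2.2.2.2.2.2, hs.param r hr]
    · exact hs.reg4
    · exact hs.reg5
    · exact hs.reg7
    · change s.reg 5 / (((Expr.reg 1).pow (h - 1)).eval _) % s.reg 0 = a
      rw [eval_pow]
      change s.reg 5 / s.reg 1 ^ (h - 1) % s.reg 0 = a
      rw [hs.reg5, h0, h1]
    · change s.reg 5 / (((Expr.reg 1).pow (h - 1)).eval _) / s.reg 0 = y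
      rw [eval_pow]
      change s.reg 5 / s.reg 1 ^ (h - 1) / s.reg 0 = y
      rw [hs.reg5, h0, h1]
    · change s.reg 5 % (((Expr.reg 1).pow (h - 1)).eval _) = w
      rw [eval_pow, eval_reg, hs.reg5, h1]
  · have h2 := R.length_edgeList_le e
    have h3 : (specs h k g).length * (e + 1) ≤ (specs h k g).length * lim :=
      Nat.mul_le_mul_left _ he
    rw [Nat.mul_succ] at h3
    omega
  · rw [eval_add, eval_reg, eval_lit, hs'.reg5]
    omega
  · rw [eval_add, eval_reg, eval_lit, hs'.reg5]
    rw [← RawData.edgeList_succ] at hs'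
    refine ⟨fun r hr => ?_, hs'.reg4, AState.setReg_reg _ _ _, hs'.reg7, hs'.mem⟩
    rw [AState.setReg_reg_of_ne _ _ hr.2.1, hs'.param r hr]

/-- Copying in increasing order is safe although the ranges may overlap, since cell `base + j` is
read before it is overwritten. The loop runs up to the end `n` of the output and not just for its
length, so that the remains of the input and the tables are overwritten by the zeros behind the
output. -/
theorem tri_copyCmd {s : AState} {base n : ℕ} (h3 : s.reg 3 = base) (h4 : s.reg 4 = n)
    (h5 : s.reg 5 = 0) (hs : ∀ i, s.mem i < V) (hnV : n < V) (hmem : ∀ i, n ≤ i → s.mem i = 0) :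
    Cmd.Tri V copyCmd s (n * 3 + 1) fun s' =>
      (s'.mem = fun i => s.mem (base + i)) ∧ ∀ r, r ≠ 5 → s'.reg r = s.reg r := by
  let I : ℕ → AState → Prop := fun j s' => s'.reg 5 = j ∧ (∀ r, r ≠ 5 → s'.reg r = s.reg r) ∧
    s'.mem = fun i => if i < j then s.mem (base + i) else s.mem i
  refine (Cmd.Tri.loop I n (t := 2) ?_ ?_ ?_).conseq le_rfl ?_
  · rintro j hj s' ⟨hj5, hr, hm⟩
    have e3 : s'.reg 3 = base := by rw [hr 3 (by decide), h3]
    have e4 : s'.reg 4 = n := by rw [hr 4 (by decide), h4]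
    have ev : (Expr.load (.reg 3 + .reg 5)).eval s' = s.mem (base + j) := by
      rw [eval_load, eval_add, eval_reg, eval_reg, e3, hj5, hm]
      simp
    refine ⟨by simp [hj5, e4, hj], (Cmd.Tri.seq (Cmd.Tri.store ?_
      (Cmd.Tri.assign ?_ ⟨?_, ?_, ?_⟩))).conseq le_rfl fun _ => id⟩
    · rw [ev]
      exact hs _
    · simp only [eval_add, eval_reg, eval_lit, AState.setMem_reg, hj5]
      omega
    · simp only [eval_add, eval_reg, eval_lit, AState.setMem_reg, hj5, AState.setReg_reg]
    · intro r hr5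
      rw [AState.setReg_reg_of_ne _ _ hr5]
      exact hr r hr5
    · simp only [AState.setReg_mem, AState.setMem_mem]
      rw [ev, eval_reg, hj5, hm]
      funext i
      rw [Function.update_apply]
      by_cases hij : i = j
      · subst hij
        simp
      · rw [if_neg hij]
        by_cases hlt : i < j
        · rw [if_pos hlt, if_pos (by omega)]
        · rw [if_neg hlt, if_neg (by omega)]
  · rintro s' ⟨hj5, hr, -⟩
    simp [hj5, hr 4 (by decide), h4]
  · exact ⟨h5, fun _ _ => rfl, by simp⟩
  · rintro s' ⟨-, hr, hm⟩
    refine ⟨?_, hr⟩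
    rw [hm]
    funext i
    split_ifs with hi
    · rfl
    · rw [hmem i (by omega), hmem (base + i) (by omega)]

/-- The constant in the bounds for the program that writes the gadget graph. -/
noncomputable def buildConst (h k g : ℕ) : ℕ :=
  40 * ((specs h k g).length + k + Fintype.card (Block h k g) + (k * g) ^ h + 1)

theorem baseCount_le : baseCount h k g q ≤ Fintype.card (Block h k g) * q ^ h := by
  have hhit : ∀ j, hitCount h q j ≤ q ^ h := fun j => Nat.sub_le _ _
  have h1 : (∑ J : Finset (Fin h), if Odd #J then 0 else hitCount h q #J) ≤ 2 ^ h * q ^ h := by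
    calc _ ≤ ∑ _J : Finset (Fin h), q ^ h := by
          refine sum_le_sum fun J _ => ?_
          split_ifs
          · exact Nat.zero_le _
          · exact hhit _
      _ = 2 ^ h * q ^ h := by simp
  rw [show Fintype.card (Block h k g) = k * copies h k g + (k * g) ^ h * 2 ^ h by simp]
  unfold baseCount
  calc _ ≤ k * copies h k g * q ^ h + (k * g) ^ h * (2 ^ h * q ^ h) := by
        gcongr
        exact hhit 2
    _ = _ := by ring

theorem tri_buildCmd (hc : c.Computes R σ) (hq : 1 ≤ q) (hN : 1 ≤ N) (hd : 1 ≤ d)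
    (hV : σ.reg 3 + buildConst h k g * (d * N * q ^ h) < V) (hσ : σ.Bdd V) :
    Cmd.Tri V c.buildCmd σ (buildConst h k g * (σ.reg 3 + d * N * q ^ (h - 1) + 1)) fun s =>
      (s.mem = fun i => (R.graphInput hq).encode.getD i 0) ∧ s.reg 0 = threshold h k g q d := by
  set lim := d * N * q ^ (h - 1) with hlim
  set U := d * N * q ^ h with hU
  set B := Fintype.card (Block h k g) with hB
  set p := (k * g) ^ h with hp
  set S := (specs h k g).length with hS
  have hK : buildConst h k g = 40 * (S + k + B + p + 1) := rfl
  have hqh : 1 ≤ q ^ h := Nat.one_le_pow _ _ hq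
  have hU1 : 1 ≤ U := Nat.mul_pos (Nat.mul_pos hd hN) hqh
  have hlimU : lim ≤ U := by
    rw [hlim, hU]
    exact Nat.mul_le_mul_left _ (Nat.pow_le_pow_right hq (by omega))
  have hqU : q ^ h ≤ U := Nat.le_mul_of_pos_left _ (Nat.mul_pos hd hN)
  have hNU : N ≤ U := by
    calc N ≤ d * N := Nat.le_mul_of_pos_left _ hd
      _ ≤ U := Nat.le_mul_of_pos_right _ hqh
  have hdqU : d * q ^ h ≤ U := by
    rw [hU]
    gcongr
    exact Nat.le_mul_of_pos_right _ hN
  have hdU : d ≤ U := le_trans (Nat.le_mul_of_pos_right _ hqh) hdqU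
  have hsize : gadgetSize h k g N q d ≤ (k + B) * U := by
    unfold gadgetSize
    calc k * N + d * (B * q ^ h) = k * N + B * (d * q ^ h) := by ring
      _ ≤ k * U + B * U := by gcongr
      _ = _ := by ring
  have hthr : threshold h k g q d ≤ (k + B + p) * U := by
    unfold threshold
    calc k + d * (baseCount h k g q + p) ≤ k * U + d * (B * q ^ h + p) := by
          gcongr
          · exact Nat.le_mul_of_pos_right _ hU1
          · exact baseCount_le
      _ = k * U + (B * (d * q ^ h) + p * d) := by ring
      _ ≤ k * U + (B * U + p * U) := by gcongr
      _ = _ := by ring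
  have hV2 : σ.reg 3 + (40 * (S * U) + 40 * (k * U) + 40 * (B * U) + 40 * (p * U) + 40 * U) < V := by
    calc _ = σ.reg 3 + buildConst h k g * U := by rw [hK]; ring
      _ < V := hV
  have hSlim : S * lim ≤ S * U := Nat.mul_le_mul_left _ hlimU
  simp only [add_mul] at hsize hthr
  have hlen := R.length_edgeList_le lim
  rw [← hS] at hlen
  have h0 := hc.reg0
  have h1 := hc.reg1
  have h2 := hc.reg2
  set base := σ.reg 3 with hbase
  have hinit : Looping R σ lim 0 (((σ.setReg 4 (base + 2)).setReg 5 0).setReg 7 lim) := by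
    refine ⟨fun r hr => ?_, rfl, rfl, rfl, ?_⟩
    · rw [AState.setReg_reg_of_ne _ _ hr.2.2.2.1, AState.setReg_reg_of_ne _ _ hr.2.1,
        AState.setReg_reg_of_ne _ _ hr.1]
    · simp only [AState.setReg_mem]
      funext i
      simp only [outMem, RawData.edgeList, List.range_zero, List.flatMap_nil]
      split_ifs with hi
      · rfl
      · rw [hc.mem i (by omega)]
        rfl
  have hbV : base + 2 + 2 * (S * lim) < V := by omega
  have hloop := Cmd.Tri.loop (V := V) (e := .bin .lt (.reg 5) (.reg 7)) (c := c.bodyCmd)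
    (Looping R σ lim) lim (t := 6 * S + 5)
    (fun j hj s hs => ⟨by simp [hs.reg5, hs.reg7, hj], tri_bodyCmd hc hq rfl hj (by omega)
      (by omega) (by omega) hbV hs⟩)
    (fun s hs => by simp [hs.reg5, hs.reg7]) hinit
  have e7 : (Expr.reg 2 * .reg 0 * (Expr.reg 1).pow (h - 1)).eval
      ((σ.setReg 4 (base + 2)).setReg 5 0) = lim := by
    simp only [eval_mul, eval_reg, eval_pow]
    change σ.reg 2 * σ.reg 0 * σ.reg 1 ^ (h - 1) = lim
    rw [h0, h1, h2]
  set len := (R.edgeList lim).length with hlendef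
  have hfinal : ∀ s, Looping R σ lim lim s → s.Bdd V → Cmd.Tri V (.seq (.store (.reg 3)
      (.lit k * .reg 0 + .reg 2 * (.lit (Fintype.card (Block h k g)) * (Expr.reg 1).pow h)))
          (.seq (.store (.reg 3 + .lit 1) ((.reg 4 - .reg 3 - .lit 2) / .lit 2))
            (.seq (.assign 5 (.lit 0))
              (.seq copyCmd (.assign 0 (thresholdExpr h k g)))))) s
      (1 + (1 + (1 + ((base + 2 + 2 * len) * 3 + 1 + 1)))) fun s =>
      (s.mem = fun i => (R.graphInput hq).encode.getD i 0) ∧ s.reg 0 = threshold h k g q d := by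
    intro s hs hsb
    have g0 : s.reg 0 = N := by rw [hs.param 0 (by decide), h0]
    have g1 : s.reg 1 = q := by rw [hs.param 1 (by decide), h1]
    have g2 : s.reg 2 = d := by rw [hs.param 2 (by decide), h2]
    have g3 : s.reg 3 = base := by rw [hs.param 3 (by decide)]
    have g4 := hs.reg4
    have ea : (Expr.lit k * .reg 0 + .reg 2 * (.lit (Fintype.card (Block h k g)) *
        (Expr.reg 1).pow h)).eval s = gadgetSize h k g N q d := by
      simp only [eval_add, eval_mul, eval_lit, eval_reg, eval_pow, g0, g1, g2]
      rfl
    set s1 := s.setMem base (gadgetSize h k g N q d) with hs1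
    have eb : ((Expr.reg 4 - .reg 3 - .lit 2) / .lit 2).eval s1 = len := by
      simp only [eval_div, eval_sub, eval_lit, eval_reg, hs1, AState.setMem_reg, g3, g4]
      omega
    set s2 := s1.setMem (base + 1) len with hs2
    refine Cmd.Tri.seq (Cmd.Tri.store (by rw [ea]; omega) ?_)
    rw [ea, eval_reg, g3]
    refine Cmd.Tri.seq (Cmd.Tri.store (by rw [eb]; omega) ?_)
    rw [eb, eval_add, eval_reg, eval_lit, show s1.reg 3 = base from g3]
    refine Cmd.Tri.seq (Cmd.Tri.assign (by rw [eval_lit]; omega) ?_)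
    have hs3m : ∀ i, (s2.setReg 5 0).mem i =
        Function.update (Function.update s.mem base (gadgetSize h k g N q d)) (base + 1) len i :=
      fun _ => rfl
    have hflat := length_flatMap_pair (R.edgeList lim)
    have hs3 : ∀ i, (s2.setReg 5 0).mem i < V := by
      intro i
      rw [hs3m, Function.update_apply, Function.update_apply]
      split_ifs
      · omega
      · omega
      · exact hsb.2 i
    have hout : ∀ i, (s2.setReg 5 0).mem (base + i) = (R.graphInput hq).encode.getD i 0 := by
      intro i
      rw [hs3m, R.encode_graphInput, Function.update_apply, Function.update_apply]
      rcases i with _ | _ | i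
      · simp
      · simp [hlendef, hlim]
      · rw [if_neg (by omega), if_neg (by omega), hs.mem]
        simp only [outMem]
        rw [if_neg (by omega), show base + (i + 1 + 1) - (base + 2) = i by omega]
        rfl
    have hz : ∀ i, base + 2 + 2 * len ≤ i → (s2.setReg 5 0).mem i = 0 := by
      intro i hi
      rw [hs3m, Function.update_of_ne (by omega), Function.update_of_ne (by omega), hs.mem]
      simp only [outMem]
      rw [if_neg (by omega), List.getD_eq_default _ _ (by omega)]
    refine Cmd.Tri.seq ((tri_copyCmd (s := s2.setReg 5 0) (base := base) g3 g4 rfl hs3 (by omega)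
      hz).conseq le_rfl ?_)
    rintro s4 ⟨hm4, hr4⟩
    have et : (thresholdExpr h k g).eval s4 = threshold h k g q d := by
      rw [eval_thresholdExpr, hr4 1 (by decide), hr4 2 (by decide)]
      change threshold h k g (s.reg 1) (s.reg 2) = _
      rw [g1, g2]
    refine Cmd.Tri.assign (by rw [et]; omega) ⟨?_, ?_⟩
    · rw [AState.setReg_mem, hm4]
      funext i
      exact hout i
    · rw [AState.setReg_reg, et]
  have hB7 : (((σ.setReg 4 (base + 2)).setReg 5 0).setReg 7 lim).Bdd V := by
    have hset : ∀ (s : AState) (r : Fin 16) (v : ℕ), s.Bdd V → v < V → (s.setReg r v).Bdd V := by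
      intro s r v hs hv
      refine ⟨fun r' => ?_, hs.2⟩
      by_cases hr : r' = r
      · subst hr
        simpa using hv
      · rw [AState.setReg_reg_of_ne _ _ hr]
        exact hs.1 r'
    -- The invariant of the main loop does not bound the memory. The bound comes from this start
    -- state, because execution preserves `Bdd`.
    exact hset _ _ _ (hset _ _ _ (hset _ _ _ hσ (by omega)) (by omega)) (by omega)
  obtain ⟨s5, hex5, hs5⟩ := hloop
  have hlast := hfinal s5 hs5 (hex5.bdd hB7)
  unfold buildCmd
  refine (Cmd.Tri.seq (Cmd.Tri.assign (r := 4) (by simp only [eval_add, eval_reg, eval_lit]; omega)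
    (Cmd.Tri.seq (Cmd.Tri.assign (r := 5) (by rw [eval_lit]; omega)
      (Cmd.Tri.seq (Cmd.Tri.assign (r := 7) ?_
        (Cmd.Tri.seq (t := lim * (6 * S + 5 + 1) + 1) ⟨s5, ?_, hlast⟩))))))).conseq ?_ fun _ => id
  · exact lt_of_eq_of_lt e7 (by omega)
  · have : (Expr.reg 2 * .reg 0 * (Expr.reg 1).pow (h - 1)).eval
      ((σ.setReg 4 ((Expr.reg 3 + .lit 2).eval σ)).setReg 5 0) = lim := e7
    rw [eval_lit, this]
    exact hex5
  · rw [hK]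
    have hl1 : lim * (6 * S + 5 + 1) = 6 * (S * lim) + 6 * lim := by ring
    have hr1 : 40 * (S + k + B + p + 1) * (base + lim + 1) = 40 * (S * lim) + 40 * base + 40 * lim +
      40 + 40 * ((S + k + B + p) * (base + 1) + (k + B + p) * lim) := by ring
    rw [hr1, hl1]
    omega

end GadgetCode

end FineGrained


/-! ### From gadget data to solvability, and the hyperclique reduction -/

namespace FineGrained

open Finset
open FineGrained.Expr
open FineGrained.GadgetCode (buildConst)

theorem length_edges_graphInput {h k g N q d : ℕ} [NeZero g] (R : RawData h k g N q d)
    (hq : 1 ≤ q) : (R.graphInput hq).m ≤ (specs h k g).length * (d * N * q ^ (h - 1)) := by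
  rw [← GraphInput.length_edges]
  simp only [RawData.graphInput, List.length_map, List.length_attach]
  exact R.length_edgeList_le _

open Classical in
/-- A problem reduces to Partial Dominating Set if its instances can be transformed into gadget
data. -/
theorem SolvableInTime.of_gadget {P : Problem} {h k g : ℕ} [NeZero g] {T : GraphInput → ℝ}
    (hp : SolvableInTime (partialDominatingSet k) T) (hh : 2 ≤ h) (hk : 1 ≤ k)
    (c : GadgetCode h k g) (prep : Cmd) (a : ℕ) (ha : 1 ≤ a) (K : ℝ)
    (T' : P.Instance → ℝ) (hT' : ∀ x, 0 ≤ T' x)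
    (H : ∀ x, ∃ (N q d : ℕ) (R : RawData h k g N q d) (σ : AState) (t : ℕ),
      1 ≤ N ∧ 1 ≤ q ∧ 1 ≤ d ∧
      Cmd.Exec ((inputSize (P.encode x) + 2) ^ a) prep (AState.init (P.encode x)) t σ ∧
      c.Computes R σ ∧
      σ.reg 3 + buildConst h k g * (d * N * q ^ h) < (inputSize (P.encode x) + 2) ^ a ∧
      (∀ y < d, ∀ s v, #{a : Fin N | R.val y s a = v} ≤ q ^ (h - 1)) ∧
      P.answer x = (if ∃ c : Fin k → Fin N, ∀ y : Fin d, ∀ P, R.active P →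
        R.toGadget.rel fun t => R.toGadget.val y (P t) (c (P t).1) then 1 else 0) ∧
      ((t + σ.reg 3 + d * N * q ^ (h - 1) : ℕ) : ℝ) ≤ K * (T' x + 1) ∧
      ∀ G : GraphInput, G.n ≤ buildConst h k g * (d * (N + q ^ h)) →
        G.m ≤ buildConst h k g * (d * N * q ^ (h - 1)) → T G ≤ K * (T' x + 1)) :
    SolvableInTime P T' := by
  refine hp.of_reduction (.seq prep c.buildCmd) a
    (K + buildConst h k g * (K + 1)) T' hT' ha fun x => ?_
  obtain ⟨N, q, d, R, σ, t, hN, hq, hd, hex, hc, hV, hval, hans, ht, hT⟩ := H x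
  have hb0 : (AState.init (P.encode x)).Bdd ((inputSize (P.encode x) + 2) ^ a) := by
    have h1 : inputSize (P.encode x) + 2 ≤ (inputSize (P.encode x) + 2) ^ a :=
      Nat.le_self_pow (by omega) _
    refine ⟨fun _ => ?_, fun i => ?_⟩
    · simp only [AState.init]
      omega
    · have := getD_le_inputSize (P.encode x) i
      simp only [AState.init]
      omega
  obtain ⟨s, hs, hmem, hthr⟩ := GadgetCode.tri_buildCmd hc hq hN hd hV (hex.bdd hb0)
  have hTx := hT' x
  have hK : 0 ≤ K * (T' x + 1) := le_trans (Nat.cast_nonneg _) ht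
  have hK0 : 0 ≤ K := nonneg_of_mul_nonneg_left hK (by linarith)
  have hB : 0 ≤ (buildConst h k g : ℝ) := Nat.cast_nonneg _
  refine ⟨_, s, R.graphInput hq, .seq hex hs, hmem, ?_, ?_, ?_⟩
  · have hiff := R.threshold_le_answer_iff hh hq hd hval hk
    rw [hans, hthr]
    by_cases hthr' : threshold h k g q d ≤ (partialDominatingSet k).answer (R.graphInput hq)
    · rw [if_pos hthr', if_pos (hiff.1 hthr')]
    · rw [if_neg hthr', if_neg fun hyes => hthr' (hiff.2 hyes)]
  · push_cast at ht ⊢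
    have h1 : (buildConst h k g : ℝ) * (σ.reg 3 + d * N * q ^ (h - 1) + 1) ≤
        buildConst h k g * ((K + 1) * (T' x + 1)) := by
      gcongr
      have : (0 : ℝ) ≤ t := Nat.cast_nonneg _
      linarith
    have h2 : (t : ℝ) ≤ K * (T' x + 1) := by
      have h3 : (0 : ℝ) ≤ σ.reg 3 := Nat.cast_nonneg _
      have h4 : (0 : ℝ) ≤ d * N * q ^ (h - 1) := by positivity
      linarith
    calc _ ≤ K * (T' x + 1) + buildConst h k g * ((K + 1) * (T' x + 1)) := add_le_add h2 h1
      _ = _ := by ring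
  · refine (hT _ ?_ ?_).trans ?_
    · change gadgetSize h k g N q d ≤ _
      have h1 : k + Fintype.card (Block h k g) ≤ buildConst h k g := by
        unfold buildConst
        omega
      unfold gadgetSize
      calc k * N + d * (Fintype.card (Block h k g) * q ^ h)
          ≤ buildConst h k g * (d * N) + d * (buildConst h k g * q ^ h) := by
            gcongr
            · omega
            · exact Nat.le_mul_of_pos_left _ hd
            · omega
        _ = _ := by ring
    · refine (length_edges_graphInput R hq).trans (Nat.mul_le_mul_right _ ?_)
      unfold buildConst
      omega
    · have : 0 ≤ (buildConst h k g : ℝ) * (K + 1) * (T' x + 1) := by positivity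
      linarith

theorem getD_flatMap_uniform {α : Type*} (f : α → List ℕ) (m : ℕ) (l : List α)
    (hl : ∀ a ∈ l, (f a).length = m) (j : ℕ) (hj : j < l.length) (r : ℕ) (hr : r < m) :
    (l.flatMap f).getD (j * m + r) 0 = (f l[j]).getD r 0 := by
  induction l generalizing j with
  | nil => simp at hj
  | cons a l ih =>
    have ha := hl a (by simp)
    rw [List.flatMap_cons]
    rcases j with _ | j
    · rw [zero_mul, zero_add, List.getD_append _ _ _ _ (by omega)]
      rfl
    · rw [List.getD_append_right _ _ _ _ (by rw [ha, Nat.add_mul]; omega), ha,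
        show (j + 1) * m + r - m = j * m + r by rw [Nat.add_mul]; omega,
        ih (fun b hb => hl b (by simp [hb])) j (by simpa using hj)]
      rfl

theorem card_digit_le {q h : ℕ} (s : Fin h) (v : ℕ) :
    #{a : Fin (q ^ h) | (a : ℕ) / q ^ s.val % q = v} ≤ q ^ (h - 1) := by
  by_cases hv : v < q
  · rw [← card_tuples_eq s ⟨v, hv⟩]
    refine (card_bijective (finFunctionFinEquiv (m := q) (n := h)).symm (Equiv.bijective _)
      fun a => ?_).le
    simp only [mem_filter, mem_univ, true_and, Fin.ext_iff]
    rw [finFunctionFinEquiv_symm_val]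
  · rw [card_eq_zero.2]
    · exact Nat.zero_le _
    · rw [filter_eq_empty_iff]
      intro a _ ha
      have : 0 < q := by
        rcases Nat.eq_zero_or_pos q with rfl | hq
        · have h0 : (0 : ℕ) ^ h = 0 := zero_pow (by have := s.2; omega)
          have := a.2.trans_eq h0
          omega
        · exact hq
      have := Nat.mod_lt (a / q ^ s.val) this
      omega

/-! ### Hypercliques -/

/-- The vertices of a hyperclique are listed in increasing order. As `2 ≤ h ≤ K`, any two positions
lie in a common set of `h` positions, and sorted hyperedges there force `F` to be strictly
increasing. The additional value `n` lies in no hyperedge; it only makes the range of values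
nonempty when there are no vertices. -/
theorem exists_hyperclique_iff {n h K : ℕ} (hh : 2 ≤ h) (hK : h ≤ K) (edges : List (Finset (Fin n)))
    (unif : ∀ e ∈ edges, #e = h) :
    (∃ F : Fin K → Fin (n + 1), ∀ P : Fin h → Fin K, StrictMono P → ∃ e, ∃ he : e ∈ edges,
      (fun t => F (P t)) = fun t => (e.orderEmbOfFin (unif e he) t).castSucc) ↔
    ∃ S : Finset (Fin n), #S = K ∧ ∀ e ⊆ S, #e = h → e ∈ edges := by
  constructor
  · rintro ⟨F, hF⟩
    have hpair : ∀ i j : Fin K, ∃ u : Finset (Fin K), i ∈ u ∧ j ∈ u ∧ #u = h := by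
      intro i j
      obtain ⟨u, hu, -, hcard⟩ := exists_subsuperset_card_eq (s := {i, j}) (t := univ)
        (subset_univ _) (card_le_two.trans hh) (by simpa using hK)
      exact ⟨u, hu (by simp), hu (by simp), hcard⟩
    have hcs : ∀ i, ∃ v : Fin n, F i = v.castSucc := by
      intro i
      obtain ⟨u, hi, -, hu⟩ := hpair i i
      obtain ⟨e, he, heq⟩ := hF (u.orderEmbOfFin hu) (OrderEmbedding.strictMono _)
      have : i ∈ Set.range (u.orderEmbOfFin hu) := by
        rw [range_orderEmbOfFin]
        exact hi
      obtain ⟨a, rfl⟩ := this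
      exact ⟨_, congrFun heq a⟩
    choose F' hF' using hcs
    have hmono : StrictMono F' := by
      intro i j hij
      obtain ⟨u, hi, hj, hu⟩ := hpair i j
      obtain ⟨e, he, heq⟩ := hF (u.orderEmbOfFin hu) (OrderEmbedding.strictMono _)
      have h1 : i ∈ Set.range (u.orderEmbOfFin hu) := by
        rw [range_orderEmbOfFin]
        exact hi
      have h2 : j ∈ Set.range (u.orderEmbOfFin hu) := by
        rw [range_orderEmbOfFin]
        exact hj
      obtain ⟨a, rfl⟩ := h1
      obtain ⟨b, rfl⟩ := h2
      have hab := (OrderEmbedding.lt_iff_lt _).1 hij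
      have ha := congrFun heq a
      have hb := congrFun heq b
      simp only [hF'] at ha hb
      rw [Fin.castSucc_injective _ ha, Fin.castSucc_injective _ hb]
      exact (OrderEmbedding.lt_iff_lt _).2 hab
    refine ⟨univ.image F', ?_, fun e he hcard => ?_⟩
    · rw [card_image_of_injective _ hmono.injective]
      simp
    · set u : Finset (Fin K) := {i | F' i ∈ e} with hu
      have himg : u.image F' = e := by
        ext v
        simp only [mem_image, hu, mem_filter, mem_univ, true_and]
        constructor
        · rintro ⟨i, hi, rfl⟩
          exact hi
        · intro hv
          obtain ⟨i, -, rfl⟩ := mem_image.1 (he hv)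
          exact ⟨i, hv, rfl⟩
      have hucard : #u = h := by
        rw [← hcard, ← himg, card_image_of_injective _ hmono.injective]
      obtain ⟨e', he', heq⟩ := hF (u.orderEmbOfFin hucard) (OrderEmbedding.strictMono _)
      have h1 : ∀ t, F' (u.orderEmbOfFin hucard t) = e'.orderEmbOfFin (unif e' he') t := by
        intro t
        have := congrFun heq t
        simp only [hF'] at this
        exact Fin.castSucc_injective _ this
      have h2 : e = e' := by
        rw [← himg, ← image_orderEmbOfFin_univ u hucard, image_image,
          ← image_orderEmbOfFin_univ e' (unif e' he')]
        congr 1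
        funext t
        exact h1 t
      rw [h2]
      exact he'
  · rintro ⟨S, hS, hcl⟩
    refine ⟨fun i => (S.orderEmbOfFin hS i).castSucc, fun P hP => ?_⟩
    have hmono : StrictMono fun t => S.orderEmbOfFin hS (P t) :=
      (OrderEmbedding.strictMono _).comp hP
    have hcard : #(univ.image fun t => S.orderEmbOfFin hS (P t)) = h := by
      rw [card_image_of_injective _ hmono.injective]
      simp
    have hmem : (univ.image fun t => S.orderEmbOfFin hS (P t)) ∈ edges := by
      refine hcl _ ?_ hcard
      intro v hv
      obtain ⟨t, -, rfl⟩ := mem_image.1 hv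
      exact orderEmbOfFin_mem _ _ _
    refine ⟨_, hmem, ?_⟩
    funext t
    rw [← congrFun (orderEmbOfFin_unique (unif _ hmem)
      (fun t => mem_image_of_mem (fun t => S.orderEmbOfFin hS (P t)) (mem_univ t)) hmono) t]

namespace HypergraphInput

variable {h : ℕ} (x : HypergraphInput h)

/-- The vertices of the `j`-th hyperedge in increasing order. -/
def tuple (j : Fin x.edges.length) (t : Fin h) : Fin (x.n + 1) :=
  (x.edges[j].orderEmbOfFin (x.uniform _ (List.getElem_mem j.2)) t).castSucc

theorem length_encode : x.encode.length = 2 + h * x.edges.length := by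
  have h1 : (x.edges.map fun e => ((e.sort (· ≤ ·)).map Fin.val).length) =
      x.edges.map fun _ => h := by
    refine List.map_congr_left fun e he => ?_
    simp [x.uniform e he]
  simp only [encode, List.length_cons, List.length_flatMap, h1]
  simp
  ring

theorem getD_encode (j : Fin x.edges.length) (t : Fin h) :
    x.encode.getD (2 + h * j + t) 0 = x.tuple j t := by
  have h1 : x.encode.getD (2 + h * j + t) 0 =
      (x.edges.flatMap fun e => (e.sort (· ≤ ·)).map Fin.val).getD (j * h + t) 0 := by
    rw [show 2 + h * (j : ℕ) + t = (j * h + t) + 1 + 1 by ring]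
    rfl
  rw [h1, getD_flatMap_uniform _ h _ (fun e he => by simp [x.uniform e he]) j j.2 t t.2]
  have h2 : #(x.edges[(j : ℕ)]) = h := x.uniform _ (List.getElem_mem j.2)
  rw [List.getD_eq_getElem _ _ (by simp [h2])]
  simp [tuple, orderEmbOfFin_apply]

/-- Hyperedges are not repeated. Thus reading the input costs no more than a power of the number of
vertices, the parameter in which the hypothesis measures time. -/
theorem length_edges_le : x.edges.length ≤ x.n ^ h := by
  rw [← List.toFinset_card_of_nodup x.nodup]
  calc #x.edges.toFinset ≤ #(powersetCard h (univ : Finset (Fin x.n))) := by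
        refine card_le_card fun e he => ?_
        rw [mem_powersetCard]
        exact ⟨subset_univ _, x.uniform e (List.mem_toFinset.1 he)⟩
    _ = x.n.choose h := by simp
    _ ≤ x.n ^ h := Nat.choose_le_pow _ _

/-- The code of the `j`-th hyperedge. -/
def tupleCode (j : Fin x.edges.length) : ℕ :=
  (finFunctionFinEquiv (x.tuple j) : Fin ((x.n + 1) ^ h))

/-- The gadget data of a hypergraph. -/
def rawData (k : ℕ) : RawData h k h ((x.n + 1) ^ h) (x.n + 1) 1 where
  -- A candidate is an `h`-tuple of vertices, written in base `n + 1`; the `k` groups together hold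
  -- the `k * h` vertices of the hyperclique.
  val _ s a := a / (x.n + 1) ^ s.2.val % (x.n + 1)
  val_lt _ _ _ _ _ := Nat.mod_lt _ (Nat.succ_pos _)
  -- Only increasing placements are tested, in the linear order of all `k * h` slots, since
  -- hyperedges are stored sorted.
  active P := StrictMono fun t => finProdFinEquiv (P t)
  rel X := ∃ j, x.tupleCode j = X

theorem answer_eq (hh : 2 ≤ h) {k : ℕ} (hk : 1 ≤ k) [NeZero h] :
    (∃ c : Fin k → Fin ((x.n + 1) ^ h), ∀ y : Fin 1, ∀ P, (x.rawData k).active P →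
      (x.rawData k).toGadget.rel fun t => (x.rawData k).toGadget.val y (P t) (c (P t).1)) ↔
    ∃ S : Finset (Fin x.n), #S = k * h ∧ ∀ e ⊆ S, #e = h → e ∈ x.edges := by
  rw [← exists_hyperclique_iff hh (Nat.le_mul_of_pos_left h hk) x.edges x.uniform]
  have hrel : ∀ f : Fin h → Fin (x.n + 1), (x.rawData k).toGadget.rel f ↔
      ∃ e, ∃ he : e ∈ x.edges, f = fun t => (e.orderEmbOfFin (x.uniform e he) t).castSucc := by
    intro f
    constructor
    · rintro ⟨j, hj⟩
      refine ⟨x.edges[j], List.getElem_mem j.2, ?_⟩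
      exact (finFunctionFinEquiv.injective (Fin.ext hj)).symm
    · rintro ⟨e, he, rfl⟩
      obtain ⟨j, hj, rfl⟩ := List.mem_iff_getElem.1 he
      exact ⟨⟨j, hj⟩, rfl⟩
  have hval : ∀ (y : Fin 1) (s : Fin k × Fin h) (a : Fin ((x.n + 1) ^ h)),
      (x.rawData k).toGadget.val y s a = finFunctionFinEquiv.symm a s.2 := by
    intro y s a
    refine Fin.ext ?_
    rw [finFunctionFinEquiv_symm_val]
    rfl
  simp only [hrel, hval]
  constructor
  · rintro ⟨c, hc⟩
    refine ⟨fun i => finFunctionFinEquiv.symm (c (finProdFinEquiv.symm i).1)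
      (finProdFinEquiv.symm i).2, fun P hP => ?_⟩
    refine hc 0 (fun t => finProdFinEquiv.symm (P t)) ?_
    change StrictMono fun t => finProdFinEquiv (finProdFinEquiv.symm (P t))
    simp only [Equiv.apply_symm_apply]
    exact hP
  · rintro ⟨F, hF⟩
    refine ⟨fun i => finFunctionFinEquiv fun s => F (finProdFinEquiv (i, s)), fun y P hP => ?_⟩
    obtain ⟨e, he, heq⟩ := hF (fun t => finProdFinEquiv (P t)) hP
    refine ⟨e, he, ?_⟩
    rw [← heq]
    funext t
    simp

end HypergraphInput

/-- Expressions for the gadget data of a hypergraph. -/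
def hypergraphCode (h k : ℕ) : GadgetCode h k h where
  val s := digit (.reg 1) s.2 (.reg 8)
  rel := .load (.reg 11 + .reg 6)
  active P := StrictMono fun t => finProdFinEquiv (P t)

/-- The program that tabulates the hyperedges. -/
def hypergraphPrep (h : ℕ) : Cmd :=
  .seq (.assign 1 (.load (.lit 0) + .lit 1)) (.seq (.assign 0 ((Expr.reg 1).pow h))
    (.seq (.assign 2 (.lit 1)) (.seq (.assign 11 (.lit 2 + .lit h * .load (.lit 1)))
      (.seq (.assign 3 (.reg 11 + .reg 0)) (.seq (.assign 5 (.lit 0))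
        (.while (.bin .lt (.reg 5) (.load (.lit 1)))
          (.seq (.store (.reg 11 + listSum ((List.finRange h).map fun t : Fin h =>
              Expr.load (.lit 2 + .lit h * .reg 5 + .lit t.val) * (Expr.reg 1).pow t.val)) (.lit 1))
            (.assign 5 (.reg 5 + .lit 1)))))))))

open Classical in
theorem tri_hypergraphPrep {h k V : ℕ} (hh : 2 ≤ h) [NeZero h] (x : HypergraphInput h)
    (hV : 2 + h * x.edges.length + 2 * (x.n + 1) ^ h < V) :
    Cmd.Tri V (hypergraphPrep h) (AState.init x.encode) (x.edges.length * 3 + 7) fun σ =>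
      (hypergraphCode h k).Computes (x.rawData k) σ ∧
        σ.reg 3 = 2 + h * x.edges.length + (x.n + 1) ^ h := by
  set m := x.edges.length with hm
  set q := x.n + 1 with hq
  -- The input fills the cells below `tb`. The table of `q ^ h` truth values follows, initially zero
  -- like all unused memory, and the output begins behind the table.
  set tb := 2 + h * m with htb
  have hqh : q ≤ q ^ h := Nat.le_self_pow (by omega) _
  have hmh : m ≤ h * m := Nat.le_mul_of_pos_left _ (by omega)
  have hlen := x.length_encode
  have hqq : (x.n + 1) ^ h = q ^ h := rfl
  have hmm : h * x.edges.length = h * m := rfl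
  have hm1 : x.encode.getD 1 0 = m := rfl
  have hm0 : x.encode.getD 0 0 = x.n := rfl
  have hcode : ∀ j, x.tupleCode j < q ^ h := fun j => Fin.is_lt _
  let I : ℕ → AState → Prop := fun j s =>
    s.reg 0 = q ^ h ∧ s.reg 1 = q ∧ s.reg 2 = 1 ∧ s.reg 3 = tb + q ^ h ∧ s.reg 11 = tb ∧
      s.reg 5 = j ∧ s.mem = fun i => if i < tb then x.encode.getD i 0 else
        if ∃ j' : Fin m, j'.val < j ∧ i = tb + x.tupleCode j' then 1 else 0
  refine Cmd.Tri.conseq (t := 1 + (1 + (1 + (1 + (1 + (1 + (m * (2 + 1) + 1)))))))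
    (Q := I m) ?_ (by omega) ?_
  · unfold hypergraphPrep
    refine Cmd.Tri.seq (Cmd.Tri.assign ?_ (Cmd.Tri.seq (Cmd.Tri.assign ?_
      (Cmd.Tri.seq (Cmd.Tri.assign ?_ (Cmd.Tri.seq (Cmd.Tri.assign ?_
        (Cmd.Tri.seq (Cmd.Tri.assign ?_ (Cmd.Tri.seq (Cmd.Tri.assign ?_
          (Cmd.Tri.loop I m ?_ ?_ ?_))))))))))))
    · change x.encode.getD 0 0 + 1 < V
      rw [hm0]
      omega
    · rw [eval_pow]
      change (x.encode.getD 0 0 + 1) ^ h < V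
      rw [hm0]
      omega
    · rw [eval_lit]
      omega
    · change 2 + h * x.encode.getD 1 0 < V
      rw [hm1]
      omega
    · rw [eval_add, eval_reg, eval_reg]
      change (2 + h * x.encode.getD 1 0) + ((Expr.reg 1).pow h).eval _ < V
      rw [eval_pow]
      change (2 + h * x.encode.getD 1 0) + (x.encode.getD 0 0 + 1) ^ h < V
      rw [hm1, hm0]
      omega
    · rw [eval_lit]
      omega
    · rintro j hj s ⟨h0, h1, h2, h3, h11, h5, hmem⟩
      have hs1 : s.mem 1 = m := by
        rw [hmem]
        simp only
        rw [if_pos (by omega), hm1]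
      have haddr : (Expr.reg 11 + listSum ((List.finRange h).map fun t : Fin h =>
          Expr.load (.lit 2 + .lit h * .reg 5 + .lit t.val) * (Expr.reg 1).pow t.val)).eval s =
          tb + x.tupleCode ⟨j, hj⟩ := by
        rw [eval_add, eval_reg, h11, eval_listSum, List.map_map]
        congr 1
        unfold HypergraphInput.tupleCode
        rw [finFunctionFinEquiv_apply, ← Fin.sum_univ_def]
        refine sum_congr rfl fun t _ => ?_
        simp only [Function.comp_apply, eval_mul, eval_load, eval_add, eval_lit, eval_reg, eval_pow,
          h5, h1]
        have hlt : 2 + h * j + t < tb := by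
          have h6 : h * (j + 1) ≤ h * m := Nat.mul_le_mul_left _ hj
          have := t.2
          rw [Nat.mul_succ] at h6
          omega
        rw [hmem]
        simp only [if_pos hlt]
        rw [← x.getD_encode ⟨j, hj⟩ t]
      refine ⟨by simp [h5, hs1, hj], Cmd.Tri.seq (Cmd.Tri.store (by rw [eval_lit]; omega)
        (Cmd.Tri.assign ?_ ⟨?_, ?_, ?_, ?_, ?_, ?_, ?_⟩))⟩
      · simp only [eval_add, eval_reg, eval_lit, AState.setMem_reg, h5]
        omega
      · exact h0
      · exact h1
      · exact h2
      · exact h3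
      · exact h11
      · simp only [eval_add, eval_reg, eval_lit, AState.setMem_reg, h5, AState.setReg_reg]
      · rw [AState.setReg_mem, AState.setMem_mem, haddr, eval_lit, hmem]
        funext i
        rw [Function.update_apply]
        by_cases hi : i < tb
        · rw [if_neg (by omega), if_pos hi, if_pos hi]
        · rw [if_neg hi, if_neg hi]
          by_cases hi2 : i = tb + x.tupleCode ⟨j, hj⟩
          · rw [if_pos hi2, if_pos ⟨⟨j, hj⟩, by simp, hi2⟩]
          · rw [if_neg hi2]
            congr 1
            refine propext (exists_congr fun j' => ?_)
            constructor
            · rintro ⟨hj', hi'⟩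
              exact ⟨by omega, hi'⟩
            · rintro ⟨hj', hi'⟩
              refine ⟨?_, hi'⟩
              rcases Nat.lt_succ_iff_lt_or_eq.1 hj' with h | h
              · exact h
              · exact absurd (by rw [hi']; congr 2; exact Fin.ext h) hi2
    · rintro s ⟨h0, h1, h2, h3, h11, h5, hmem⟩
      have hs1 : s.mem 1 = m := by
        rw [hmem]
        simp only
        rw [if_pos (by omega), hm1]
      simp [h5, hs1]
    · have e0 : ∀ s : AState, s.reg 1 = q → ((Expr.reg 1).pow h).eval s = q ^ h := by
        intro s hs
        rw [eval_pow, eval_reg, hs]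
      refine ⟨?_, ?_, rfl, ?_, ?_, rfl, ?_⟩
      · exact e0 _ rfl
      · rfl
      · change (2 + h * x.encode.getD 1 0) + ((Expr.reg 1).pow h).eval _ = _
        rw [e0 _ rfl]
        rfl
      · rfl
      · simp only [AState.setReg_mem]
        funext i
        simp only [AState.init]
        split_ifs with hi hi2
        · rfl
        · obtain ⟨j', hj', -⟩ := hi2
          omega
        · rw [List.getD_eq_default _ _ (by omega)]
  · rintro σ ⟨h0, h1, h2, h3, h11, h5, hmem⟩
    refine ⟨⟨h0, h1, h2, ?_, fun P => Iff.rfl, ?_, ?_⟩, h3⟩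
    · intro i hi
      rw [h3] at hi
      rw [hmem]
      simp only
      rw [if_neg (by omega), if_neg]
      rintro ⟨j', -, hj'⟩
      have := hcode j'
      omega
    · intro s hr hs ha hy p
      change (digit (.reg 1) p.2.val (.reg 8)).eval s = _
      rw [eval_digit, eval_reg, eval_reg, hr 1 (by decide), h1]
      rfl
    · intro s hr hs hx
      change s.mem (s.reg 11 + s.reg 6) ≠ 0 ↔ _
      rw [hr 11 (by decide), h11, hs _ (by omega), hmem]
      simp only
      rw [if_neg (by omega)]
      constructor
      · intro hne
        by_cases hex : ∃ j' : Fin m, j'.val < m ∧ tb + s.reg 6 = tb + x.tupleCode j'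
        · obtain ⟨j', -, hj'⟩ := hex
          exact ⟨j', by omega⟩
        · rw [if_neg hex] at hne
          exact absurd rfl hne
      · rintro ⟨j', hj'⟩
        rw [if_pos ⟨j', j'.2, by omega⟩]
        exact one_ne_zero

/-- Here `q = n + 1`, `N = q ^ h` and `d = 1`, so there are `O(q ^ h)` vertices and `O(N * q ^ (h -
1)) = O(q ^ (2 * h - 1))` edges. The constant `K₀` depends only on `h` and `k`, which allows the
bound on `T` to be chosen after it. -/
theorem hyperclique_of_pds {h k : ℕ} (hh : 2 ≤ h) (hk : 1 ≤ k) {T : GraphInput → ℝ}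
    (hp : SolvableInTime (partialDominatingSet k) T) : ∃ K₀ : ℕ, ∀ (T' : HypergraphInput h → ℝ)
    (_ : ∀ x, 0 ≤ T' x) (K : ℝ) (_ : ∀ x : HypergraphInput h,
      ((x.n : ℝ) + 1) ^ (2 * h - 1) ≤ K * (T' x + 1) ∧
      ∀ G : GraphInput, G.n ≤ K₀ * (x.n + 1) ^ h → G.m ≤ K₀ * (x.n + 1) ^ (2 * h - 1) →
        T G ≤ K * (T' x + 1)),
    SolvableInTime (hypercliqueDetection h (k * h)) T' := by
  classical
  have : NeZero h := ⟨by omega⟩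
  refine ⟨2 * buildConst h k h, fun T' hT' K H => ?_⟩
  refine SolvableInTime.of_gadget (P := hypercliqueDetection h (k * h)) hp hh hk (hypergraphCode h k) (hypergraphPrep h) (2 * h + buildConst h k h + 4)
    (by omega) ((h + 16) * K) T' hT' fun x => ?_
  have hQ : (x.n + 1) ^ h * (x.n + 1) ^ (h - 1) = (x.n + 1) ^ (2 * h - 1) := by
    rw [← pow_add]
    congr 1
    omega
  have hn1 : 1 ≤ x.n + 1 := by omega
  have hpow : (x.n + 1) ^ h ≤ (x.n + 1) ^ (2 * h - 1) := Nat.pow_le_pow_right hn1 (by omega)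
  have hone : 1 ≤ (x.n + 1) ^ (2 * h - 1) := Nat.one_le_pow _ _ hn1
  have hedges : x.edges.length ≤ (x.n + 1) ^ (2 * h - 1) :=
    x.length_edges_le.trans ((Nat.pow_le_pow_left (by omega) _).trans hpow)
  set X := inputSize x.encode + 2 with hX
  have hXlen : 2 + h * x.edges.length ≤ X := by
    rw [← x.length_encode, hX]
    unfold inputSize
    omega
  have hXn : x.n + 1 ≤ X := by
    have : x.encode.getD 0 0 ≤ inputSize x.encode := getD_le_inputSize _ _
    have h2 : x.encode.getD 0 0 = x.n := rfl
    omega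
  have hV : 2 + h * x.edges.length + (x.n + 1) ^ h + (x.n + 1) ^ h +
      buildConst h k h * (1 * (x.n + 1) ^ h * (x.n + 1) ^ h) < X ^ (2 * h + buildConst h k h + 4) := by
    have hX2 : X ≤ X ^ (2 * h) := Nat.le_self_pow (by omega) _
    have hXh : X ^ h ≤ X ^ (2 * h) := Nat.pow_le_pow_right (by omega) (by omega)
    have h1 : (x.n + 1) ^ h ≤ X ^ h := Nat.pow_le_pow_left hXn _
    have h2 : (x.n + 1) ^ h * (x.n + 1) ^ h ≤ X ^ (2 * h) := by
      rw [two_mul, pow_add]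
      exact Nat.mul_le_mul h1 h1
    have h3 : buildConst h k h * (1 * (x.n + 1) ^ h * (x.n + 1) ^ h) ≤
        buildConst h k h * X ^ (2 * h) := by
      rw [one_mul]
      exact Nat.mul_le_mul_left _ h2
    -- Constant factors are absorbed by the exponent: `X ≥ 2`, so `X ^ c` exceeds `c`.
    have h4 : (buildConst h k h + 4) * X ^ (2 * h) < X ^ (2 * h + buildConst h k h + 4) := by
      rw [show 2 * h + buildConst h k h + 4 = (buildConst h k h + 4) + 2 * h by ring, pow_add]
      refine Nat.mul_lt_mul_of_pos_right ?_ (pow_pos (by omega) _)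
      exact Nat.lt_pow_self (by omega)
    have hpos : 0 < X ^ (2 * h) := pow_pos (by omega) _
    rw [add_mul] at h4
    omega
  obtain ⟨σ, hex, hc, hσ3⟩ := tri_hypergraphPrep (k := k)
    (V := X ^ (2 * h + buildConst h k h + 4)) hh x (by
      have := Nat.zero_le (buildConst h k h * (1 * (x.n + 1) ^ h * (x.n + 1) ^ h))
      omega)
  refine ⟨_, _, 1, x.rawData k, σ, _, Nat.one_le_pow _ _ hn1, hn1, le_rfl, hex, hc, ?_, ?_, ?_, ?_, ?_⟩
  · rw [hσ3]
    change _ < X ^ _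
    omega
  · intro y _ s v
    exact card_digit_le s.2 v
  · simp only [hypercliqueDetection, x.answer_eq hh hk]
  · rw [hσ3, one_mul, hQ]
    have h1 : x.edges.length * 3 + 7 + (2 + h * x.edges.length + (x.n + 1) ^ h) +
        (x.n + 1) ^ (2 * h - 1) ≤ (h + 16) * (x.n + 1) ^ (2 * h - 1) := by
      have := Nat.mul_le_mul_left h hedges
      rw [add_mul]
      omega
    calc ((x.edges.length * 3 + 7 + (2 + h * x.edges.length + (x.n + 1) ^ h) +
        (x.n + 1) ^ (2 * h - 1) : ℕ) : ℝ) ≤ ((h + 16) * (x.n + 1) ^ (2 * h - 1) : ℕ) := by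
          exact_mod_cast h1
      _ = (h + 16) * ((x.n : ℝ) + 1) ^ (2 * h - 1) := by push_cast; ring
      _ ≤ (h + 16) * (K * (T' x + 1)) := by
          gcongr
          exact (H x).1
      _ = _ := by ring
  · intro G hn hm
    have h0 : (0 : ℝ) ≤ (x.n : ℝ) + 1 := add_nonneg (Nat.cast_nonneg _) zero_le_one
    have h1 : 0 ≤ K * (T' x + 1) := le_trans (pow_nonneg h0 (2 * h - 1)) (H x).1
    have hn' : G.n ≤ 2 * buildConst h k h * (x.n + 1) ^ h := by
      rw [one_mul, ← two_mul, ← mul_assoc, mul_comm (buildConst h k h) 2] at hn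
      exact hn
    have hm' : G.m ≤ 2 * buildConst h k h * (x.n + 1) ^ (2 * h - 1) := by
      rw [one_mul, hQ] at hm
      refine le_trans hm (Nat.mul_le_mul_right _ (Nat.le_mul_of_pos_left _ (by norm_num)))
    refine le_trans ((H x).2 G hn' hm') ?_
    have h2 : 0 ≤ ((h : ℝ) + 15) * (K * (T' x + 1)) := mul_nonneg (add_nonneg (Nat.cast_nonneg _) (by norm_num)) h1
    linarith

end FineGrained


namespace FineGrained

open Finset
open FineGrained.Expr
open FineGrained.GadgetCode (buildConst)

/-! ### Orthogonal vectors -/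

theorem card_mod_le {q h : ℕ} (hh : 1 ≤ h) (v : ℕ) :
    #{a : Fin (q ^ h) | (a : ℕ) % q = v} ≤ q ^ (h - 1) := by
  simpa using card_digit_le (q := q) (⟨0, hh⟩ : Fin h) v

/-- The least admissible `q` satisfies `(q - 1) ^ k < n` and `q ≤ 2 * (q - 1)`, unless it is `1`.
Minimality is stated because the program finds `q` by counting upwards. -/
theorem exists_min_root {k : ℕ} (hk : 1 ≤ k) (n : ℕ) :
    ∃ q, 1 ≤ q ∧ n ≤ q ^ k ∧ q ^ k ≤ 2 ^ k * (n + 1) ∧ ∀ p, 1 ≤ p → p < q → p ^ k < n := by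
  classical
  have hex : ∃ q, 1 ≤ q ∧ n ≤ q ^ k :=
    ⟨n + 1, by omega, (Nat.le_succ n).trans (Nat.le_self_pow (by omega) _)⟩
  obtain ⟨h1, h2⟩ := Nat.find_spec hex
  have hmin : ∀ p, 1 ≤ p → p < Nat.find hex → p ^ k < n := by
    intro p hp hlt
    have := Nat.find_min hex hlt
    push Not at this
    exact this hp
  refine ⟨Nat.find hex, h1, h2, ?_, hmin⟩
  rcases Nat.eq_or_lt_of_le h1 with h | h
  · rw [← h, one_pow]
    exact Nat.mul_pos (by positivity) (by omega)
  · have h3 := hmin (Nat.find hex - 1) (by omega) (by omega)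
    calc Nat.find hex ^ k ≤ (2 * (Nat.find hex - 1)) ^ k := Nat.pow_le_pow_left (by omega) _
      _ = 2 ^ k * (Nat.find hex - 1) ^ k := mul_pow _ _ _
      _ ≤ _ := by gcongr; omega

namespace OVInput

variable {k : ℕ} (x : OVInput k)

theorem length_encode : x.encode.length = 2 + k * (x.n * x.d) := by
  simp [encode]
  ring

theorem getD_encode (i : Fin k) (j : Fin x.n) (y : Fin x.d) :
    x.encode.getD (2 + (i * x.n + j) * x.d + y) 0 = (x.vec i j y).toNat := by
  have h1 : x.encode.getD (2 + (i * x.n + j) * x.d + y) 0 =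
      ((List.finRange k).flatMap fun i => (List.finRange x.n).flatMap fun j =>
        (List.finRange x.d).map fun y => (x.vec i j y).toNat).getD
          (i * (x.n * x.d) + (j * x.d + y)) 0 := by
    rw [show 2 + ((i : ℕ) * x.n + j) * x.d + y = (i * (x.n * x.d) + (j * x.d + y)) + 1 + 1 by ring]
    rfl
  have h2 : (j : ℕ) * x.d + y < x.n * x.d := by
    have := Nat.mul_le_mul_right x.d j.2
    rw [Nat.succ_mul] at this
    have := y.2
    omega
  rw [h1, getD_flatMap_uniform _ (x.n * x.d) _ (fun _ _ => by simp) i (by simp) _ h2,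
    getD_flatMap_uniform _ x.d _ (fun _ _ => by simp) j (by simp) _ y.2,
    List.getD_eq_getElem _ _ (by simp)]
  simp

theorem getD_encode_le (i : ℕ) : x.encode.getD (2 + i) 0 ≤ 1 := by
  rw [add_comm]
  change ((List.finRange k).flatMap fun i => (List.finRange x.n).flatMap fun j =>
        (List.finRange x.d).map fun y => (x.vec i j y).toNat).getD i 0 ≤ 1
  rw [List.getD_eq_getElem?_getD]
  rcases h : ((List.finRange k).flatMap fun i => (List.finRange x.n).flatMap fun j =>
        (List.finRange x.d).map fun y => (x.vec i j y).toNat)[i]? with _ | v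
  · simp
  · have hmem := List.mem_of_getElem? h
    simp only [List.mem_flatMap, List.mem_map] at hmem
    obtain ⟨_, -, _, -, _, -, rfl⟩ := hmem
    exact Bool.toNat_le _

/-- The entry of a vector, read from the encoding. -/
def entry (i a y : ℕ) : ℕ := x.encode.getD (2 + (i * x.n + a % x.n) * x.d + y) 0

theorem entry_le (i a y : ℕ) : x.entry i a y ≤ 1 := by
  unfold entry
  rw [add_assoc]
  exact x.getD_encode_le _

/-- The gadget data of an instance of orthogonal vectors. -/
def rawData (q : ℕ) : RawData k k 1 (q ^ k) (2 * q) (x.d + if x.d = 0 then 1 else 0) where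
  -- The bit carries the constraint. The label `a % q` spreads the candidates over about `n ^ (1 /
  -- k)` values, so that no element has too many neighbors.
  val y s a := 2 * (a % q) + x.entry s.1 a y
  val_lt y _ s a ha := by
    have h1 := x.entry_le s.1 a y
    have hq : 0 < q := by
      rcases Nat.eq_zero_or_pos q with rfl | hq
      · have hk : k ≠ 0 := by
          have := s.1.2
          omega
        rw [zero_pow hk] at ha
        omega
      · exact hq
    have h2 := Nat.mod_lt a hq
    omega
  active P := ∀ t, (P t).1 = t
  -- The parity of a digit is the coordinate of the vector. The gadget has a candidate even if the
  -- families are empty; the first conjunct then makes every constraint fail.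
  rel X := x.n ≠ 0 ∧ ∃ t : Fin k, X / (2 * q) ^ t.val % (2 * q) % 2 = 0

/-- Candidates with index at least `n` repeat vectors, being read modulo `n`. For `d = 0` a single
layer is added because the gadget needs one; its entries are read behind the end of the input and
are zero, which agrees with the empty sum. -/
theorem answer_eq {q : ℕ} (hk : 0 < k) (hnq : x.n ≤ q ^ k) :
    (∃ c : Fin k → Fin (q ^ k), ∀ y : Fin (x.d + if x.d = 0 then 1 else 0), ∀ P,
      (x.rawData q).active P → (x.rawData q).toGadget.rel
        fun t => (x.rawData q).toGadget.val y (P t) (c (P t).1)) ↔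
    ∃ a : Fin k → Fin x.n, ∑ y, ∏ i, (x.vec i (a i) y).toNat = 0 := by
  have hsum : ∀ a : Fin k → Fin x.n, ∑ y, ∏ i, (x.vec i (a i) y).toNat = 0 ↔
      ∀ y, ∃ i, x.vec i (a i) y = false := by
    intro a
    simp only [sum_eq_zero_iff, mem_univ, true_implies, prod_eq_zero_iff, true_and]
    refine forall_congr' fun y => exists_congr fun i => ?_
    cases x.vec i (a i) y <;> simp
  have hrel : ∀ (y : Fin (x.d + if x.d = 0 then 1 else 0)) (c : Fin k → Fin (q ^ k))
      (P : SlotMap k k 1), (x.rawData q).active P → ((x.rawData q).toGadget.rel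
        (fun t => (x.rawData q).toGadget.val y (P t) (c (P t).1)) ↔
          x.n ≠ 0 ∧ ∃ t : Fin k, x.entry t (c t) y = 0) := by
    intro y c P hP
    refine and_congr Iff.rfl (exists_congr fun t => ?_)
    rw [← finFunctionFinEquiv_symm_val, Equiv.symm_apply_apply]
    change (2 * ((c (P t).1 : ℕ) % q) + x.entry (P t).1 (c (P t).1) y) % 2 = 0 ↔ _
    rw [hP t]
    have := x.entry_le t (c t) y
    omega
  have hent : ∀ (t : Fin k) (a : ℕ) (ha : a % x.n < x.n) (y : Fin x.d),
      x.entry t a y = 0 ↔ x.vec t ⟨a % x.n, ha⟩ y = false := by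
    intro t a ha y
    unfold entry
    rw [x.getD_encode t ⟨a % x.n, ha⟩ y]
    cases x.vec t ⟨a % x.n, ha⟩ y <;> simp
  simp only [hsum]
  constructor
  · rintro ⟨c, hc⟩
    have hP : (x.rawData q).active fun t => (t, 0) := fun _ => rfl
    have hc' := fun y => (hrel y c _ hP).1 (hc y _ hP)
    have h0 : 0 < x.d + if x.d = 0 then 1 else 0 := by split_ifs <;> omega
    have hn : 0 < x.n := Nat.pos_of_ne_zero (hc' ⟨0, h0⟩).1
    refine ⟨fun t => ⟨c t % x.n, Nat.mod_lt _ hn⟩, fun y => ?_⟩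
    have hy : (y : ℕ) < x.d + if x.d = 0 then 1 else 0 := y.2.trans_le (Nat.le_add_right _ _)
    obtain ⟨-, t, ht⟩ := hc' ⟨y, hy⟩
    exact ⟨t, (hent t (c t) (Nat.mod_lt _ hn) y).1 ht⟩
  · rintro ⟨a, ha⟩
    let c : Fin k → Fin (q ^ k) := fun t => (a t).castLE hnq
    refine ⟨c, fun y P hP => (hrel y c P hP).2 ?_⟩
    change x.n ≠ 0 ∧ ∃ t : Fin k, x.entry t (a t) y = 0
    refine ⟨fun hn => ?_, ?_⟩
    · have := (a ⟨0, hk⟩).2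
      omega
    · by_cases hd : x.d = 0
      · refine ⟨⟨0, hk⟩, ?_⟩
        unfold entry
        rw [List.getD_eq_default _ _ (by rw [length_encode]; simp [hd])]
      · have hy : y.val < x.d := by
          refine y.2.trans_eq ?_
          rw [if_neg hd, add_zero]
        obtain ⟨t, ht⟩ := ha ⟨y, hy⟩
        have hmod : (a t : ℕ) % x.n = a t := Nat.mod_eq_of_lt (a t).2
        refine ⟨t, (hent t _ (by rw [hmod]; exact (a t).2) ⟨y, hy⟩).2 ?_⟩
        rw [← ht]
        congr 1
        exact Fin.ext hmod

end OVInput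

/-- Expressions for the gadget data of an instance of orthogonal vectors. -/
def ovCode (k : ℕ) : GadgetCode k k 1 where
  val s := .lit 2 * (.reg 8 % .reg 11) + .load (.lit 2 + (.lit s.1.val * .reg 12 +
    .reg 8 % .reg 12) * .reg 13 + .reg 9)
  rel := .reg 12 * listSum ((List.finRange k).map fun t : Fin k =>
    neg (digit (.reg 1) t.val (.reg 6) % .lit 2))
  active P := ∀ t, (P t).1 = t

/-- The program that computes the parameters. -/
def ovPrep (k : ℕ) : Cmd :=
  .seq (.assign 12 (.load (.lit 0))) (.seq (.assign 13 (.load (.lit 1)))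
    (.seq (.assign 2 (.reg 13 + .bin .eq (.reg 13) (.lit 0)))
      -- The input has length `2 + k * n * d`. The surplus keeps the addresses of entries below the
      -- output also for `n = 0`, where the layer is still added to the address, and for `d = 0`.
      (.seq (.assign 3 (.lit k * (.reg 12 * .reg 13) + .reg 13 + .lit 3))
        (.seq (.assign 11 (.lit 1))
          (.seq (.while (.bin .lt ((Expr.reg 11).pow k) (.reg 12)) (.assign 11 (.reg 11 + .lit 1)))
            (.seq (.assign 0 ((Expr.reg 11).pow k)) (.assign 1 (.lit 2 * .reg 11))))))))

theorem listSum_ne_zero (s : AState) (l : List Expr) :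
    (listSum l).eval s ≠ 0 ↔ ∃ e ∈ l, e.eval s ≠ 0 := by
  rw [eval_listSum, ne_eq, List.sum_eq_zero_iff]
  simp

theorem tri_ovPrep {k q V : ℕ} (x : OVInput k) (hq : 1 ≤ q) (hnq : x.n ≤ q ^ k)
    (hmin : ∀ p, 1 ≤ p → p < q → p ^ k < x.n)
    (hV : k * (x.n * x.d) + x.d + 3 + x.n + q ^ k + 2 * q < V) :
    Cmd.Tri V (ovPrep k) (AState.init x.encode) (q * 2 + 8) fun σ =>
      (ovCode k).Computes (x.rawData q) σ ∧ σ.reg 3 = k * (x.n * x.d) + x.d + 3 := by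
  have hlen := x.length_encode
  have hm0 : x.encode.getD 0 0 = x.n := rfl
  have hm1 : x.encode.getD 1 0 = x.d := rfl
  let I : ℕ → AState → Prop := fun j s =>
    s.reg 2 = (x.d + if x.d = 0 then 1 else 0) ∧ s.reg 3 = k * (x.n * x.d) + x.d + 3 ∧
      s.reg 11 = j + 1 ∧ s.reg 12 = x.n ∧ s.reg 13 = x.d ∧ s.mem = fun i => x.encode.getD i 0
  let J : AState → Prop := fun s => I (q - 1) s ∧ s.reg 0 = q ^ k ∧ s.reg 1 = 2 * q
  refine Cmd.Tri.conseq (t := 1 + (1 + (1 + (1 + (1 + (((q - 1) * (1 + 1) + 1) + (1 + 1)))))))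
    (Q := J) ?_ (by omega) ?_
  · unfold ovPrep
    refine Cmd.Tri.seq (Cmd.Tri.assign ?_ (Cmd.Tri.seq (Cmd.Tri.assign ?_
      (Cmd.Tri.seq (Cmd.Tri.assign ?_ (Cmd.Tri.seq (Cmd.Tri.assign ?_
        (Cmd.Tri.seq (Cmd.Tri.assign ?_ (Cmd.Tri.seq
          ((Cmd.Tri.loop I (q - 1) ?_ ?_ ?_).conseq le_rfl ?_)))))))))))
    · change x.n < V
      omega
    · change x.d < V
      omega
    · change x.d + (if x.d = 0 then 1 else 0) < V
      split_ifs <;> omega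
    · change k * (x.n * x.d) + x.d + 3 < V
      omega
    · change 1 < V
      omega
    · rintro j hj s ⟨h2, h3, h11, h12, h13, hmem⟩
      refine ⟨?_, Cmd.Tri.assign ?_ ⟨h2, h3, ?_, h12, h13, hmem⟩⟩
      · rw [eval_lt', eval_pow, eval_reg, eval_reg, h11, h12, if_pos (hmin _ (by omega) (by omega))]
        exact one_ne_zero
      · rw [eval_add, eval_reg, h11, eval_lit]
        omega
      · rw [AState.setReg_reg, eval_add, eval_reg, h11, eval_lit]
    · rintro s ⟨h2, h3, h11, h12, h13, hmem⟩
      rw [eval_lt', eval_pow, eval_reg, eval_reg, h11, h12, Nat.sub_add_cancel hq,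
        if_neg (by omega)]
    · exact ⟨rfl, rfl, rfl, rfl, rfl, rfl⟩
    · rintro s ⟨h2, h3, h11, h12, h13, hmem⟩
      have h11' : s.reg 11 = q := by omega
      have e0 : ((Expr.reg 11).pow k).eval s = q ^ k := by rw [eval_pow, eval_reg, h11']
      refine Cmd.Tri.seq (Cmd.Tri.assign ?_ (Cmd.Tri.assign ?_
        ⟨⟨h2, h3, h11, h12, h13, hmem⟩, e0, ?_⟩))
      · rw [e0]
        omega
      · change 2 * s.reg 11 < V
        omega
      · change 2 * s.reg 11 = _
        omega
  · rintro σ ⟨⟨h2, h3, h11, h12, h13, hmem⟩, h0, h1⟩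
    rw [Nat.sub_add_cancel hq] at h11
    refine ⟨⟨h0, h1, h2, ?_, fun P => Iff.rfl, ?_, ?_⟩, h3⟩
    · intro i hi
      rw [hmem]
      simp only
      rw [List.getD_eq_default _ _ (by omega)]
    · intro s hr hs ha hy p
      change 2 * (s.reg 8 % s.reg 11) + s.mem (2 + (p.1 * s.reg 12 + s.reg 8 % s.reg 12) *
        s.reg 13 + s.reg 9) = 2 * (s.reg 8 % q) + x.entry p.1 (s.reg 8) (s.reg 9)
      rw [hr 11 (by decide), hr 12 (by decide), hr 13 (by decide), h11, h12, h13, hs, hmem]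
      · rfl
      · rw [h3]
        rcases Nat.eq_zero_or_pos x.n with hn | hn
        · have hq1 : q = 1 := by
            by_contra hne
            exact Nat.not_lt_zero _ (hn ▸ hmin 1 le_rfl (by omega))
          have h8 : s.reg 8 = 0 := by
            rw [hq1, one_pow] at ha
            omega
          rw [hn, h8]
          simp only [Nat.mul_zero, Nat.zero_mod, Nat.add_zero, Nat.zero_mul]
          split_ifs at hy <;> omega
        · have h4 : (p.1 : ℕ) * x.n + s.reg 8 % x.n + 1 ≤ k * x.n := by
            have h5 := Nat.mul_le_mul_right x.n p.1.2
            have h6 := Nat.mod_lt (s.reg 8) hn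
            rw [Nat.succ_mul] at h5
            omega
          have h5 := Nat.mul_le_mul_right x.d h4
          rw [Nat.succ_mul, Nat.mul_assoc k] at h5
          split_ifs at hy <;> omega
    · intro s hr hs hx
      change (Expr.reg 12 * listSum ((List.finRange k).map fun t : Fin k =>
        neg (digit (.reg 1) t.val (.reg 6) % .lit 2))).eval s ≠ 0 ↔ _
      rw [eval_mul, mul_ne_zero_iff, eval_reg, hr 12 (by decide), h12, listSum_ne_zero]
      refine and_congr Iff.rfl ?_
      constructor
      · rintro ⟨e, he, hne⟩
        obtain ⟨t, -, rfl⟩ := List.mem_map.1 he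
        rw [eval_neg_ne_zero, eval_mod, eval_digit, eval_reg, eval_reg, hr 1 (by decide), h1] at hne
        exact ⟨t, hne⟩
      · rintro ⟨t, ht⟩
        refine ⟨_, List.mem_map.2 ⟨t, List.mem_finRange t, rfl⟩, ?_⟩
        rw [eval_neg_ne_zero, eval_mod, eval_digit, eval_reg, eval_reg, hr 1 (by decide), h1]
        exact ht

/-- With radix `2 * q` and `N = q ^ k` there are `O(d * q ^ k)` vertices and `O(d * q ^ (2 * k -
1))` edges, where `d` counts the added layer for dimension zero. Only the upper bound on `q ^ k` is
left visible to the estimate of `T`. -/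
theorem ov_of_pds {k : ℕ} (hk : 2 ≤ k) {T : GraphInput → ℝ}
    (hp : SolvableInTime (partialDominatingSet k) T) (δ : ℝ) : ∃ K₀ : ℕ,
    ∀ (T' : (orthogonalVectors k δ).Instance → ℝ) (_ : ∀ x, 0 ≤ T' x) (K : ℝ)
    (_ : ∀ x, ∀ q : ℕ, 1 ≤ q → q ^ k ≤ 2 ^ k * (x.1.n + 1) →
      ((x.1.d : ℝ) + 1) * q ^ (2 * k - 1) ≤ K * (T' x + 1) ∧
      ∀ G : GraphInput, G.n ≤ K₀ * ((x.1.d + 1) * q ^ k) →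
        G.m ≤ K₀ * ((x.1.d + 1) * q ^ (2 * k - 1)) → T G ≤ K * (T' x + 1)),
    SolvableInTime (orthogonalVectors k δ) T' := by
  classical
  obtain ⟨B, hB⟩ : ∃ B, B = buildConst k k 1 := ⟨_, rfl⟩
  refine ⟨B * 3 ^ k, fun T' hT' K H => ?_⟩
  refine SolvableInTime.of_gadget (P := orthogonalVectors k δ) hp hk (by omega) (ovCode k)
    (ovPrep k) (B * 8 ^ k + 4 ^ k + k + 5 + k + 3)
    (le_trans (by norm_num) (Nat.le_add_left 3 _)) ((k + 16 + 2 ^ k) * K) T' hT' fun x => ?_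
  obtain ⟨q, hq, hnq, hqn, hmin⟩ := exists_min_root (k := k) (by omega) x.1.n
  have hkey := H x q hq hqn
  set d := x.1.d + if x.1.d = 0 then 1 else 0 with hd
  have hd1 : 1 ≤ d := by
    rw [hd]
    split_ifs <;> omega
  have hdle : d ≤ x.1.d + 1 := by
    rw [hd]
    split_ifs <;> omega
  have hqk : q ≤ q ^ k := Nat.le_self_pow (by omega) _
  have hpow : q ^ k ≤ q ^ (2 * k - 1) := Nat.pow_le_pow_right hq (by omega)
  have hQ : q ^ k * (2 * q) ^ (k - 1) = 2 ^ (k - 1) * q ^ (2 * k - 1) := by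
    rw [mul_pow, mul_left_comm, ← pow_add]
    congr 2
    omega
  have h2k : 2 ^ (k - 1) ≤ 2 ^ k := Nat.pow_le_pow_right (by norm_num) (by omega)
  have h23 : 2 ^ k ≤ 3 ^ k := Nat.pow_le_pow_left (by norm_num) _
  obtain ⟨X, hX⟩ : ∃ X, X = inputSize x.1.encode + 2 := ⟨_, rfl⟩
  have hXn : x.1.n + 1 ≤ X := by
    have : x.1.encode.getD 0 0 ≤ inputSize x.1.encode := getD_le_inputSize _ _
    have h2 : x.1.encode.getD 0 0 = x.1.n := rfl
    omega
  have hXd : x.1.d + 1 ≤ X := by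
    have : x.1.encode.getD 1 0 ≤ inputSize x.1.encode := getD_le_inputSize _ _
    have h2 : x.1.encode.getD 1 0 = x.1.d := rfl
    omega
  have hV : k * (x.1.n * x.1.d) + x.1.d + 3 + x.1.n + q ^ k + 2 * q +
      B * (d * q ^ k * (2 * q) ^ k) < X ^ (B * 8 ^ k + 4 ^ k + k + 5 + k + 3) := by
    have hX2 : X ≤ X ^ 3 := Nat.le_self_pow (by norm_num) _
    have hX22 : X * X ≤ X ^ 3 := by
      rw [← pow_two]
      exact Nat.pow_le_pow_right (by omega) (by norm_num)
    have h1 : x.1.n * x.1.d ≤ X ^ 3 := (Nat.mul_le_mul (by omega) (by omega)).trans hX22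
    have h2 : q ^ k ≤ 2 ^ k * X := hqn.trans (Nat.mul_le_mul_left _ hXn)
    have h3 : q ^ k ≤ 2 ^ k * X ^ 3 := h2.trans (Nat.mul_le_mul_left _ hX2)
    have h4 : d * q ^ k * (2 * q) ^ k ≤ 8 ^ k * X ^ 3 := by
      calc d * q ^ k * (2 * q) ^ k = d * q ^ k * (2 ^ k * q ^ k) := by rw [mul_pow]
        _ ≤ X * (2 ^ k * X) * (2 ^ k * (2 ^ k * X)) := by gcongr; omega
        _ = (2 * 2 * 2) ^ k * X ^ 3 := by
          rw [mul_pow, mul_pow]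
          ring
        _ = _ := by norm_num
    have h5 := Nat.mul_le_mul_left B h4
    have h6 := Nat.mul_le_mul_left k h1
    have h7 : 3 * 2 ^ k * X ^ 3 ≤ (4 ^ k + k + 1) * X ^ 3 := by
      refine Nat.mul_le_mul_right _ ?_
      have h8 : 2 ^ k * 4 ≤ 2 ^ k * 2 ^ k :=
        Nat.mul_le_mul_left _ (Nat.pow_le_pow_right (n := 2) (by norm_num) hk)
      rw [← mul_pow] at h8
      norm_num at h8
      omega
    have h9 : (B * 8 ^ k + 4 ^ k + k + 5 + k) * X ^ 3 < X ^ (B * 8 ^ k + 4 ^ k + k + 5 + k + 3) := by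
      rw [pow_add]
      exact Nat.mul_lt_mul_of_pos_right (Nat.lt_pow_self (by omega)) (pow_pos (by omega) _)
    have e1 : (B * 8 ^ k + 4 ^ k + k + 5 + k) * X ^ 3 =
      B * (8 ^ k * X ^ 3) + (4 ^ k + k + 1) * X ^ 3 + k * X ^ 3 + 4 * X ^ 3 := by ring
    have e2 : 3 * 2 ^ k * X ^ 3 = 3 * (2 ^ k * X ^ 3) := by ring
    omega
  obtain ⟨σ, hex, hc, hσ3⟩ := tri_ovPrep (V := X ^ (B * 8 ^ k + 4 ^ k + k + 5 + k + 3)) x.1 hq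
    hnq hmin (by
      have := Nat.zero_le (B * (d * q ^ k * (2 * q) ^ k))
      omega)
  rw [hX] at hex hV
  refine ⟨q ^ k, 2 * q, d, x.1.rawData q, σ, _, Nat.one_le_pow _ _ hq, by omega, hd1, hex, hc,
    ?_, ?_, ?_, ?_, ?_⟩
  · rw [hσ3, ← hB]
    change _ < (inputSize x.1.encode + 2) ^ _
    omega
  · intro y _ s v
    -- Halving a value recovers the label, which occurs for `q ^ (k - 1)` candidates.
    calc #{a : Fin (q ^ k) | (x.1.rawData q).val y s a = v}
        ≤ #{a : Fin (q ^ k) | (a : ℕ) % q = v / 2} := by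
          refine card_le_card fun a ha => ?_
          rw [mem_filter] at ha ⊢
          refine ⟨ha.1, ?_⟩
          have h1 : 2 * ((a : ℕ) % q) + x.1.entry s.1 a y = v := ha.2
          have h2 := x.1.entry_le s.1 a y
          omega
      _ ≤ q ^ (k - 1) := card_mod_le (by omega) _
      _ ≤ (2 * q) ^ (k - 1) := Nat.pow_le_pow_left (by omega) _
  · exact if_congr (x.1.answer_eq (by omega) hnq).symm rfl rfl
  · rw [hσ3, mul_assoc d, hQ]
    have h1 : q * 2 + 8 + (k * (x.1.n * x.1.d) + x.1.d + 3) + d * (2 ^ (k - 1) * q ^ (2 * k - 1)) ≤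
        (k + 16 + 2 ^ k) * ((x.1.d + 1) * q ^ (2 * k - 1)) := by
      have h3 : x.1.n * x.1.d ≤ (x.1.d + 1) * q ^ (2 * k - 1) := by
        rw [mul_comm]
        exact Nat.mul_le_mul (by omega) (hnq.trans hpow)
      have h4 := Nat.mul_le_mul_left k h3
      have h5 : d * (2 ^ (k - 1) * q ^ (2 * k - 1)) ≤ 2 ^ k * ((x.1.d + 1) * q ^ (2 * k - 1)) := by
        rw [mul_left_comm]
        gcongr
      have h6 : x.1.d + 1 ≤ (x.1.d + 1) * q ^ (2 * k - 1) :=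
        Nat.le_mul_of_pos_right _ (pow_pos hq _)
      have h7 : q ^ (2 * k - 1) ≤ (x.1.d + 1) * q ^ (2 * k - 1) :=
        Nat.le_mul_of_pos_left _ (by omega)
      have e1 : (k + 16 + 2 ^ k) * ((x.1.d + 1) * q ^ (2 * k - 1)) =
        k * ((x.1.d + 1) * q ^ (2 * k - 1)) + 16 * ((x.1.d + 1) * q ^ (2 * k - 1)) +
          2 ^ k * ((x.1.d + 1) * q ^ (2 * k - 1)) := by ring
      omega
    calc ((q * 2 + 8 + (k * (x.1.n * x.1.d) + x.1.d + 3) +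
        d * (2 ^ (k - 1) * q ^ (2 * k - 1)) : ℕ) : ℝ)
          ≤ ((k + 16 + 2 ^ k) * ((x.1.d + 1) * q ^ (2 * k - 1)) : ℕ) := by exact_mod_cast h1
      _ = (k + 16 + 2 ^ k) * (((x.1.d : ℝ) + 1) * q ^ (2 * k - 1)) := by push_cast; ring
      _ ≤ (k + 16 + 2 ^ k) * (K * (T' x + 1)) := by
          refine mul_le_mul_of_nonneg_left hkey.1 ?_
          positivity
      _ = _ := by ring
  · intro G hn hm
    rw [← hB] at hn hm
    have h0 : (0 : ℝ) ≤ (x.1.d : ℝ) + 1 := add_nonneg (Nat.cast_nonneg _) zero_le_one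
    have h1 : 0 ≤ K * (T' x + 1) :=
      le_trans (mul_nonneg h0 (pow_nonneg (Nat.cast_nonneg q) _)) hkey.1
    have hn' : G.n ≤ B * 3 ^ k * ((x.1.d + 1) * q ^ k) := by
      refine le_trans hn ?_
      have e1 : B * 3 ^ k * ((x.1.d + 1) * q ^ k) = B * ((x.1.d + 1) * (3 ^ k * q ^ k)) := by ring
      rw [e1, mul_pow]
      refine Nat.mul_le_mul_left _ (Nat.mul_le_mul hdle ?_)
      have h8 : 1 + 2 ^ k ≤ 3 ^ k := by
        have := Nat.pow_lt_pow_left (show 2 < 3 by norm_num) (show k ≠ 0 by omega)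
        omega
      calc q ^ k + 2 ^ k * q ^ k = (1 + 2 ^ k) * q ^ k := by ring
        _ ≤ _ := Nat.mul_le_mul_right _ h8
    have hm' : G.m ≤ B * 3 ^ k * ((x.1.d + 1) * q ^ (2 * k - 1)) := by
      rw [mul_assoc d, hQ] at hm
      refine le_trans hm ?_
      have e1 : B * 3 ^ k * ((x.1.d + 1) * q ^ (2 * k - 1)) =
        B * ((x.1.d + 1) * (3 ^ k * q ^ (2 * k - 1))) := by ring
      rw [e1]
      exact Nat.mul_le_mul_left _ (Nat.mul_le_mul hdle (Nat.mul_le_mul_right _ (h2k.trans h23)))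
    refine le_trans (hkey.2 G hn' hm') ?_
    have h2 : 0 ≤ ((k : ℝ) + 15 + 2 ^ k) * (K * (T' x + 1)) :=
      mul_nonneg (add_nonneg (add_nonneg (Nat.cast_nonneg _) (by norm_num))
        (pow_nonneg zero_le_two _)) h1
    linarith

end FineGrained


namespace FineGrained

/-! ### The exponent of matrix multiplication is at least two -/

/-- The functions of `G` can be computed with `T` operations. -/
def ComputedIn {X : Type} (inputs : Set (X → ℚ)) (T : ℕ) (G : Set (X → ℚ)) : Prop :=
  ∃ g : Fin T → X → ℚ, IsStraightLine inputs g ∧ G ⊆ inputs ∪ Set.range g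

namespace ComputedIn

variable {X : Type} {inputs G : Set (X → ℚ)} {T : ℕ}

theorem mono {G' : Set (X → ℚ)} (h : ComputedIn inputs T G) (hG : G' ⊆ G) :
    ComputedIn inputs T G' :=
  let ⟨g, h1, h2⟩ := h
  ⟨g, h1, hG.trans h2⟩

theorem extend (h : ComputedIn inputs T G) (f : X → ℚ)
    (hf : (∃ c : ℚ, f = fun _ => c) ∨ ∃ a ∈ inputs ∪ G, ∃ b ∈ inputs ∪ G,
      f = a + b ∨ f = a - b ∨ f = a * b) : ComputedIn inputs (T + 1) (insert f G) := by
  obtain ⟨g, h1, h2⟩ := h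
  have hG : inputs ∪ G ⊆ inputs ∪ Set.range g := Set.union_subset Set.subset_union_left h2
  refine ⟨Fin.snoc (α := fun _ => X → ℚ) g f, fun t => ?_, ?_⟩
  · induction t using Fin.lastCases with
    | last =>
      rw [Fin.snoc_last]
      have hsub : inputs ∪ G ⊆ inputs ∪
          Fin.snoc (α := fun _ => X → ℚ) g f '' {s | s < Fin.last T} := by
        refine hG.trans (Set.union_subset_union_right _ ?_)
        rintro _ ⟨s, rfl⟩
        exact ⟨s.castSucc, Fin.castSucc_lt_last s, Fin.snoc_castSucc ..⟩
      refine hf.imp_right ?_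
      rintro ⟨a, ha, b, hb, h⟩
      exact ⟨a, hsub ha, b, hsub hb, h⟩
    | cast t =>
      rw [Fin.snoc_castSucc]
      have hsub : inputs ∪ g '' {s | s < t} ⊆ inputs ∪
          Fin.snoc (α := fun _ => X → ℚ) g f '' {s | s < t.castSucc} := by
        refine Set.union_subset_union_right _ ?_
        rintro _ ⟨s, hs, rfl⟩
        exact ⟨s.castSucc, Fin.castSucc_lt_castSucc_iff.2 hs, Fin.snoc_castSucc ..⟩
      refine (h1 t).imp_right ?_
      rintro ⟨a, ha, b, hb, h⟩
      exact ⟨a, hsub ha, b, hsub hb, h⟩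
  · refine Set.insert_subset (Or.inr ⟨Fin.last T, Fin.snoc_last ..⟩) (h2.trans ?_)
    refine Set.union_subset_union_right _ ?_
    rintro _ ⟨s, rfl⟩
    exact ⟨s.castSucc, Fin.snoc_castSucc ..⟩

theorem sum_mul (h : ComputedIn inputs T G) (l : List ((X → ℚ) × (X → ℚ)))
    (hl : ∀ p ∈ l, p.1 ∈ inputs ∧ p.2 ∈ inputs) :
    ComputedIn inputs (T + (2 * l.length + 1)) (insert (l.map fun p => p.1 * p.2).sum G) := by
  induction l with
  | nil => exact h.extend _ (.inl ⟨0, rfl⟩)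
  | cons p l ih =>
    have hp := hl p (by simp)
    have h1 := (ih fun p hp => hl p (by simp [hp])).extend (p.1 * p.2)
      (.inr ⟨p.1, .inl hp.1, p.2, .inl hp.2, .inr (.inr rfl)⟩)
    have h2 := h1.extend (p.1 * p.2 + (l.map fun p => p.1 * p.2).sum)
      (.inr ⟨_, .inr (by simp), _, .inr (by simp), .inl rfl⟩)
    rw [List.map_cons, List.sum_cons]
    exact h2.mono (Set.insert_subset_insert fun f hf => by simp [hf])

end ComputedIn

/-- The schoolbook algorithm shows that the set of exponents is nonempty; the infimum of the empty
set would be `0`. -/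
theorem matMulInOps_cubic (n : ℕ) : MatMulInOps n (n * n * (2 * n + 1)) := by
  have key : ∀ ps : List (Fin n × Fin n), ComputedIn (matrixInputs n) (ps.length * (2 * n + 1))
      {f | ∃ p ∈ ps, f = fun M => (M.1 * M.2) p.1 p.2} := by
    intro ps
    induction ps with
    | nil =>
      rw [List.length_nil, zero_mul]
      exact ⟨Fin.elim0, fun t => t.elim0, by rintro f ⟨p, hp, -⟩; simp at hp⟩
    | cons p ps ih =>
      have h1 := ih.sum_mul ((List.finRange n).map fun l =>
        ((fun M => M.1 p.1 l), fun M => M.2 l p.2)) (by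
          intro q hq
          obtain ⟨l, -, rfl⟩ := List.mem_map.1 hq
          exact ⟨⟨_, _, .inl rfl⟩, ⟨_, _, .inr rfl⟩⟩)
      rw [List.length_map, List.length_finRange, ← Nat.succ_mul] at h1
      refine h1.mono ?_
      rintro f ⟨r, hr, rfl⟩
      rcases List.mem_cons.1 hr with rfl | hr
      · refine .inl ?_
        rw [List.map_map, ← Fin.sum_univ_def]
        funext M
        rw [Finset.sum_apply, Matrix.mul_apply]
        rfl
      · exact .inr ⟨r, hr, rfl⟩
  have hall := key (Finset.univ : Finset (Fin n × Fin n)).toList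
  rw [Finset.length_toList, Finset.card_univ, Fintype.card_prod, Fintype.card_fin] at hall
  obtain ⟨g, h1, h2⟩ := hall
  exact ⟨g, h1, fun i j => h2 ⟨(i, j), by simp, rfl⟩⟩

/-- No entry of the product is an input: it vanishes when one factor is zero, while the other factor
may consist of ones. The `n * n` entries are pairwise distinct functions, as multiplying the
identity by matrix units shows, so each needs its own operation. -/
theorem MatMulInOps.sq_le {n T : ℕ} (h : MatMulInOps n T) : n * n ≤ T := by
  obtain ⟨g, -, hg⟩ := h
  have hmem : ∀ p : Fin n × Fin n, ∃ t, g t = fun M => (M.1 * M.2) p.1 p.2 := by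
    intro p
    rcases hg p.1 p.2 with ⟨i, j, h | h⟩ | h
    · have := congrFun h (Matrix.of fun _ _ => 1, 0)
      simp at this
    · have := congrFun h (0, Matrix.of fun _ _ => 1)
      simp at this
    · exact h
  choose t ht using hmem
  have hinj : Function.Injective t := by
    intro p r hpr
    have h1 := ht r
    rw [← hpr, ht p] at h1
    have h2 := congrFun h1 (1, Matrix.single p.1 p.2 1)
    simp only [one_mul, Matrix.single_apply] at h2
    by_contra hne
    rw [if_pos (by simp), if_neg fun h => hne (Prod.ext h.1 h.2)] at h2
    exact one_ne_zero h2
  simpa using Fintype.card_le_of_injective t hinj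

/-- This makes the time allowed for finding a `2k`-clique at least about `n ^ 4` for `k ≥ 3`, which
leaves room for writing a graph with `O(n ^ 3)` edges. -/
theorem two_le_matMulExponent : 2 ≤ matMulExponent := by
  refine le_csInf ⟨3, 3, fun n => ⟨_, matMulInOps_cubic n, ?_⟩⟩ ?_
  · have h : n * n * (2 * n + 1) ≤ 3 * n ^ 3 := by
      rcases Nat.eq_zero_or_pos n with rfl | hn
      · simp
      · calc n * n * (2 * n + 1) ≤ n * n * (3 * n) := Nat.mul_le_mul_left _ (by omega)
          _ = _ := by ring
    rw [show (3 : ℝ) = ((3 : ℕ) : ℝ) by norm_num, Real.rpow_natCast]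
    exact_mod_cast h
  · rintro τ ⟨C, hC⟩
    by_contra! hτ
    have htend := (tendsto_rpow_atTop (show 0 < 2 - τ by linarith)).comp
      tendsto_natCast_atTop_atTop
    obtain ⟨n, hn1, hn⟩ := ((Filter.eventually_ge_atTop 1).and
      (htend.eventually_gt_atTop C)).exists
    obtain ⟨T, hT, hle⟩ := hC n
    have hn0 : (0 : ℝ) < n := by exact_mod_cast hn1
    have h1 : ((n : ℝ) ^ (2 : ℝ)) ≤ C * (n : ℝ) ^ τ := by
      refine le_trans ?_ hle
      rw [show (2 : ℝ) = ((2 : ℕ) : ℝ) by norm_num, Real.rpow_natCast, pow_two]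
      exact_mod_cast hT.sq_le
    have h2 : (n : ℝ) ^ (2 : ℝ) = (n : ℝ) ^ (2 - τ) * (n : ℝ) ^ τ := by
      rw [← Real.rpow_add hn0]
      ring_nf
    rw [h2] at h1
    have h3 := le_of_mul_le_mul_right h1 (Real.rpow_pos_of_pos hn0 _)
    exact absurd hn (not_lt.2 h3)

end FineGrained


namespace FineGrained

/-! ### Cliques as hypercliques -/

/-- A graph as a 2-uniform hypergraph. -/
def GraphInput.toHypergraph (x : GraphInput) : HypergraphInput 2 where
  n := x.n
  edges := x.edges.map fun e => {e.1, e.2}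
  nodup := by
    refine x.nodup.map_on ?_
    rintro ⟨a, b⟩ hab ⟨c, d⟩ hcd heq
    have h1 := ((x.mem_edges a b).1 hab).1
    have h2 := ((x.mem_edges c d).1 hcd).1
    have ha : a ∈ ({c, d} : Finset (Fin x.n)) := heq ▸ Finset.mem_insert_self _ _
    have hb : b ∈ ({c, d} : Finset (Fin x.n)) := heq ▸ by simp
    simp only [Finset.mem_insert, Finset.mem_singleton] at ha hb
    rcases ha with rfl | rfl <;> rcases hb with rfl | rfl
    · exact absurd h1 (lt_irrefl _)
    · rfl
    · exact absurd h1 h2.not_gt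
    · exact absurd h1 (lt_irrefl _)
  uniform e he := by
    obtain ⟨⟨a, b⟩, hab, rfl⟩ := List.mem_map.1 he
    exact Finset.card_pair ((x.mem_edges a b).1 hab).1.ne

theorem GraphInput.encode_toHypergraph (x : GraphInput) : x.toHypergraph.encode = x.encode := by
  have h1 : ∀ e ∈ x.edges, ((({e.1, e.2} : Finset (Fin x.n)).sort (· ≤ ·)).map Fin.val) =
      [(e.1 : ℕ), (e.2 : ℕ)] := by
    rintro ⟨a, b⟩ hab
    have hlt := ((x.mem_edges a b).1 hab).1
    rw [Finset.sort_insert _ (by simpa using hlt.le) (by simpa using hlt.ne)]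
    simp
  have h2 : x.toHypergraph.edges.flatMap (fun e => (e.sort (· ≤ ·)).map Fin.val) =
      x.edges.flatMap fun e => [(e.1 : ℕ), (e.2 : ℕ)] := by
    simp only [GraphInput.toHypergraph, List.flatMap_map]
    exact List.flatMap_congr h1
  rw [HypergraphInput.encode, GraphInput.encode, h2]
  simp [GraphInput.toHypergraph]

theorem GraphInput.answer_toHypergraph (x : GraphInput) (K : ℕ) :
    (hypercliqueDetection 2 K).answer x.toHypergraph = (cliqueDetection K).answer x := by
  have hadj : ∀ a b : Fin x.n, x.graph.Adj a b →
      ({a, b} : Finset (Fin x.n)) ∈ x.toHypergraph.edges := by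
    intro a b hab
    rcases lt_or_gt_of_ne hab.ne with h | h
    · exact List.mem_map.2 ⟨(a, b), (x.mem_edges a b).2 ⟨h, hab⟩, rfl⟩
    · exact List.mem_map.2 ⟨(b, a), (x.mem_edges b a).2 ⟨h, hab.symm⟩, Finset.pair_comm _ _⟩
  have hclique : ∀ S : Finset (Fin x.n), (S.card = K ∧ ∀ e : Finset (Fin x.n), e ⊆ S →
      e.card = 2 → e ∈ x.toHypergraph.edges) ↔ x.graph.IsNClique K S := by
    intro S
    rw [SimpleGraph.isNClique_iff, and_comm]
    refine and_congr ?_ Iff.rfl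
    constructor
    · intro H a ha b hb hne
      have hmem := H {a, b} (by
        intro v hv
        rcases Finset.mem_insert.1 hv with rfl | hv
        · exact ha
        · exact Finset.mem_singleton.1 hv ▸ hb) (Finset.card_pair hne)
      obtain ⟨⟨c, d⟩, hcd, heq⟩ := List.mem_map.1 hmem
      have hcd' := ((x.mem_edges c d).1 hcd).2
      have ha' : a ∈ ({c, d} : Finset (Fin x.n)) := heq ▸ Finset.mem_insert_self _ _
      have hb' : b ∈ ({c, d} : Finset (Fin x.n)) := heq ▸ by simp
      simp only [Finset.mem_insert, Finset.mem_singleton] at ha' hb'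
      rcases ha' with rfl | rfl <;> rcases hb' with rfl | rfl
      · exact absurd rfl hne
      · exact hcd'
      · exact hcd'.symm
      · exact absurd rfl hne
    · intro H e he hcard
      obtain ⟨a, b, hab, rfl⟩ := Finset.card_eq_two.1 hcard
      exact hadj a b (H (he (by simp)) (he (by simp)) hab)
  classical
  exact if_congr (exists_congr hclique) rfl rfl

/-- The same program works: a graph and its 2-uniform hypergraph have literally the same encoding,
because edges are listed with the smaller endpoint first. -/
theorem clique_of_hyperclique {K : ℕ} {τ : ℝ}
    (h : SolvableInTime (hypercliqueDetection 2 K) fun x : HypergraphInput 2 => (x.n : ℝ) ^ τ) :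
    SolvableInTime (cliqueDetection K) fun x : GraphInput => (x.n : ℝ) ^ τ := by
  obtain ⟨p, C, c, H⟩ := h
  refine ⟨p, C, c, fun x => ?_⟩
  obtain ⟨t, s, hrun, hans, ht⟩ := H (GraphInput.toHypergraph x)
  refine ⟨t, s, ?_, hans.trans (GraphInput.answer_toHypergraph x K), ht⟩
  have he : (hypercliqueDetection 2 K).encode (GraphInput.toHypergraph x) =
    (cliqueDetection K).encode x := GraphInput.encode_toHypergraph x
  rwa [he] at hrun

/-! ### Growth of running times -/

/-- The base is `0` or at least `1`, as are numbers of vertices and edges, so a negative exponent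
may be replaced by `0`. The summand `1` in the constant covers the base `0`, including `0 ^ 0 = 1`.
-/
theorem rpow_le_of_le_mul_rpow {b y K s E τ : ℝ} (hb : b = 0 ∨ 1 ≤ b) (hK : 0 ≤ K) (hy : 1 ≤ y)
    (hle : b ≤ K * y ^ s) (hτ : s * max E 0 ≤ τ) (hτ0 : 0 ≤ τ) :
    b ^ E ≤ (1 + K ^ max E 0) * y ^ τ := by
  have hy0 : 0 ≤ y := zero_le_one.trans hy
  have h1 : 1 ≤ y ^ τ := Real.one_le_rpow hy hτ0
  have h2 : 0 ≤ K ^ max E 0 := Real.rpow_nonneg hK _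
  have h3 : 1 ≤ (1 + K ^ max E 0) * y ^ τ := by nlinarith
  rcases hb with rfl | hb
  · refine le_trans ?_ h3
    by_cases hE : E = 0
    · simp [hE]
    · rw [Real.zero_rpow hE]
      exact zero_le_one
  · calc b ^ E ≤ b ^ max E 0 := Real.rpow_le_rpow_of_exponent_le hb (le_max_left _ _)
      _ ≤ (K * y ^ s) ^ max E 0 :=
        Real.rpow_le_rpow (zero_le_one.trans hb) hle (le_max_right _ _)
      _ = K ^ max E 0 * y ^ (s * max E 0) := by
        rw [Real.mul_rpow hK (Real.rpow_nonneg hy0 _), ← Real.rpow_mul hy0]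
      _ ≤ K ^ max E 0 * y ^ τ := by
        gcongr
      _ ≤ _ := by nlinarith

/-- If `n ≤ O(y ^ a)` and `m ≤ O(y ^ b)` then `T n m ≤ O(y ^ τ)`. -/
def GrowthBound (T : ℝ → ℝ → ℝ) (a b τ : ℝ) : Prop :=
  ∀ K₀ : ℝ, 0 ≤ K₀ → ∃ K : ℝ, 0 ≤ K ∧ ∀ y : ℝ, 1 ≤ y → ∀ n m : ℕ, (n : ℝ) ≤ K₀ * y ^ a →
    (m : ℝ) ≤ K₀ * y ^ b → T n m ≤ K * y ^ τ

theorem cast_eq_zero_or_one_le (n : ℕ) : (n : ℝ) = 0 ∨ 1 ≤ (n : ℝ) := by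
  rcases Nat.eq_zero_or_pos n with h | h
  · exact .inl (by exact_mod_cast h)
  · exact .inr (by exact_mod_cast h)

/-- The bound on the number of vertices alone suffices. In the applications the term with the edges
has at most the same order, so nothing is lost. -/
theorem growthBound_min {e E a b τ : ℝ} (he : 0 < e) (hτ : a * max E 0 ≤ τ) (hτ0 : 0 ≤ τ) :
    GrowthBound (fun n m => min n (m ^ e) ^ E) a b τ := by
  refine fun K₀ hK₀ => ⟨1 + K₀ ^ max E 0, add_nonneg zero_le_one (Real.rpow_nonneg hK₀ _),
    fun y hy n m hn _ => ?_⟩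
  refine rpow_le_of_le_mul_rpow ?_ hK₀ hy ((min_le_left _ _).trans hn) hτ hτ0
  rcases cast_eq_zero_or_one_le n with h | h
  · left
    rw [h]
    exact min_eq_left (Real.rpow_nonneg (Nat.cast_nonneg _) _)
  · rcases cast_eq_zero_or_one_le m with h' | h'
    · left
      rw [h', Real.zero_rpow he.ne']
      exact min_eq_right (Nat.cast_nonneg _)
    · exact .inr (le_min h (Real.one_le_rpow h' he.le))

theorem growthBound_edges {E a b τ : ℝ} (hτ : b * max E 0 ≤ τ) (hτ0 : 0 ≤ τ) :
    GrowthBound (fun _ m => m ^ E) a b τ :=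
  fun K₀ hK₀ => ⟨1 + K₀ ^ max E 0, add_nonneg zero_le_one (Real.rpow_nonneg hK₀ _),
    fun _ hy _ m _ hm => rpow_le_of_le_mul_rpow (cast_eq_zero_or_one_le m) hK₀ hy hm hτ hτ0⟩

theorem growthBound_mul {E a b τ : ℝ} (ha : 0 ≤ a) (hτ : b + a * max E 0 ≤ τ) :
    GrowthBound (fun n m => m * n ^ E) a b τ := by
  intro K₀ hK₀
  have h1 : 0 ≤ 1 + K₀ ^ max E 0 := add_nonneg zero_le_one (Real.rpow_nonneg hK₀ _)
  refine ⟨K₀ * (1 + K₀ ^ max E 0), mul_nonneg hK₀ h1, fun y hy n m hn hm => ?_⟩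
  have hy0 : 0 < y := zero_lt_one.trans_le hy
  have h2 := rpow_le_of_le_mul_rpow (cast_eq_zero_or_one_le n) hK₀ hy hn le_rfl
    (mul_nonneg ha (le_max_right E 0))
  calc (m : ℝ) * (n : ℝ) ^ E
      ≤ (K₀ * y ^ b) * ((1 + K₀ ^ max E 0) * y ^ (a * max E 0)) := by gcongr
    _ = K₀ * (1 + K₀ ^ max E 0) * y ^ (b + a * max E 0) := by
      rw [Real.rpow_add hy0]
      ring
    _ ≤ _ := by
      gcongr

/-- The gadget sizes are powers of `n + 1`. The summand `1` on the right, present in the definition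
of solvability, takes care of `n = 0`. -/
theorem cast_add_one_rpow_le (n : ℕ) {τ : ℝ} (hτ : 0 ≤ τ) :
    ((n : ℝ) + 1) ^ τ ≤ 2 ^ τ * ((n : ℝ) ^ τ + 1) := by
  have h2 : (1 : ℝ) ≤ 2 ^ τ := Real.one_le_rpow one_le_two hτ
  have hn : 0 ≤ (n : ℝ) ^ τ := Real.rpow_nonneg (Nat.cast_nonneg _) _
  rcases cast_eq_zero_or_one_le n with h | h
  · rw [h, zero_add, Real.one_rpow]
    have : (0 : ℝ) ≤ 0 ^ τ := Real.rpow_nonneg le_rfl _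
    nlinarith
  · calc ((n : ℝ) + 1) ^ τ ≤ (2 * n) ^ τ := by
          gcongr
          linarith
      _ = 2 ^ τ * (n : ℝ) ^ τ := Real.mul_rpow zero_le_two (Nat.cast_nonneg _)
      _ ≤ _ := by nlinarith

theorem GrowthBound.total {T : ℝ → ℝ → ℝ} {a b τ : ℝ} (hT : GrowthBound T a b τ) (ha : a ≤ τ)
    (hb : b ≤ τ) : GrowthBound (fun n m => n + m + T n m) a b τ := by
  intro K₀ hK₀
  obtain ⟨K, hK, H⟩ := hT K₀ hK₀
  refine ⟨2 * K₀ + K, by positivity, fun y hy n m hn hm => ?_⟩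
  have h1 : K₀ * y ^ a ≤ K₀ * y ^ τ :=
    mul_le_mul_of_nonneg_left (Real.rpow_le_rpow_of_exponent_le hy ha) hK₀
  have h2 : K₀ * y ^ b ≤ K₀ * y ^ τ :=
    mul_le_mul_of_nonneg_left (Real.rpow_le_rpow_of_exponent_le hy hb) hK₀
  have h3 := H y hy n m hn hm
  simp only
  linarith

theorem hyperclique_of_growthBound {h k : ℕ} (hh : 2 ≤ h) (hk : 1 ≤ k) {T : ℝ → ℝ → ℝ}
    (hp : PDSInTime k T) {τ : ℝ} (hτ : 2 * (h : ℝ) - 1 ≤ τ)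
    (hT : GrowthBound T h (2 * h - 1) τ) :
    SolvableInTime (hypercliqueDetection h (k * h))
      fun x : HypergraphInput h => (x.n : ℝ) ^ τ := by
  have hh' : (2 : ℝ) ≤ h := by exact_mod_cast hh
  obtain ⟨K₀, H⟩ := hyperclique_of_pds hh hk hp
  obtain ⟨K, hK, hG⟩ := hT.total (by linarith) hτ K₀ (Nat.cast_nonneg _)
  have hτ0 : 0 ≤ τ := by linarith
  refine H _ (fun x => Real.rpow_nonneg (Nat.cast_nonneg _) _) ((1 + K) * 2 ^ τ) fun x => ?_
  have hy : (1 : ℝ) ≤ (x.n : ℝ) + 1 := le_add_of_nonneg_left (Nat.cast_nonneg _)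
  have e1 : ((x.n : ℝ) + 1) ^ (2 * h - 1) = ((x.n : ℝ) + 1) ^ (2 * (h : ℝ) - 1) := by
    rw [← Real.rpow_natCast, Nat.cast_sub (by omega)]
    push_cast
    rfl
  have e2 : ((x.n : ℝ) + 1) ^ h = ((x.n : ℝ) + 1) ^ (h : ℝ) := (Real.rpow_natCast _ _).symm
  have hpow : 0 ≤ ((x.n : ℝ) + 1) ^ τ := Real.rpow_nonneg (zero_le_one.trans hy) _
  have hbd := mul_le_mul_of_nonneg_left (cast_add_one_rpow_le x.n hτ0)
    (add_nonneg zero_le_one hK)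
  rw [← mul_assoc] at hbd
  refine ⟨?_, fun G hn hm => ?_⟩
  · refine le_trans ?_ hbd
    rw [e1]
    have := Real.rpow_le_rpow_of_exponent_le hy hτ
    nlinarith
  · refine le_trans ?_ hbd
    have hn' : (G.n : ℝ) ≤ K₀ * ((x.n : ℝ) + 1) ^ (h : ℝ) := by
      rw [← e2]
      exact_mod_cast hn
    have hm' : (G.m : ℝ) ≤ K₀ * ((x.n : ℝ) + 1) ^ (2 * (h : ℝ) - 1) := by
      rw [← e1]
      exact_mod_cast hm
    have := hG _ hy G.n G.m hn' hm'
    refine this.trans ?_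
    nlinarith

theorem ov_of_growthBound {k : ℕ} (hk : 2 ≤ k) {T : ℝ → ℝ → ℝ} (hp : PDSInTime k T) {δ τ : ℝ}
    (hδ : 0 < δ) (hτ : 2 - 1 / (k : ℝ) + δ ≤ τ)
    (hT : GrowthBound T (1 + δ) (2 - 1 / (k : ℝ) + δ) τ) :
    SolvableInTime (orthogonalVectors k δ) fun x => (x.1.n : ℝ) ^ τ := by
  have hk0 : (0 : ℝ) < k := by exact_mod_cast (by omega : 0 < k)
  have hk1 : 1 / (k : ℝ) ≤ 1 := by
    rw [div_le_one hk0]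
    exact_mod_cast (by omega : 1 ≤ k)
  obtain ⟨K₀, H⟩ := ov_of_pds hk hp δ
  -- One factor `2` comes from `d + 1 ≤ 2 * y ^ δ`, the power from `q ≤ 2 * y ^ (1 / k)` raised to
  -- `2 * k - 1`.
  set c : ℝ := 2 * 2 ^ (2 * k - 1) with hc
  have hc0 : 0 ≤ c := by positivity
  have hck : 2 * 2 ^ k ≤ c := by
    rw [hc]
    gcongr
    · norm_num
    · omega
  obtain ⟨K, hK, hG⟩ := hT.total (by linarith) hτ (K₀ * c) (mul_nonneg (Nat.cast_nonneg _) hc0)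
  have hτ0 : 0 ≤ τ := by linarith
  refine H _ (fun x => Real.rpow_nonneg (Nat.cast_nonneg _) _) ((c + K) * 2 ^ τ)
    fun x q hq hqn => ?_
  obtain ⟨y, hy⟩ : ∃ y, y = (x.1.n : ℝ) + 1 := ⟨_, rfl⟩
  have hy1 : 1 ≤ y := by
    rw [hy]
    exact le_add_of_nonneg_left (Nat.cast_nonneg _)
  have hy0 : 0 < y := zero_lt_one.trans_le hy1
  have hd : (x.1.d : ℝ) + 1 ≤ 2 * y ^ δ := by
    have h1 : (x.1.d : ℝ) ≤ y ^ δ := by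
      refine le_trans x.2 (Real.rpow_le_rpow (Nat.cast_nonneg _) ?_ hδ.le)
      rw [hy]
      exact le_add_of_nonneg_right zero_le_one
    have h2 : 1 ≤ y ^ δ := Real.one_le_rpow hy1 hδ.le
    linarith
  have hqk : (q : ℝ) ^ k ≤ 2 ^ k * y := by
    rw [hy]
    exact_mod_cast hqn
  have hq2 : (q : ℝ) ≤ 2 * y ^ (1 / (k : ℝ)) := by
    refine le_of_pow_le_pow_left₀ (n := k) (by omega)
      (mul_nonneg zero_le_two (Real.rpow_nonneg hy0.le _)) ?_
    rw [mul_pow, ← Real.rpow_natCast (y ^ _), ← Real.rpow_mul hy0.le, one_div,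
      inv_mul_cancel₀ hk0.ne', Real.rpow_one]
    exact hqk
  have hq3 : (q : ℝ) ^ (2 * k - 1) ≤ 2 ^ (2 * k - 1) * y ^ (2 - 1 / (k : ℝ)) := by
    refine (pow_le_pow_left₀ (Nat.cast_nonneg _) hq2 _).trans_eq ?_
    rw [mul_pow, ← Real.rpow_natCast (y ^ _), ← Real.rpow_mul hy0.le, Nat.cast_sub (by omega)]
    congr 2
    push_cast
    field_simp
  have hd0 : 0 ≤ (x.1.d : ℝ) + 1 := add_nonneg (Nat.cast_nonneg _) zero_le_one
  have hn0 : ((x.1.d : ℝ) + 1) * (q : ℝ) ^ k ≤ c * y ^ (1 + δ) := by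
    calc _ ≤ (2 * y ^ δ) * (2 ^ k * y) := mul_le_mul hd hqk (by positivity) (by positivity)
      _ = 2 * 2 ^ k * y ^ (1 + δ) := by
        rw [Real.rpow_add hy0, Real.rpow_one]
        ring
      _ ≤ _ := mul_le_mul_of_nonneg_right hck (by positivity)
  have hm0 : ((x.1.d : ℝ) + 1) * (q : ℝ) ^ (2 * k - 1) ≤ c * y ^ (2 - 1 / (k : ℝ) + δ) := by
    calc _ ≤ (2 * y ^ δ) * (2 ^ (2 * k - 1) * y ^ (2 - 1 / (k : ℝ))) :=
          mul_le_mul hd hq3 (by positivity) (by positivity)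
      _ = _ := by
        rw [Real.rpow_add hy0, hc]
        ring
  have hpow : 0 ≤ y ^ τ := Real.rpow_nonneg hy0.le _
  have hbd := mul_le_mul_of_nonneg_left (cast_add_one_rpow_le x.1.n hτ0) (add_nonneg hc0 hK)
  rw [← mul_assoc, ← hy] at hbd
  refine ⟨?_, fun G hn hm => ?_⟩
  · refine le_trans ?_ hbd
    have h1 := mul_le_mul_of_nonneg_left (Real.rpow_le_rpow_of_exponent_le hy1 hτ) hc0
    have h2 := mul_nonneg hK hpow
    rw [add_mul]
    linarith
  · refine le_trans ?_ hbd
    have hn' : (G.n : ℝ) ≤ K₀ * c * y ^ (1 + δ) := by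
      rw [mul_assoc]
      refine le_trans ?_ (mul_le_mul_of_nonneg_left hn0 (Nat.cast_nonneg _))
      exact_mod_cast hn
    have hm' : (G.m : ℝ) ≤ K₀ * c * y ^ (2 - 1 / (k : ℝ) + δ) := by
      rw [mul_assoc]
      refine le_trans ?_ (mul_le_mul_of_nonneg_left hm0 (Nat.cast_nonneg _))
      exact_mod_cast hm
    refine (hG _ hy1 G.n G.m hn' hm').trans ?_
    exact mul_le_mul_of_nonneg_right (le_add_of_nonneg_left hc0) hpow

/-! ### Choosing exponents -/

theorem not_cliqueHypothesis {k : ℕ} (hk : 3 ≤ k) {ε : ℝ} (hε : 0 < ε)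
    (hp : PDSInTime k (fun n m => min n (m ^ (2 / 3 : ℝ)) ^ (k * matMulExponent / 3 - ε))) :
    ¬ CliqueHypothesis := by
  intro H
  have hω := two_le_matMulExponent
  have hk' : (3 : ℝ) ≤ k := by exact_mod_cast hk
  have hkω : 6 ≤ k * matMulExponent := by nlinarith
  have hm1 := min_le_left (2 * ε) 1
  have hm2 := min_le_right (2 * ε) 1
  -- Squaring the number of vertices doubles the saving. Capping it at `1` keeps the target exponent
  -- at least `3`, the exponent of the number of edges.
  refine H (min (2 * ε) 1) (lt_min (by linarith) one_pos) (k * 2) (by omega)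
    (clique_of_hyperclique (hyperclique_of_growthBound le_rfl (by omega) hp ?_
      (growthBound_min (by norm_num) ?_ ?_)))
  · push_cast
    linarith
  · rw [mul_max_of_nonneg _ _ (Nat.cast_nonneg _), max_le_iff]
    push_cast
    constructor <;> linarith
  · push_cast
    linarith

/-- The number `a` is the exponent with which the relevant size of the gadget graph grows, so a
saving `ε` in `T` becomes `a * ε`: `a = h` for vertices, `a = 5 = 2 * 3 - 1` for edges with `h = 3`.
The cap at `1` keeps the target above the cost of writing the graph. -/
theorem not_hypercliqueHypothesis {h k : ℕ} (hh : 3 ≤ h) (hk : 2 ≤ k) {ε a : ℝ} (hε : 0 < ε)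
    {T : ℝ → ℝ → ℝ} (hp : PDSInTime k T) (ha : 0 < a)
    (hT : ∀ τ : ℝ, 0 ≤ τ → (k : ℝ) * h - a * ε ≤ τ → GrowthBound T h (2 * h - 1) τ) :
    ¬ HypercliqueHypothesis h := by
  intro H
  have hk' : (2 : ℝ) ≤ k := by exact_mod_cast hk
  have hh' : (3 : ℝ) ≤ h := by exact_mod_cast hh
  have hkh : 2 * (h : ℝ) ≤ k * h := by nlinarith
  have hm1 := min_le_left (a * ε) 1
  have hm2 := min_le_right (a * ε) 1
  refine H (min (a * ε) 1) (lt_min (mul_pos ha hε) one_pos) (k * h) ?_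
    (hyperclique_of_growthBound (by omega) (by omega) hp ?_ (hT _ ?_ ?_))
  · have := Nat.mul_le_mul_right h hk
    omega
  all_goals
    push_cast
    linarith

/-- Half of the saving is kept as `ε'`, and the dimension exponent `δ` is made so small that the
factor `n ^ δ` in the size of the graph, raised to a power of at most `k + 1`, costs no more than
the other half. -/
theorem not_ovHypothesis {k : ℕ} (hk : 2 ≤ k) {ε : ℝ} (hε : 0 < ε) {T : ℝ → ℝ → ℝ}
    (hp : PDSInTime k T) (hT : ∀ δ ε' : ℝ, 0 < δ → 0 < ε' → δ * (k + 1) ≤ ε' → 2 * ε' ≤ ε →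
      4 * ε' ≤ 1 → GrowthBound T (1 + δ) (2 - 1 / (k : ℝ) + δ) (k - ε')) : ¬ OVHypothesis k := by
  intro H
  have hk' : (2 : ℝ) ≤ k := by exact_mod_cast hk
  have hk1 : 0 < 1 / (k : ℝ) := by positivity
  obtain ⟨ε', hε', h1, h2⟩ : ∃ ε' : ℝ, 0 < ε' ∧ 2 * ε' ≤ ε ∧ 4 * ε' ≤ 1 := by
    refine ⟨min (ε / 2) (1 / 4), lt_min (by linarith) (by norm_num), ?_, ?_⟩
    · linarith [min_le_left (ε / 2) (1 / 4)]
    · linarith [min_le_right (ε / 2) (1 / 4)]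
  have hδ : 0 < ε' / (k + 1) := by positivity
  have hδ' : ε' / (k + 1) * (k + 1) = ε' := div_mul_cancel₀ _ (by positivity)
  refine H ε' hε' _ hδ (ov_of_growthBound hk hp hδ ?_ (hT _ _ hδ hε' hδ'.le h1 h2))
  -- For `k = 2` this is an equality; the remaining `1 / 2` accommodates both `δ` and `ε'`, which
  -- are at most `1 / 4`.
  have h3 : 2 - 1 / (k : ℝ) ≤ k - 1 / 2 := by
    rcases Nat.eq_or_lt_of_le hk with rfl | hk3
    · norm_num
    · have : (3 : ℝ) ≤ k := by exact_mod_cast hk3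
      linarith
  nlinarith

end FineGrained

theorem mainTheorem5 :
    (∀ k : ℕ, 3 ≤ k →
      (∃ ε : ℝ, 0 < ε ∧
        PDSInTime k (fun n m => min n (m ^ (2 / 3 : ℝ)) ^ (k * matMulExponent / 3 - ε))) →
      ¬ CliqueHypothesis) ∧
    (∀ h k : ℕ, 3 ≤ h → h < k →
      (∃ ε : ℝ, 0 < ε ∧
        PDSInTime k (fun n m => min n (m ^ ((h : ℝ) / (2 * h - 1))) ^ ((k : ℝ) - ε))) →
      ¬ HypercliqueHypothesis h) ∧
    (∀ k : ℕ, 2 ≤ k →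
      (∃ ε : ℝ, 0 < ε ∧
        PDSInTime k (fun n m => min n (m ^ ((k : ℝ) / (2 * k - 1))) ^ ((k : ℝ) - ε))) →
      ¬ OVHypothesis k) ∧
    (∀ k : ℕ, 3 ≤ k →
      (∃ ε : ℝ, 0 < ε ∧ PDSInTime k (fun n m => m * n ^ ((k : ℝ) - 2 - ε))) →
      ¬ OVHypothesis k) ∧
    (∀ k : ℕ, 3 ≤ k →
      (∃ ε : ℝ, 0 < ε ∧ PDSInTime k (fun _ m => m ^ (3 * (k : ℝ) / 5 - ε))) →
      ¬ HypercliqueHypothesis 3) := by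
  refine ⟨?_, ?_, ?_, ?_, ?_⟩
  · rintro k hk ⟨ε, hε, hp⟩
    exact not_cliqueHypothesis hk hε hp
  · rintro h k hh hk ⟨ε, hε, hp⟩
    have hh' : (3 : ℝ) ≤ h := by exact_mod_cast hh
    refine not_hypercliqueHypothesis hh (by omega) hε hp (a := h) (by linarith)
      fun τ hτ0 hτ => growthBound_min (div_pos (by linarith) (by linarith)) ?_ hτ0
    rw [mul_max_of_nonneg _ _ (by linarith), max_le_iff]
    constructor <;> linarith
  · rintro k hk ⟨ε, hε, hp⟩
    have hk' : (2 : ℝ) ≤ k := by exact_mod_cast hk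
    refine not_ovHypothesis hk hε hp fun δ ε' hδ hε' h1 h2 h3 =>
      growthBound_min (div_pos (by linarith) (by linarith)) ?_ (by linarith)
    rw [mul_max_of_nonneg _ _ (by linarith), max_le_iff]
    constructor
    · have := mul_pos hδ hε
      linarith
    · linarith
  · rintro k hk ⟨ε, hε, hp⟩
    have hk' : (3 : ℝ) ≤ k := by exact_mod_cast hk
    have hk1 : 0 < 1 / (k : ℝ) := by positivity
    refine not_ovHypothesis (by omega) hε hp fun δ ε' hδ hε' h1 h2 h3 =>
      growthBound_mul (by linarith) ?_
    -- If the exponent of `n` is nonnegative, the total is `2 - 1/k + δ + (1 + δ)(k - 2 - ε)`, which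
    -- is at most `k - ε + δ(k + 1)` and so at most `k - ε'`. If it is negative, `2 - 1/k + δ ≤ k -
    -- ε'` is what remains.
    rw [← le_sub_iff_add_le', mul_max_of_nonneg _ _ (by linarith), max_le_iff]
    constructor
    · have := mul_pos hδ hε
      linarith
    · nlinarith
  · rintro k hk ⟨ε, hε, hp⟩
    have hk' : (3 : ℝ) ≤ k := by exact_mod_cast hk
    refine not_hypercliqueHypothesis le_rfl (by omega) hε hp (a := 5) (by norm_num)
      fun τ hτ0 hτ => growthBound_edges ?_ hτ0
    rw [mul_max_of_nonneg _ _ (by norm_num), max_le_iff]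
    push_cast at hτ ⊢
    constructor <;> linarith
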